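/- Notation. $e(u)=e^{2\pi i u}$; $\widehat g(y)=\mathcal F g(y)=\int_{\mathbb R} g(x)\,e(-xy)\,dx$, extended to tempered distributions by $\int\widehat\sigma\,g\,dx=\int\sigma\,\widehat g\,dx$ for $g\in\mathcal S(\mathbb R)$; $\operatorname{sg}x$ is the sign of $x$. A distribution $\sigma$ on $\mathbb R$ *vanishes to order $k\ge 0$ at $0$* if on some open neighborhood $U$ of $0$ it can be written as a finite sum $\sigma=\sum_j f_jD_jh_j$ with $f_j\in C^\infty(U)$ vanishing to order $k$ at $0$, $h_j\in L^\infty_{\mathrm{loc}}(U)$, and $D_j$ linear differential operators on $U$ with $C^\infty$ coefficients which map functions vanishing to order $l$ at $0$ to functions vanishing to order $l$ at $0$, for every $l\ge 0$. It *vanishes to infinite order at $0$* if it vanishes to order $k$ for every $k$. A distribution on $\mathbb R\setminus\{0\}$ *extends canonically across $0$* if it is the restriction of a (necessarily unique) distribution on $\mathbb R$ which vanishes to infinite order at $0$. $\mathcal S_{\mathrm{sis}}(\mathbb R)$ is the space of functions $f\in C^\infty(\mathbb R\setminus\{0\})$ which decay rapidly as $|x|\to\infty$, along with all their derivatives, and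 which, for $0<|x|\ll1$, are finite sums of functions of the form $\sum_{0\le j\le n}(\operatorname{sg}x)^{\eta}|x|^{\alpha}(\log|x|)^jf_j(x)$ with $(\alpha,\eta)\in\mathbb C\times\mathbb Z/2\mathbb Z$ and $f_j$ of class $C^\infty$ near $0$. If $\sigma\in\mathcal S'(\mathbb R)$ and $f$ is a function on $\mathbb R\setminus\{0\}$ which is smooth and decays rapidly with all derivatives as $|x|\to\infty$, and if the distribution $f\sigma$ on $\mathbb R\setminus\{0\}$ extends canonically across $0$, with extension $\tau$, put $\int_{\mathbb R}f\sigma\,dx=\int\phi\,\tau\,dx+\int\bigl((1-\phi)f\bigr)\,\sigma\,dx$, where $\phi\in C_c^\infty(\mathbb R)$ is any function with $\phi\equiv1$ near $0$. Theorem. Let $\alpha\in\mathbb C$, $\eta\in\mathbb Z/2\mathbb Z$, let $f\in\mathcal S_{\mathrm{sis}}(\mathbb R)$, and let $\sigma\in\mathcal S'(\mathbb R)$ vanish to infinite order at $0$. Then: (i) the function $x\mapsto f(1/x)(\operatorname{sg}x)^\eta|x|^{-\alpha-1}$ (with value $0$ at $x=0$) is smooth and, along with each of its derivatives, grows at most polynomially;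 its Fourier transform as a tempered distribution agrees on $\mathbb R\setminus\{0\}$ with a unique $C^\infty$ function, denoted $T_{\alpha,\eta}(f)$; (ii) the distribution $(\operatorname{sg}x)^\eta|x|^{\alpha-1}\,\widehat\sigma(1/x)$ on $\mathbb R\setminus\{0\}$ extends canonically across $0$, and the extension, denoted $T^*_{\alpha,\eta}(\sigma)$, is tempered; (iii) the integrals $\int_{\mathbb R}T_{\alpha,\eta}(f)\,\sigma\,dx$ and $\int_{\mathbb R}f\,T^*_{\alpha,\eta}(\sigma)\,dx$ are well defined, and $$\int_{\mathbb R}T_{\alpha,\eta}(f)(x)\,\sigma(x)\,dx=\int_{\mathbb R}f(x)\,T^*_{\alpha,\eta}(\sigma)(x)\,dx .$$ -/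

import Mathlib

open MeasureTheory Set
open scoped SchwartzMap FourierTransform ContDiff

noncomputable section

/-- `(sg x)^η` for `η ∈ ℤ/2ℤ` (only used for `x ≠ 0`). -/
def sgPow (η : ZMod 2) (x : ℝ) : ℂ := ((Real.sign x : ℝ) : ℂ) ^ η.val

/-- `|x|^α` for complex `α` (only used for `x ≠ 0`). -/
def absPow (α : ℂ) (x : ℝ) : ℂ := ((|x| : ℝ) : ℂ) ^ α

/-! ### Distributions vanishing to infinite order at the origin -/

/-- A function, smooth near `0`, vanishes to order `k` at `0`. -/
def FunVanishesToOrder (k : ℕ) (φ : ℝ → ℂ) : Prop :=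
  ∀ i < k, iteratedDeriv i φ 0 = 0

/-- The differential operator `∑_{i ≤ m} a_i (d/dx)^i` applied to `φ`. -/
def diffOp (m : ℕ) (a : ℕ → ℝ → ℂ) (φ : ℝ → ℂ) (x : ℝ) : ℂ :=
  ∑ i ∈ Finset.range (m + 1), a i x * iteratedDeriv i φ x

/-- The formal transpose `φ ↦ ∑_{i ≤ m} (-1)^i (d/dx)^i (a_i φ)` of `∑_{i ≤ m} a_i (d/dx)^i`. -/
def diffOpTranspose (m : ℕ) (a : ℕ → ℝ → ℂ) (φ : ℝ → ℂ) (x : ℝ) : ℂ :=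
  ∑ i ∈ Finset.range (m + 1), (-1) ^ i * iteratedDeriv i (fun y => a i y * φ y) x

/-- A differential operator on the neighbourhood `U` of `0` with smooth coefficients `a_i` is
tangential to `{0}`: it preserves every power of the ideal of smooth functions vanishing at `0`. -/
def IsTangential (U : Set ℝ) (m : ℕ) (a : ℕ → ℝ → ℂ) : Prop :=
  ∀ (k : ℕ) (φ : ℝ → ℂ), ContDiffOn ℝ ∞ φ U →
    FunVanishesToOrder k φ → FunVanishesToOrder k (diffOp m a φ)

/-- The tempered distribution `σ` vanishes to order `k` at `0`: on some open neighbourhood `U` of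
`0`, `σ = ∑_j f_j D_j h_j` with `f_j` smooth and vanishing to order `k` at `0`, `D_j` a differential
operator tangential to `{0}`, and `h_j` measurable and locally bounded. The identity of
distributions on `U` is tested against `ψ ∈ C_c^∞(U)`. -/
def VanishesToOrder (k : ℕ) (σ : 𝓢'(ℝ, ℂ)) : Prop :=
  ∃ U : Set ℝ, IsOpen U ∧ (0 : ℝ) ∈ U ∧
    ∃ (N : ℕ) (m : Fin N → ℕ) (a : Fin N → ℕ → ℝ → ℂ) (f h : Fin N → ℝ → ℂ),
      (∀ j, ∀ i ≤ m j, ContDiffOn ℝ ∞ (a j i) U) ∧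
      (∀ j, IsTangential U (m j) (a j)) ∧
      (∀ j, ContDiffOn ℝ ∞ (f j) U ∧ FunVanishesToOrder k (f j)) ∧
      (∀ j, ∀ K ⊆ U, IsCompact K → MemLp (h j) ⊤ (volume.restrict K)) ∧
      ∀ ψ : 𝓢(ℝ, ℂ), HasCompactSupport ψ → tsupport ψ ⊆ U →
        σ ψ = ∑ j, ∫ x, h j x * diffOpTranspose (m j) (a j) (fun y => f j y * ψ y) x

/-- The tempered distribution `σ` vanishes to infinite order at `0`. -/
def VanishesToInfiniteOrder (σ : 𝓢'(ℝ, ℂ)) : Prop := ∀ k : ℕ, VanishesToOrder k σ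

/-- `ψ` is a test function with compact support in `ℝ - {0}`. -/
def IsTestOffZero (ψ : 𝓢(ℝ, ℂ)) : Prop := HasCompactSupport ψ ∧ (0 : ℝ) ∉ tsupport ψ

/-! ### Functions with simple singularities -/

/-- `f` has a singularity of type `(α, η)` at `0`. -/
def HasSingularityOfType (α : ℂ) (η : ZMod 2) (f : ℝ → ℂ) : Prop :=
  ∃ (n : ℕ) (F : ℕ → ℝ → ℂ) (ε : ℝ), 0 < ε ∧
    (∀ j ≤ n, ContDiffOn ℝ ∞ (F j) (Ioo (-ε) ε)) ∧
    ∀ x : ℝ, x ≠ 0 → |x| < ε →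
      f x = ∑ j ∈ Finset.range (n + 1),
        sgPow η x * absPow α x * ((Real.log |x| : ℝ) : ℂ) ^ j * F j x

/-- `f` has a simple singularity at `0`: near `0` it is a finite sum of functions which have
singularities of some types. -/
def HasSimpleSingularity (f : ℝ → ℂ) : Prop :=
  ∃ (m : ℕ) (α : Fin m → ℂ) (η : Fin m → ZMod 2) (g : Fin m → ℝ → ℂ),
    (∀ j, HasSingularityOfType (α j) (η j) (g j)) ∧
    ∃ ε : ℝ, 0 < ε ∧ ∀ x : ℝ, x ≠ 0 → |x| < ε → f x = ∑ j, g j x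

/-- The space `S_sis(ℝ)`. Its elements are functions on `ℝ - {0}`; the value at `0` is irrelevant. -/
structure IsSis (f : ℝ → ℂ) : Prop where
  smooth : ContDiffOn ℝ ∞ f {0}ᶜ
  simple : HasSimpleSingularity f
  decay : ∀ k n : ℕ, ∃ C : ℝ, ∀ x : ℝ, 1 ≤ |x| → |x| ^ k * ‖iteratedDeriv n f x‖ ≤ C

/-! ### The integration pairing -/

/-- `∫ f σ dx` exists and equals `c`: the distribution `f σ` on `ℝ - {0}` has a canonical extension
`τ` across `0`, i.e. one that vanishes to infinite order at `0`; and for any cutoff `φ ∈ C_c^∞(ℝ)`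
with `φ = 1` near `0`, `c = ∫ φ τ dx + ∫ ((1 - φ) f) σ dx`, where `(1 - φ) f` is a Schwartz
function. -/
def HasPairing (f : ℝ → ℂ) (σ : 𝓢'(ℝ, ℂ)) (c : ℂ) : Prop :=
  ∃ τ : 𝓢'(ℝ, ℂ), VanishesToInfiniteOrder τ ∧
    (∀ ψ : 𝓢(ℝ, ℂ), IsTestOffZero ψ →
      ∃ g : 𝓢(ℝ, ℂ), (∀ x, g x = f x * ψ x) ∧ τ ψ = σ g) ∧
    (∀ φ : 𝓢(ℝ, ℂ), HasCompactSupport φ → (∀ᶠ x in nhds (0 : ℝ), φ x = 1) →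
      ∃ g : 𝓢(ℝ, ℂ), (∀ x, g x = (1 - φ x) * f x) ∧ c = τ φ + σ g)

/-- The integral `∫ f σ dx` (meaningful if `∃! c, HasPairing f σ c`). -/
def pairing (f : ℝ → ℂ) (σ : 𝓢'(ℝ, ℂ)) : ℂ := Classical.epsilon (HasPairing f σ)

/-! ### The operators `T_{α,η}` and `T*_{α,η}` -/

/-- The function `x ↦ f(1/x) (sg x)^η |x|^{-α-1}`, extended by `0` to `x = 0`. -/
def invTwist (α : ℂ) (η : ZMod 2) (f : ℝ → ℂ) (x : ℝ) : ℂ :=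
  if x = 0 then 0 else f (1 / x) * sgPow η x * absPow (-α - 1) x

/-- `F = T_{α,η}(f)` as a function on `ℝ - {0}` (normalized by `F 0 = 0`): the function
`f(1/x) (sg x)^η |x|^{-α-1}` is smooth of temperate growth, and its Fourier transform, a tempered
distribution, coincides on `ℝ - {0}` with the smooth function `F`. -/
def IsTalpha (α : ℂ) (η : ZMod 2) (f F : ℝ → ℂ) : Prop :=
  F 0 = 0 ∧ ContDiffOn ℝ ∞ F {0}ᶜ ∧
    ∃ hg : (invTwist α η f).HasTemperateGrowth,
      ∀ ψ : 𝓢(ℝ, ℂ), IsTestOffZero ψ →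
        (𝓕 (hg.toTemperedDistribution : 𝓢'(ℝ, ℂ))) ψ = ∫ y, F y * ψ y

/-- `T_{α,η}(f)` (meaningful if `∃! F, IsTalpha α η f F`). -/
def Talpha (α : ℂ) (η : ZMod 2) (f : ℝ → ℂ) : ℝ → ℂ := Classical.epsilon (IsTalpha α η f)

/-- `ρ = T*_{α,η}(σ)`: `ρ` is the canonical extension across `0`, as a tempered distribution, of the
distribution `(sg x)^η |x|^{α-1} σ̂(1/x)` on `ℝ - {0}`. The integral of the latter against a test
function `ψ(x) dx` is, by the change of variables `x = 1/y`, the integral of `σ̂(y)` against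
`(sg y)^η |y|^{1-α} ψ(1/y) y^{-2} dy`. -/
def IsTstar (α : ℂ) (η : ZMod 2) (σ ρ : 𝓢'(ℝ, ℂ)) : Prop :=
  VanishesToInfiniteOrder ρ ∧
    ∀ ψ : 𝓢(ℝ, ℂ), IsTestOffZero ψ →
      ∃ g : 𝓢(ℝ, ℂ), (∀ y, g y = sgPow η y * absPow (1 - α) y * ψ (1 / y) * ((y : ℂ) ^ 2)⁻¹) ∧
        ρ ψ = (𝓕 σ) g

/-- `T*_{α,η}(σ)` (meaningful if `∃! ρ, IsTstar α η σ ρ`). -/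
def Tstar (α : ℂ) (η : ZMod 2) (σ : 𝓢'(ℝ, ℂ)) : 𝓢'(ℝ, ℂ) := Classical.epsilon (IsTstar α η σ)

end

/-! ### The Euler operator `x d/dx` -/

/-! Write θ = x d/dx. Both sides of the formula turn out to be the value at T f of one functional,
an extension of σ from Schwartz functions to functions with a power singularity at 0.

The extension rests on a characterisation (`vanishesToInfiniteOrder_iff_isFlat`): σ vanishes to
infinite order at 0 iff it is flat, i.e. for each k it is bounded by a norm sup |x|^k (1+|x|)^n |θ^b
ψ|, b ≤ m, with n, m depending on k. If σ vanishes to infinite order, testing tangential operators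
on the monomials shows that the coefficient of (d/dx)^i vanishes to order i, so each derivative
comes with a compensating power of x. Conversely, for a flat σ, a one-dimensional Sobolev estimate,
Hahn–Banach and Riesz in L² write σ near 0 as a sum of θ-derivatives of L² functions times a high
power of x; one integration makes those functions bounded.

Call F tame of order k (`IsTame`) if it is smooth off 0, rapidly decreasing, and θ^b F = O(|x|^{-k})
at 0 for all b. Functions in S_sis are tame (`IsSis.isTame`). Cutting F off near 0 and ∞
approximates it in the norms of order k+1, so a flat σ extends to all tame functions by
`flatExtend`. The extension computes the pairing (`IsFlat.pairing_eq`), and uniqueness of canonical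
extensions follows from the same density.

The operator T, realised as `twistFourier`, preserves tameness with bounds. The twisted inversion G
of F is flat at 0 because F decays rapidly; at infinity it grows polynomially, but each derivative
gains a power of decay. So for large a the derivative G^{(a)} is integrable, and (2πix)^{-a} times
its Fourier transform is independent of a. This gives any decay at infinity and a fixed power at 0.
The relation θ(T F) = T(θF + αF) carries the bounds to all θ-derivatives.

Consequently F ↦ σ(T F), with σ extended, is again flat, and defines a distribution vanishing to
infinite order. On test functions off 0 the twisted inversion is Schwartz, so this distribution is
the one prescribed for T*σ. Its extension to tame functions is σ(T F) by continuity along cutoffs,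
which is the asserted identity at F = f. -/

/-- The Euler operator `x d/dx`. -/
noncomputable def eulerOp (F : ℝ → ℂ) (x : ℝ) : ℂ := (x : ℂ) * deriv F x

theorem ContDiffAt.deriv_infty {F : ℝ → ℂ} {x : ℝ} (h : ContDiffAt ℝ ∞ F x) :
    ContDiffAt ℝ ∞ (deriv F) x := h.derivWithin (by simp)

theorem ContDiffAt.iteratedDeriv_infty {F : ℝ → ℂ} {x : ℝ} (h : ContDiffAt ℝ ∞ F x) (n : ℕ) :
    ContDiffAt ℝ ∞ (iteratedDeriv n F) x := by
  induction n with
  | zero => simpa [iteratedDeriv_zero] using h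
  | succ n ih => rw [iteratedDeriv_succ]; exact ih.deriv_infty

theorem contDiffAt_ofReal {n : ℕ∞ω} {x : ℝ} : ContDiffAt ℝ n (fun y : ℝ => (y : ℂ)) x :=
  Complex.ofRealCLM.contDiff.contDiffAt

theorem ContDiffAt.eulerOp {F : ℝ → ℂ} {x : ℝ} (h : ContDiffAt ℝ ∞ F x) :
    ContDiffAt ℝ ∞ (eulerOp F) x :=
  contDiffAt_ofReal.mul h.deriv_infty

theorem ContDiffAt.eulerOp_iterate {F : ℝ → ℂ} {x : ℝ} (h : ContDiffAt ℝ ∞ F x) (b : ℕ) :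
    ContDiffAt ℝ ∞ (_root_.eulerOp^[b] F) x := by
  induction b with
  | zero => exact h
  | succ b ih => rw [Function.iterate_succ_apply']; exact ih.eulerOp

theorem ContDiffAt.eventually_differentiableAt {F : ℝ → ℂ} {x : ℝ} (h : ContDiffAt ℝ ∞ F x) :
    ∀ᶠ y in nhds x, DifferentiableAt ℝ F y := by
  have h1 : ContDiffAt ℝ 1 F x := h.of_le (by exact_mod_cast le_top)
  filter_upwards [h1.eventually (by simp)] with y hy
  exact hy.differentiableAt (by simp)

theorem ContDiffAt.differentiableAt_infty {F : ℝ → ℂ} {x : ℝ} (h : ContDiffAt ℝ ∞ F x) :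
    DifferentiableAt ℝ F x := h.differentiableAt (by simp)

theorem Filter.EventuallyEq.eulerOp {F H : ℝ → ℂ} {x : ℝ} (h : F =ᶠ[nhds x] H) :
    eulerOp F =ᶠ[nhds x] eulerOp H := by
  filter_upwards [h.deriv] with y hy
  simp [_root_.eulerOp, hy]

theorem Filter.EventuallyEq.eulerOp_iterate {F H : ℝ → ℂ} {x : ℝ} (h : F =ᶠ[nhds x] H) (b : ℕ) :
    _root_.eulerOp^[b] F =ᶠ[nhds x] _root_.eulerOp^[b] H := by
  induction b with
  | zero => exact h
  | succ b ih => rw [Function.iterate_succ_apply', Function.iterate_succ_apply']; exact ih.eulerOp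

theorem eulerOp_add_eventuallyEq {F H : ℝ → ℂ} {x : ℝ} (hF : ContDiffAt ℝ ∞ F x)
    (hH : ContDiffAt ℝ ∞ H x) :
    eulerOp (fun y => F y + H y) =ᶠ[nhds x] fun y => eulerOp F y + eulerOp H y := by
  filter_upwards [hF.eventually_differentiableAt, hH.eventually_differentiableAt] with y h1 h2
  simp only [eulerOp]
  rw [deriv_fun_add h1 h2]; ring

theorem eulerOp_mul_eventuallyEq {F H : ℝ → ℂ} {x : ℝ} (hF : ContDiffAt ℝ ∞ F x)
    (hH : ContDiffAt ℝ ∞ H x) :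
    eulerOp (fun y => F y * H y) =ᶠ[nhds x] fun y => eulerOp F y * H y + F y * eulerOp H y := by
  filter_upwards [hF.eventually_differentiableAt, hH.eventually_differentiableAt] with y h1 h2
  simp only [eulerOp]
  rw [deriv_fun_mul h1 h2]; ring

theorem eulerOp_const_mul (c : ℂ) (F : ℝ → ℂ) :
    eulerOp (fun y => c * F y) = fun y => c * eulerOp F y := by
  funext y
  simp only [eulerOp, deriv_const_mul_field]; ring

theorem eulerOp_iterate_const_mul (c : ℂ) (F : ℝ → ℂ) (b : ℕ) :
    eulerOp^[b] (fun y => c * F y) = fun y => c * eulerOp^[b] F y := by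
  induction b generalizing F with
  | zero => rfl
  | succ b ih => rw [Function.iterate_succ_apply, Function.iterate_succ_apply, eulerOp_const_mul, ih]

theorem eulerOp_iterate_add {F H : ℝ → ℂ} {x : ℝ} (hF : ContDiffAt ℝ ∞ F x)
    (hH : ContDiffAt ℝ ∞ H x) (b : ℕ) :
    eulerOp^[b] (fun y => F y + H y) x = eulerOp^[b] F x + eulerOp^[b] H x := by
  induction b generalizing F H with
  | zero => rfl
  | succ b ih =>
    simp only [Function.iterate_succ_apply]
    rw [((eulerOp_add_eventuallyEq hF hH).eulerOp_iterate b).eq_of_nhds, ih hF.eulerOp hH.eulerOp]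

theorem norm_eulerOp_iterate_mul_le {F H : ℝ → ℂ} {x A B : ℝ} (hF : ContDiffAt ℝ ∞ F x)
    (hH : ContDiffAt ℝ ∞ H x) {b : ℕ} (hA : ∀ c ≤ b, ‖eulerOp^[c] F x‖ ≤ A)
    (hB : ∀ c ≤ b, ‖eulerOp^[c] H x‖ ≤ B) :
    ‖eulerOp^[b] (fun y => F y * H y) x‖ ≤ 2 ^ b * A * B := by
  induction b generalizing F H with
  | zero =>
    have h1 := hA 0 le_rfl
    have h2 := hB 0 le_rfl
    simp only [Function.iterate_zero, id_eq] at h1 h2 ⊢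
    rw [norm_mul, pow_zero, one_mul]
    exact mul_le_mul h1 h2 (norm_nonneg _) ((norm_nonneg _).trans h1)
  | succ b ih =>
    rw [Function.iterate_succ_apply,
      ((eulerOp_mul_eventuallyEq hF hH).eulerOp_iterate b).eq_of_nhds,
      eulerOp_iterate_add (hF.eulerOp.mul hH) (hF.mul hH.eulerOp)]
    have h1 := ih hF.eulerOp hH (fun c hc => by simpa using hA (c + 1) (by omega))
      (fun c hc => hB c (by omega))
    have h2 := ih hF hH.eulerOp (fun c hc => hA c (by omega))
      (fun c hc => by simpa using hB (c + 1) (by omega))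
    calc _ ≤ _ := norm_add_le _ _
      _ ≤ 2 ^ b * A * B + 2 ^ b * A * B := add_le_add h1 h2
      _ = 2 ^ (b + 1) * A * B := by ring

theorem iteratedDeriv_eulerOp {F : ℝ → ℂ} {x : ℝ} (hF : ContDiffAt ℝ ∞ F x) (p : ℕ) :
    iteratedDeriv p (eulerOp F) x
      = x * iteratedDeriv (p + 1) F x + p * iteratedDeriv p F x := by
  induction p generalizing F with
  | zero => simp [eulerOp, iteratedDeriv_zero, iteratedDeriv_one]
  | succ p ih =>
    have h1 : deriv (eulerOp F) =ᶠ[nhds x] fun y => eulerOp (deriv F) y + deriv F y := by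
      filter_upwards [hF.deriv_infty.eventually_differentiableAt] with y hy
      have : HasDerivAt (fun y : ℝ => (y : ℂ)) 1 y := Complex.ofRealCLM.hasDerivAt
      have := (this.mul hy.hasDerivAt).deriv
      simp only [eulerOp]
      rw [show eulerOp F = (fun y : ℝ => (y : ℂ)) * deriv F from rfl, this]; ring
    have hn : ∀ {H : ℝ → ℂ}, ContDiffAt ℝ ∞ H x → ContDiffAt ℝ (p : ℕ∞ω) H x :=
      fun h => h.of_le (by exact_mod_cast le_top)
    rw [iteratedDeriv_succ', h1.iteratedDeriv_eq p,
      iteratedDeriv_fun_add (hn hF.deriv_infty.eulerOp) (hn hF.deriv_infty), ih hF.deriv_infty]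
    rw [← iteratedDeriv_succ', ← iteratedDeriv_succ']
    push_cast; ring

/-- With its converse `exists_norm_eulerOp_iterate_le`, this makes x^p (d/dx)^p and θ^b
interchangeable in estimates. The Euler form is preferred because θ is a derivation that commutes
with dilations and behaves simply under inversion. -/
theorem exists_abs_pow_mul_norm_iteratedDeriv_le (p : ℕ) : ∃ C : ℝ, 0 ≤ C ∧
    ∀ (F : ℝ → ℂ) (x M : ℝ), ContDiffAt ℝ ∞ F x → (∀ b ≤ p, ‖eulerOp^[b] F x‖ ≤ M) →
      |x| ^ p * ‖iteratedDeriv p F x‖ ≤ C * M := by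
  induction p with
  | zero => exact ⟨1, by simp, fun F x M hF h => by simpa using h 0 le_rfl⟩
  | succ p ih =>
    obtain ⟨C, hC, ih⟩ := ih
    refine ⟨C + p * C, by positivity, fun F x M hF h => ?_⟩
    have h1 := ih (eulerOp F) x M hF.eulerOp (fun b hb => by simpa using h (b + 1) (by omega))
    have h2 := ih F x M hF (fun b hb => h b (by omega))
    have h3 : (x : ℂ) * iteratedDeriv (p + 1) F x
        = iteratedDeriv p (eulerOp F) x - p * iteratedDeriv p F x := by
      rw [iteratedDeriv_eulerOp hF]; ring
    have h4 : |x| * ‖iteratedDeriv (p + 1) F x‖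
        ≤ ‖iteratedDeriv p (eulerOp F) x‖ + p * ‖iteratedDeriv p F x‖ := by
      have := norm_sub_le (iteratedDeriv p (eulerOp F) x) (p * iteratedDeriv p F x)
      rw [← h3] at this
      simpa using this
    calc |x| ^ (p + 1) * ‖iteratedDeriv (p + 1) F x‖
        = |x| ^ p * (|x| * ‖iteratedDeriv (p + 1) F x‖) := by ring
      _ ≤ |x| ^ p * (‖iteratedDeriv p (eulerOp F) x‖ + p * ‖iteratedDeriv p F x‖) := by gcongr
      _ = |x| ^ p * ‖iteratedDeriv p (eulerOp F) x‖ + p * (|x| ^ p * ‖iteratedDeriv p F x‖) := by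
        ring
      _ ≤ C * M + p * (C * M) := by gcongr
      _ = _ := by ring

theorem exists_norm_eulerOp_iterate_le (b : ℕ) : ∃ C : ℝ, 0 ≤ C ∧
    ∀ (F : ℝ → ℂ) (x M : ℝ), ContDiffAt ℝ ∞ F x →
      (∀ p ≤ b, |x| ^ p * ‖iteratedDeriv p F x‖ ≤ M) → ‖eulerOp^[b] F x‖ ≤ C * M := by
  induction b with
  | zero => exact ⟨1, by simp, fun F x M hF h => by simpa using h 0 le_rfl⟩
  | succ b ih =>
    obtain ⟨C, hC, ih⟩ := ih
    refine ⟨C * (1 + b), by positivity, fun F x M hF h => ?_⟩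
    rw [Function.iterate_succ_apply, mul_assoc]
    refine ih (eulerOp F) x ((1 + b) * M) hF.eulerOp fun p hp => ?_
    rw [iteratedDeriv_eulerOp hF]
    have hM : 0 ≤ M := le_trans (by positivity) (h 0 (by omega))
    calc _ ≤ |x| ^ p * (|x| * ‖iteratedDeriv (p + 1) F x‖ + p * ‖iteratedDeriv p F x‖) := by
          gcongr
          refine (norm_add_le _ _).trans ?_
          simp
      _ = |x| ^ (p + 1) * ‖iteratedDeriv (p + 1) F x‖ + p * (|x| ^ p * ‖iteratedDeriv p F x‖) := by
        ring
      _ ≤ M + p * M := by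
        gcongr
        · exact h (p + 1) (by omega)
        · exact h p (by omega)
      _ ≤ M + b * M := by gcongr
      _ = _ := by ring

/-! ### Functions on the punctured line with weighted bounds -/

/-- The weighted bound `|x|^k (1+|x|)^n ‖(x d/dx)^b F‖ ≤ M` off `0`, for all `b ≤ m`. -/
def EulerBound (k n m : ℕ) (M : ℝ) (F : ℝ → ℂ) : Prop :=
  ∀ b ≤ m, ∀ x : ℝ, x ≠ 0 → |x| ^ k * (1 + |x|) ^ n * ‖eulerOp^[b] F x‖ ≤ M

/-- `F` is smooth off `0`, rapidly decreasing at infinity with all its derivatives, and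
`(x d/dx)^b F = O(|x|^{-k})` near `0` for all `b`. -/
structure IsTame (k : ℕ) (F : ℝ → ℂ) : Prop where
  smooth : ∀ x : ℝ, x ≠ 0 → ContDiffAt ℝ ∞ F x
  bound : ∀ n m : ℕ, ∃ M : ℝ, EulerBound k n m M F

theorem EulerBound.nonneg {k n m : ℕ} {M : ℝ} {F : ℝ → ℂ} (h : EulerBound k n m M F) : 0 ≤ M :=
  le_trans (by positivity) (h 0 (by omega) 1 one_ne_zero)

theorem EulerBound.mono {k n m n' m' : ℕ} {M M' : ℝ} {F : ℝ → ℂ} (h : EulerBound k n m M F)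
    (hn : n' ≤ n) (hm : m' ≤ m) (hM : M ≤ M') : EulerBound k n' m' M' F := by
  intro b hb x hx
  refine le_trans ?_ ((h b (hb.trans hm) x hx).trans hM)
  gcongr
  linarith [abs_nonneg x]

/-- A stronger singularity weight |x|^l also grows at infinity, so it is paid for by l extra powers
of decay. -/
theorem EulerBound.raise {k n m : ℕ} (l : ℕ) {M : ℝ} {F : ℝ → ℂ} (h : EulerBound k (n + l) m M F) :
    EulerBound (k + l) n m M F := by
  intro b hb x hx
  refine le_trans ?_ (h b hb x hx)
  rw [pow_add, pow_add, mul_assoc (|x| ^ k), mul_comm (|x| ^ l)]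
  gcongr
  linarith [abs_nonneg x]

theorem EulerBound.congr {k n m : ℕ} {M : ℝ} {F H : ℝ → ℂ} (h : EulerBound k n m M F)
    (hFH : ∀ x, x ≠ 0 → H x = F x) : EulerBound k n m M H := by
  intro b hb x hx
  have : H =ᶠ[nhds x] F := by
    filter_upwards [isOpen_ne.mem_nhds hx] with y hy using hFH y hy
  rw [(this.eulerOp_iterate b).eq_of_nhds]
  exact h b hb x hx

theorem EulerBound.add {k n m : ℕ} {M M' : ℝ} {F H : ℝ → ℂ} (h : EulerBound k n m M F)
    (h' : EulerBound k n m M' H) (hF : ∀ x : ℝ, x ≠ 0 → ContDiffAt ℝ ∞ F x)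
    (hH : ∀ x : ℝ, x ≠ 0 → ContDiffAt ℝ ∞ H x) :
    EulerBound k n m (M + M') (fun x => F x + H x) := by
  intro b hb x hx
  rw [eulerOp_iterate_add (hF x hx) (hH x hx)]
  refine le_trans ?_ (add_le_add (h b hb x hx) (h' b hb x hx))
  rw [← mul_add]
  gcongr
  exact norm_add_le _ _

theorem EulerBound.const_mul {k n m : ℕ} {M : ℝ} {F : ℝ → ℂ} (h : EulerBound k n m M F) (c : ℂ) :
    EulerBound k n m (‖c‖ * M) (fun x => c * F x) := by
  intro b hb x hx
  rw [eulerOp_iterate_const_mul, norm_mul]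
  refine le_trans (le_of_eq (by ring)) (mul_le_mul_of_nonneg_left (h b hb x hx) (norm_nonneg c))

theorem EulerBound.mul {k n m k' n' : ℕ} {M M' : ℝ} {F H : ℝ → ℂ} (h : EulerBound k n m M F)
    (h' : EulerBound k' n' m M' H) (hF : ∀ x : ℝ, x ≠ 0 → ContDiffAt ℝ ∞ F x)
    (hH : ∀ x : ℝ, x ≠ 0 → ContDiffAt ℝ ∞ H x) :
    EulerBound (k + k') (n + n') m (2 ^ m * M * M') (fun x => F x * H x) := by
  intro b hb x hx
  have hx' : 0 < |x| := abs_pos.2 hx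
  have h1 := norm_eulerOp_iterate_mul_le (hF x hx) (hH x hx) (b := b)
    (A := M / (|x| ^ k * (1 + |x|) ^ n)) (B := M' / (|x| ^ k' * (1 + |x|) ^ n'))
    (fun c hc => by
      rw [le_div_iff₀ (by positivity), mul_comm]; exact h c (hc.trans hb) x hx)
    (fun c hc => by
      rw [le_div_iff₀ (by positivity), mul_comm]; exact h' c (hc.trans hb) x hx)
  have hM := h.nonneg
  have hM' := h'.nonneg
  calc _ ≤ |x| ^ (k + k') * (1 + |x|) ^ (n + n') * (2 ^ b * (M / (|x| ^ k * (1 + |x|) ^ n)) *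
        (M' / (|x| ^ k' * (1 + |x|) ^ n'))) := by gcongr
    _ = 2 ^ b * M * M' := by field_simp; ring
    _ ≤ _ := by
      gcongr
      norm_num

theorem EulerBound.eulerOp {k n m : ℕ} {M : ℝ} {F : ℝ → ℂ} (h : EulerBound k n (m + 1) M F) :
    EulerBound k n m M (eulerOp F) := fun b hb x hx => by
  simpa using h (b + 1) (by omega) x hx

theorem IsTame.congr {k : ℕ} {F H : ℝ → ℂ} (h : IsTame k F) (hFH : ∀ x, x ≠ 0 → H x = F x) :
    IsTame k H where
  smooth x hx := (h.smooth x hx).congr_of_eventuallyEq (by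
    filter_upwards [isOpen_ne.mem_nhds hx] with y hy using hFH y hy)
  bound n m := (h.bound n m).imp fun _ hM => hM.congr hFH

theorem IsTame.raise {k : ℕ} {F : ℝ → ℂ} (h : IsTame k F) {l : ℕ} (hl : k ≤ l) : IsTame l F where
  smooth := h.smooth
  bound n m := by
    obtain ⟨d, rfl⟩ := Nat.exists_eq_add_of_le hl
    exact (h.bound (n + d) m).imp fun _ hM => hM.raise d

theorem IsTame.add {k : ℕ} {F H : ℝ → ℂ} (h : IsTame k F) (h' : IsTame k H) :
    IsTame k (fun x => F x + H x) where
  smooth x hx := (h.smooth x hx).add (h'.smooth x hx)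
  bound n m := by
    obtain ⟨M, hM⟩ := h.bound n m
    obtain ⟨M', hM'⟩ := h'.bound n m
    exact ⟨_, hM.add hM' h.smooth h'.smooth⟩

theorem IsTame.const_mul {k : ℕ} {F : ℝ → ℂ} (h : IsTame k F) (c : ℂ) :
    IsTame k (fun x => c * F x) where
  smooth x hx := contDiffAt_const.mul (h.smooth x hx)
  bound n m := by
    obtain ⟨M, hM⟩ := h.bound n m
    exact ⟨_, hM.const_mul c⟩

theorem IsTame.mul {k l : ℕ} {F H : ℝ → ℂ} (h : IsTame k F) (h' : IsTame l H) :
    IsTame (k + l) (fun x => F x * H x) where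
  smooth x hx := (h.smooth x hx).mul (h'.smooth x hx)
  bound n m := by
    obtain ⟨M, hM⟩ := h.bound n m
    obtain ⟨M', hM'⟩ := h'.bound 0 m
    exact ⟨_, hM.mul hM' h.smooth h'.smooth⟩

theorem IsTame.eulerOp {k : ℕ} {F : ℝ → ℂ} (h : IsTame k F) : IsTame k (eulerOp F) where
  smooth x hx := (h.smooth x hx).eulerOp
  bound n m := (h.bound n (m + 1)).imp fun _ hM => hM.eulerOp

/-! ### Schwartz functions -/

/-- The Euler operator on Schwartz functions. -/
noncomputable def schwartzEuler : 𝓢(ℝ, ℂ) →L[ℂ] 𝓢(ℝ, ℂ) :=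
  (SchwartzMap.smulLeftCLM ℂ (fun x : ℝ => (x : ℂ))) ∘L (SchwartzMap.derivCLM ℂ ℂ)

theorem coe_schwartzEuler (ψ : 𝓢(ℝ, ℂ)) : ⇑(schwartzEuler ψ) = eulerOp ψ := by
  funext x
  simp only [schwartzEuler, ContinuousLinearMap.comp_apply]
  rw [SchwartzMap.smulLeftCLM_apply_apply (by fun_prop)]
  simp [eulerOp]

theorem coe_schwartzEuler_iterate (ψ : 𝓢(ℝ, ℂ)) (b : ℕ) :
    ⇑((schwartzEuler ^ b) ψ) = eulerOp^[b] ψ := by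
  induction b generalizing ψ with
  | zero => rfl
  | succ b ih => rw [pow_succ, mul_apply_eq_comp, ih, coe_schwartzEuler,
      Function.iterate_succ_apply]

theorem SchwartzMap.contDiffAt_infty (ψ : 𝓢(ℝ, ℂ)) (x : ℝ) : ContDiffAt ℝ ∞ ψ x :=
  (ψ.smooth ⊤).contDiffAt

/-- A continuous function on Schwartz space which bounds the weighted norms. -/
noncomputable def eulerNorm (k n m : ℕ) (ψ : 𝓢(ℝ, ℂ)) : ℝ :=
  ∑ b ∈ Finset.range (m + 1), 2 ^ n * (SchwartzMap.seminorm ℂ k 0 ((schwartzEuler ^ b) ψ)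
    + SchwartzMap.seminorm ℂ (k + n) 0 ((schwartzEuler ^ b) ψ))

theorem one_add_pow_le {t : ℝ} (ht : 0 ≤ t) (n : ℕ) : (1 + t) ^ n ≤ 2 ^ n * (1 + t ^ n) := by
  rcases le_total t 1 with h | h
  · calc (1 + t) ^ n ≤ 2 ^ n := by gcongr; linarith
      _ ≤ _ := by nlinarith [pow_pos (two_pos (α := ℝ)) n, pow_nonneg ht n]
  · calc (1 + t) ^ n ≤ (2 * t) ^ n := by gcongr; linarith
      _ ≤ _ := by rw [mul_pow]; nlinarith [pow_pos (two_pos (α := ℝ)) n, pow_nonneg ht n]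

theorem eulerBound_eulerNorm (k n m : ℕ) (ψ : 𝓢(ℝ, ℂ)) :
    EulerBound k n m (eulerNorm k n m ψ) ψ := by
  intro b hb x _
  have h1 := SchwartzMap.norm_pow_mul_le_seminorm ℂ ((schwartzEuler ^ b) ψ) k x
  have h2 := SchwartzMap.norm_pow_mul_le_seminorm ℂ ((schwartzEuler ^ b) ψ) (k + n) x
  rw [coe_schwartzEuler_iterate] at h1 h2
  rw [Real.norm_eq_abs] at h1 h2
  refine le_trans ?_ (Finset.single_le_sum (f := fun b => 2 ^ n *
    (SchwartzMap.seminorm ℂ k 0 ((schwartzEuler ^ b) ψ)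
    + SchwartzMap.seminorm ℂ (k + n) 0 ((schwartzEuler ^ b) ψ)))
    (fun i _ => by positivity) (Finset.mem_range.2 (Nat.lt_succ_of_le hb)))
  calc _ ≤ |x| ^ k * (2 ^ n * (1 + |x| ^ n)) * ‖eulerOp^[b] ψ x‖ := by
        gcongr; exact one_add_pow_le (abs_nonneg x) n
    _ = 2 ^ n * (|x| ^ k * ‖eulerOp^[b] ψ x‖ + |x| ^ (k + n) * ‖eulerOp^[b] ψ x‖) := by ring
    _ ≤ _ := by gcongr

theorem SchwartzMap.isTame (ψ : 𝓢(ℝ, ℂ)) : IsTame 0 ψ where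
  smooth x _ := ψ.contDiffAt_infty x
  bound n m := ⟨_, eulerBound_eulerNorm 0 n m ψ⟩

theorem continuous_eulerNorm (k n m : ℕ) : Continuous (eulerNorm k n m) := by
  have h (k : ℕ) : Continuous (SchwartzMap.seminorm ℂ k 0 : 𝓢(ℝ, ℂ) → ℝ) :=
    (schwartz_withSeminorms ℂ ℝ ℂ).continuous_seminorm (k, 0)
  unfold eulerNorm
  refine continuous_finsetSum _ fun b _ => ?_
  have h1 := (h k).comp (schwartzEuler ^ b).continuous
  have h2 := (h (k + n)).comp (schwartzEuler ^ b).continuous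
  exact continuous_const.mul (h1.add h2)

theorem eulerNorm_zero (k n m : ℕ) : eulerNorm k n m 0 = 0 := by
  simp [eulerNorm]

/-! ### Cutoff functions -/

/-- A fixed Schwartz function supported in `[-2, 2]` and equal to `1` on `[-1, 1]`. -/
theorem exists_schwartz_plateau : ∃ χ : 𝓢(ℝ, ℂ), (∀ x, |x| ≤ 1 → χ x = 1) ∧
    (∀ x, 2 ≤ |x| → χ x = 0) := by
  let b : ContDiffBump (0 : ℝ) := ⟨1, 2, one_pos, one_lt_two⟩
  have h1 : HasCompactSupport (fun x => ((b x : ℝ) : ℂ)) :=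
    b.hasCompactSupport.comp_left (g := fun t : ℝ => (t : ℂ)) (by simp)
  have h2 : ContDiff ℝ ∞ (fun x => ((b x : ℝ) : ℂ)) :=
    Complex.ofRealCLM.contDiff.comp b.contDiff
  refine ⟨h1.toSchwartzMap h2, fun x hx => ?_, fun x hx => ?_⟩
  · have : b x = 1 := b.one_of_mem_closedBall (by simpa [b] using hx)
    simp [this]
  · have : b x = 0 := b.zero_of_le_dist (by simpa [b] using hx)
    simp [this]

/-- A Schwartz function supported in `[-2, 2]` and equal to `1` on `[-1, 1]`. -/
noncomputable def plateau : 𝓢(ℝ, ℂ) := exists_schwartz_plateau.choose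

theorem plateau_eq_one {x : ℝ} (hx : |x| ≤ 1) : plateau x = 1 :=
  exists_schwartz_plateau.choose_spec.1 x hx

theorem plateau_eq_zero {x : ℝ} (hx : 2 ≤ |x|) : plateau x = 0 :=
  exists_schwartz_plateau.choose_spec.2 x hx

theorem hasCompactSupport_plateau : HasCompactSupport plateau :=
  HasCompactSupport.of_support_subset_isCompact (isCompact_Icc (a := (-2 : ℝ)) (b := 2))
    fun x hx => by
      by_contra h
      exact hx (plateau_eq_zero (not_lt.1 fun h' => h ⟨by linarith [(abs_lt.1 h').1],
        (abs_lt.1 h').2.le⟩))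

/-- Cutoffs with compact support off `0`, equal to `1` for `2/(N+1) ≤ |x| ≤ N+1`. -/
noncomputable def cutoff (N : ℕ) (x : ℝ) : ℂ :=
  plateau (((N : ℝ) + 1)⁻¹ * x) + (-1) * plateau (((N : ℝ) + 1) * x)

theorem contDiff_cutoff (N : ℕ) : ContDiff ℝ ∞ (cutoff N) := by
  have h (c : ℝ) : ContDiff ℝ ∞ (fun x : ℝ => plateau (c * x)) :=
    (plateau.smooth ⊤).comp (contDiff_const.mul contDiff_id)
  exact (h _).add (contDiff_const.mul (h _))

theorem cutoff_eq_zero_of_le {N : ℕ} {x : ℝ} (hx : |x| ≤ ((N : ℝ) + 1)⁻¹) : cutoff N x = 0 := by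
  have hN : (0 : ℝ) < N + 1 := by positivity
  have hN1 : (1 : ℝ) ≤ N + 1 := by linarith [(Nat.cast_nonneg N : (0 : ℝ) ≤ N)]
  have hi : ((N : ℝ) + 1)⁻¹ ≤ 1 := inv_le_one_of_one_le₀ hN1
  have h1 : plateau (((N : ℝ) + 1)⁻¹ * x) = 1 := plateau_eq_one (by
    rw [abs_mul, abs_of_pos (inv_pos.2 hN)]
    calc _ ≤ (1 : ℝ) * 1 := mul_le_mul hi (hx.trans hi) (abs_nonneg _) zero_le_one
      _ = 1 := one_mul 1)
  have h2 : plateau (((N : ℝ) + 1) * x) = 1 := plateau_eq_one (by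
    rw [abs_mul, abs_of_pos hN]
    calc _ ≤ ((N : ℝ) + 1) * ((N : ℝ) + 1)⁻¹ := by gcongr
      _ = 1 := mul_inv_cancel₀ hN.ne')
  simp [cutoff, h1, h2]

theorem cutoff_eq_zero_of_ge {N : ℕ} {x : ℝ} (hx : 2 * ((N : ℝ) + 1) ≤ |x|) : cutoff N x = 0 := by
  have hN : (0 : ℝ) < N + 1 := by positivity
  have hN1 : (1 : ℝ) ≤ N + 1 := by linarith [(Nat.cast_nonneg N : (0 : ℝ) ≤ N)]
  have h1 : plateau (((N : ℝ) + 1)⁻¹ * x) = 0 := plateau_eq_zero (by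
    rw [abs_mul, abs_of_pos (inv_pos.2 hN), ← div_eq_inv_mul, le_div_iff₀ hN]; exact hx)
  have h2 : plateau (((N : ℝ) + 1) * x) = 0 := plateau_eq_zero (by
    rw [abs_mul, abs_of_pos hN]; nlinarith [abs_nonneg x])
  simp [cutoff, h1, h2]

theorem cutoff_eq_one {N : ℕ} {x : ℝ} (h1 : 2 / ((N : ℝ) + 1) < |x|) (h2 : |x| < N + 1) :
    cutoff N x = 1 := by
  have hN : (0 : ℝ) < N + 1 := by positivity
  have e1 : plateau (((N : ℝ) + 1)⁻¹ * x) = 1 := plateau_eq_one (by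
    rw [abs_mul, abs_of_pos (inv_pos.2 hN), ← div_eq_inv_mul, div_le_one hN]; exact h2.le)
  have e2 : plateau (((N : ℝ) + 1) * x) = 0 := plateau_eq_zero (by
    rw [abs_mul, abs_of_pos hN, mul_comm]; exact ((div_lt_iff₀ hN).1 h1).le)
  simp [cutoff, e1, e2]

theorem eulerOp_iterate_comp_mul (F : ℝ → ℂ) (c : ℝ) (b : ℕ) :
    eulerOp^[b] (fun x => F (c * x)) = fun x => eulerOp^[b] F (c * x) := by
  induction b generalizing F with
  | zero => rfl
  | succ b ih =>
    rw [Function.iterate_succ_apply, Function.iterate_succ_apply, ← ih]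
    congr 1
    funext x
    simp only [eulerOp]
    rw [deriv_comp_mul_left]
    simp; ring

theorem EulerBound.comp_mul {m : ℕ} {M : ℝ} {F : ℝ → ℂ} (h : EulerBound 0 0 m M F) {c : ℝ}
    (hc : c ≠ 0) : EulerBound 0 0 m M (fun x => F (c * x)) := by
  intro b hb x hx
  rw [eulerOp_iterate_comp_mul]
  simpa using h b hb (c * x) (mul_ne_zero hc hx)

/-- The cutoffs are differences of dilates of one function and θ commutes with dilations, so the
bounds are uniform in N. -/
theorem exists_eulerBound_cutoff (m : ℕ) : ∃ C : ℝ, ∀ N, EulerBound 0 0 m C (cutoff N) := by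
  refine ⟨eulerNorm 0 0 m plateau + ‖(-1 : ℂ)‖ * eulerNorm 0 0 m plateau, fun N => ?_⟩
  have hN : ((N : ℝ) + 1) ≠ 0 := by positivity
  have h := eulerBound_eulerNorm 0 0 m plateau
  have hs (c : ℝ) (x : ℝ) : ContDiffAt ℝ ∞ (fun x : ℝ => plateau (c * x)) x :=
    ((plateau.smooth ⊤).comp (contDiff_const.mul contDiff_id)).contDiffAt
  exact (h.comp_mul (inv_ne_zero hN)).add ((h.comp_mul hN).const_mul (-1)) (fun x _ => hs _ x)
    (fun x _ => contDiffAt_const.mul (hs _ x))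

theorem eulerBound_const (c : ℂ) (m : ℕ) : EulerBound 0 0 m ‖c‖ (fun _ => c) := by
  intro b _ x _
  rcases b with - | b
  · simp
  · have : eulerOp (fun _ => c) = fun _ => (0 : ℂ) := by funext x; simp [eulerOp]
    have h0 : eulerOp^[b] (fun _ => (0 : ℂ)) = fun _ => 0 := by
      have := eulerOp_iterate_const_mul 0 (fun _ => (0 : ℂ)) b
      simpa using this
    rw [Function.iterate_succ_apply, this, h0]
    simp

theorem contDiff_of_notMem_tsupport {H : ℝ → ℂ} (hs : ∀ x : ℝ, x ≠ 0 → ContDiffAt ℝ ∞ H x)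
    (h0 : H =ᶠ[nhds 0] 0) : ContDiff ℝ ∞ H := by
  rw [contDiff_iff_contDiffAt]
  intro x
  rcases eq_or_ne x 0 with rfl | hx
  · exact (contDiffAt_const (c := (0 : ℂ))).congr_of_eventuallyEq h0
  · exact hs x hx

theorem exists_testOffZero {H : ℝ → ℂ} (hs : ∀ x : ℝ, x ≠ 0 → ContDiffAt ℝ ∞ H x) {δ R : ℝ}
    (hδ : 0 < δ) (h0 : ∀ x, |x| ≤ δ → H x = 0) (hR : ∀ x, R ≤ |x| → H x = 0) :
    ∃ ψ : 𝓢(ℝ, ℂ), IsTestOffZero ψ ∧ ∀ x, ψ x = H x := by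
  have hc : HasCompactSupport H :=
    HasCompactSupport.of_support_subset_isCompact (isCompact_Icc (a := -R) (b := R))
    fun x hx => by
      by_contra h
      exact hx (hR x (not_lt.1 fun h' => h ⟨by linarith [(abs_lt.1 h').1], (abs_lt.1 h').2.le⟩))
  have h0' : H =ᶠ[nhds 0] 0 := by
    filter_upwards [Metric.ball_mem_nhds (0 : ℝ) hδ] with x hx
    exact h0 x (by simpa using (Metric.mem_ball.1 hx).le)
  refine ⟨hc.toSchwartzMap (contDiff_of_notMem_tsupport hs h0'), ⟨hc, ?_⟩, fun x => rfl⟩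
  exact notMem_tsupport_iff_eventuallyEq.2 h0'

theorem exists_testOffZero_cutoff_mul {k : ℕ} {F : ℝ → ℂ} (hF : IsTame k F) (N : ℕ) :
    ∃ ψ : 𝓢(ℝ, ℂ), IsTestOffZero ψ ∧ ∀ x, ψ x = cutoff N x * F x :=
  exists_testOffZero (fun x hx => (contDiff_cutoff N).contDiffAt.mul (hF.smooth x hx))
    (δ := ((N : ℝ) + 1)⁻¹) (R := 2 * ((N : ℝ) + 1)) (by positivity)
    (fun x hx => by rw [cutoff_eq_zero_of_le hx, zero_mul])
    (fun x hx => by rw [cutoff_eq_zero_of_ge hx, zero_mul])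

/-- Density of functions supported off 0: the error tends to 0 once one power of singularity is
given away. -/
theorem exists_eulerBound_sub_cutoff_mul {k : ℕ} {F : ℝ → ℂ} (hF : IsTame k F) (n m : ℕ) :
    ∃ M : ℝ, ∀ N : ℕ, EulerBound (k + 1) n m (M / ((N : ℝ) + 1))
      (fun x => F x + (-1) * (cutoff N x * F x)) := by
  obtain ⟨C, hC⟩ := exists_eulerBound_cutoff m
  obtain ⟨M, hM⟩ := hF.bound (n + 2) m
  refine ⟨2 * (2 ^ m * (‖(1 : ℂ)‖ + ‖(-1 : ℂ)‖ * C) * M), fun N => ?_⟩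
  have hN : (0 : ℝ) < N + 1 := by positivity
  have hsm : ∀ x : ℝ, x ≠ 0 → ContDiffAt ℝ ∞ (fun x => 1 + (-1) * cutoff N x) x := fun x _ =>
    (contDiff_const.add (contDiff_const.mul (contDiff_cutoff N))).contDiffAt
  have h1 : EulerBound 0 0 m (‖(1 : ℂ)‖ + ‖(-1 : ℂ)‖ * C) (fun x => 1 + (-1) * cutoff N x) :=
    (eulerBound_const 1 m).add ((hC N).const_mul (-1)) (fun x _ => contDiffAt_const)
      (fun x _ => (contDiff_const.mul (contDiff_cutoff N)).contDiffAt)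
  have h2 := h1.mul hM hsm hF.smooth
  rw [zero_add, zero_add] at h2
  replace h2 := h2.congr (H := fun x => F x + (-1) * (cutoff N x * F x)) (fun x _ => by ring)
  intro b hb x hx
  have hx' : 0 < |x| := abs_pos.2 hx
  -- Strict inequalities make this region open, so there the error vanishes on a neighbourhood and
  -- all its Euler derivatives are zero.
  by_cases hcase : 2 / ((N : ℝ) + 1) < |x| ∧ |x| < N + 1
  · have hev : (fun x => F x + (-1) * (cutoff N x * F x)) =ᶠ[nhds x] fun _ => 0 := by
      filter_upwards [(isOpen_lt continuous_const continuous_abs).mem_nhds hcase.1,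
        (isOpen_lt continuous_abs continuous_const).mem_nhds hcase.2] with y h1 h2
      rw [cutoff_eq_one h1 h2]; ring
    have h0 := eulerBound_const 0 m b hb x hx
    rw [(hev.eulerOp_iterate b).eq_of_nhds]
    simp only [pow_zero, one_mul, norm_zero] at h0
    rw [le_antisymm h0 (norm_nonneg _), mul_zero]
    exact div_nonneg (mul_nonneg zero_le_two h2.nonneg) hN.le
  -- Near 0 the factor |x| itself is small; at infinity two powers of decay dominate |x| with a gain
  -- of 1/(N+1). This is why `hM` was taken with n + 2.
  · have h3 : |x| ≤ 2 / ((N : ℝ) + 1) * (1 + |x|) ^ 2 := by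
      rw [not_and_or, not_lt, not_lt] at hcase
      rcases hcase with h | h
      · refine h.trans (le_mul_of_one_le_right (by positivity) ?_)
        nlinarith
      · rw [div_mul_eq_mul_div, le_div_iff₀ hN]
        nlinarith
    have h4 := h2 b hb x hx
    calc |x| ^ (k + 1) * (1 + |x|) ^ n * ‖eulerOp^[b] (fun x => F x + (-1) * (cutoff N x * F x)) x‖
        = |x| * (|x| ^ k * (1 + |x|) ^ n *
          ‖eulerOp^[b] (fun x => F x + (-1) * (cutoff N x * F x)) x‖) := by ring
      _ ≤ (2 / ((N : ℝ) + 1) * (1 + |x|) ^ 2) * (|x| ^ k * (1 + |x|) ^ n *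
          ‖eulerOp^[b] (fun x => F x + (-1) * (cutoff N x * F x)) x‖) := by gcongr
      _ = 2 / ((N : ℝ) + 1) * (|x| ^ k * (1 + |x|) ^ (n + 2) *
          ‖eulerOp^[b] (fun x => F x + (-1) * (cutoff N x * F x)) x‖) := by ring
      _ ≤ 2 / ((N : ℝ) + 1) * (2 ^ m * (‖(1 : ℂ)‖ + ‖(-1 : ℂ)‖ * C) * M) := by gcongr
      _ = _ := by ring

/-! ### Functionals on tame functions -/

/-- A linear functional on tame functions, bounded by the weighted norms of every order. -/
structure IsFlatFunctional (L : (ℝ → ℂ) → ℂ) : Prop where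
  add : ∀ (k : ℕ) (F H : ℝ → ℂ), IsTame k F → IsTame k H → L (fun x => F x + H x) = L F + L H
  const_mul : ∀ (k : ℕ) (c : ℂ) (F : ℝ → ℂ), IsTame k F → L (fun x => c * F x) = c * L F
  bound : ∀ k : ℕ, ∃ (n m : ℕ) (C : ℝ), ∀ (F : ℝ → ℂ) (M : ℝ), IsTame k F →
    EulerBound k n m M F → ‖L F‖ ≤ C * M

/-- A tempered distribution bounded by the weighted norms of every order. -/
def IsFlat (σ : 𝓢'(ℝ, ℂ)) : Prop :=
  ∀ k : ℕ, ∃ (n m : ℕ) (C : ℝ), ∀ (ψ : 𝓢(ℝ, ℂ)) (M : ℝ), EulerBound k n m M ψ → ‖σ ψ‖ ≤ C * M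

/-- The weighted bounds only see points off 0, so the difference satisfies one with M = 0. -/
theorem IsFlatFunctional.congr {L : (ℝ → ℂ) → ℂ} (hL : IsFlatFunctional L) {k : ℕ} {F H : ℝ → ℂ}
    (hF : IsTame k F) (h : ∀ x, x ≠ 0 → H x = F x) : L H = L F := by
  have hH := hF.congr h
  obtain ⟨n, m, C, hb⟩ := hL.bound k
  have h0 : EulerBound k n m 0 (fun x => H x + (-1) * F x) := by
    have h1 : EulerBound k n m 0 (fun _ => (0 : ℂ)) := by
      intro b hb x hx
      have := eulerBound_const 0 m b hb x hx
      simp only [pow_zero, one_mul, norm_zero] at this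
      rw [le_antisymm this (norm_nonneg _), mul_zero]
    exact h1.congr fun x hx => by rw [h x hx]; ring
  have h1 := hb _ 0 (hH.add (hF.const_mul (-1))) h0
  rw [hL.add k _ _ hH (hF.const_mul _), hL.const_mul k _ _ hF, mul_zero] at h1
  have h2 := norm_le_zero_iff.1 h1
  linear_combination h2

theorem tendsto_const_div_add_one (a : ℝ) :
    Filter.Tendsto (fun N : ℕ => a / ((N : ℝ) + 1)) Filter.atTop (nhds 0) :=
  (Filter.tendsto_atTop_add_const_right _ _ tendsto_natCast_atTop_atTop).const_div_atTop a

theorem isTame_cutoff_mul {k : ℕ} {F : ℝ → ℂ} (hF : IsTame k F) (N : ℕ) :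
    IsTame k (fun x => cutoff N x * F x) := by
  obtain ⟨ψ, -, hψ⟩ := exists_testOffZero_cutoff_mul hF N
  exact (ψ.isTame.congr fun x _ => (hψ x).symm).raise (Nat.zero_le k)

theorem IsFlatFunctional.tendsto {L : (ℝ → ℂ) → ℂ} (hL : IsFlatFunctional L) {k : ℕ} {F : ℝ → ℂ}
    (hF : IsTame k F) :
    Filter.Tendsto (fun N => L (fun x => cutoff N x * F x)) Filter.atTop (nhds (L F)) := by
  obtain ⟨n, m, C, hb⟩ := hL.bound (k + 1)
  obtain ⟨M, hM⟩ := exists_eulerBound_sub_cutoff_mul hF n m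
  rw [tendsto_iff_norm_sub_tendsto_zero]
  refine squeeze_zero (fun _ => norm_nonneg _) (fun N => ?_) (tendsto_const_div_add_one (C * M))
  have hF' := hF.raise (Nat.le_succ k)
  have hκ := isTame_cutoff_mul hF' N
  have h1 := hb _ _ (hF'.add (hκ.const_mul (-1))) (hM N)
  rw [hL.add _ _ _ hF' (hκ.const_mul _), hL.const_mul _ _ _ hκ, neg_one_mul,
    ← sub_eq_add_neg, norm_sub_rev] at h1
  rwa [mul_div_assoc]

/-- The bound of order 0 gives continuity for the Schwartz topology, through the continuous majorant
`eulerNorm`; the bounds of the other orders give flatness. -/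
theorem IsFlatFunctional.exists_distribution {L : (ℝ → ℂ) → ℂ} (hL : IsFlatFunctional L) :
    ∃ τ : 𝓢'(ℝ, ℂ), IsFlat τ ∧ ∀ ψ : 𝓢(ℝ, ℂ), τ ψ = L ψ := by
  let l : 𝓢(ℝ, ℂ) →ₗ[ℂ] ℂ :=
    { toFun := fun ψ => L ψ
      map_add' := fun φ ψ => hL.add 0 φ ψ φ.isTame ψ.isTame
      map_smul' := fun c ψ => hL.const_mul 0 c ψ ψ.isTame }
  have hc : Continuous l := by
    refine continuous_of_continuousAt_zero l ?_
    obtain ⟨n, m, C, hb⟩ := hL.bound 0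
    rw [ContinuousAt, map_zero, tendsto_zero_iff_norm_tendsto_zero]
    have h1 : Filter.Tendsto (fun ψ => C * eulerNorm 0 n m ψ) (nhds 0) (nhds 0) := by
      have := ((continuous_eulerNorm 0 n m).const_mul C).tendsto 0
      rwa [eulerNorm_zero, mul_zero] at this
    exact squeeze_zero (fun _ => norm_nonneg _)
      (fun ψ => hb ψ _ ψ.isTame (eulerBound_eulerNorm 0 n m ψ)) h1
  refine ⟨ContinuousLinearMap.toPointwiseConvergenceCLM _ _ _ _ ⟨l, hc⟩, fun k => ?_, fun ψ => rfl⟩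
  obtain ⟨n, m, C, hb⟩ := hL.bound k
  exact ⟨n, m, C, fun ψ M hM => hb ψ M (ψ.isTame.raise (Nat.zero_le k)) hM⟩

/-! ### Extending flat distributions to tame functions. -/

open Classical in
/-- The Schwartz function with given underlying function, if there is one. -/
noncomputable def toSchwartz (H : ℝ → ℂ) : 𝓢(ℝ, ℂ) :=
  if h : ∃ ψ : 𝓢(ℝ, ℂ), ∀ x, ψ x = H x then h.choose else 0

theorem toSchwartz_eq {H : ℝ → ℂ} {ψ : 𝓢(ℝ, ℂ)} (h : ∀ x, ψ x = H x) : toSchwartz H = ψ := by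
  have h' : ∃ ψ : 𝓢(ℝ, ℂ), ∀ x, ψ x = H x := ⟨ψ, h⟩
  rw [toSchwartz, dif_pos h']
  ext x
  rw [h'.choose_spec, h]

/-- The extension of a flat distribution to tame functions. -/
noncomputable def flatExtend (σ : 𝓢'(ℝ, ℂ)) (F : ℝ → ℂ) : ℂ :=
  Filter.limUnder Filter.atTop fun N : ℕ => σ (toSchwartz fun x => cutoff N x * F x)

theorem coe_toSchwartz_cutoff_mul {k : ℕ} {F : ℝ → ℂ} (hF : IsTame k F) (N : ℕ) (x : ℝ) :
    toSchwartz (fun x => cutoff N x * F x) x = cutoff N x * F x := by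
  obtain ⟨ψ, -, hψ⟩ := exists_testOffZero_cutoff_mul hF N
  rw [toSchwartz_eq hψ, hψ]

theorem IsFlat.tendsto_flatExtend {σ : 𝓢'(ℝ, ℂ)} (hσ : IsFlat σ) {k : ℕ} {F : ℝ → ℂ}
    (hF : IsTame k F) :
    Filter.Tendsto (fun N => σ (toSchwartz fun x => cutoff N x * F x)) Filter.atTop
      (nhds (flatExtend σ F)) := by
  refine CauchySeq.tendsto_limUnder ?_
  obtain ⟨n, m, C, hb⟩ := hσ (k + 1)
  obtain ⟨M, hM⟩ := exists_eulerBound_sub_cutoff_mul hF n m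
  -- The sign of C is not part of flatness; it is forced by a test function whose norm is positive,
  -- here `plateau`.
  have h0 : 0 ≤ C * M := by
    have h1 : 0 ≤ M := by simpa using (hM 0).nonneg
    rcases h1.eq_or_lt with h | h
    · simp [← h]
    · have := (norm_nonneg _).trans (hb _ _ (eulerBound_eulerNorm (k + 1) n m plateau))
      have h2 : 0 < eulerNorm (k + 1) n m plateau := by
        have := eulerBound_eulerNorm (k + 1) n m plateau 0 (Nat.zero_le m) 1 one_ne_zero
        refine lt_of_lt_of_le ?_ this
        simp [plateau_eq_one]
      exact mul_nonneg (nonneg_of_mul_nonneg_left this h2) h.le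
  refine cauchySeq_of_le_tendsto_0 (fun N : ℕ => 2 * (C * M) / ((N : ℝ) + 1)) ?_
    (tendsto_const_div_add_one _)
  intro p q N hp hq
  have hFs := hF.raise (Nat.le_succ k)
  have hE (r : ℕ) : IsTame (k + 1) (fun x => F x + (-1) * (cutoff r x * F x)) :=
    hFs.add ((isTame_cutoff_mul hFs r).const_mul (-1))
  have h1 : EulerBound (k + 1) n m (M / ((q : ℝ) + 1) + ‖(-1 : ℂ)‖ * (M / ((p : ℝ) + 1)))
      (toSchwartz (fun x => cutoff p x * F x) - toSchwartz (fun x => cutoff q x * F x)) := by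
    refine ((hM q).add ((hM p).const_mul (-1)) (hE q).smooth
      ((hE p).const_mul (-1)).smooth).congr fun x _ => ?_
    rw [Pi.sub_apply, coe_toSchwartz_cutoff_mul hF, coe_toSchwartz_cutoff_mul hF]
    ring
  have h2 := hb (toSchwartz (fun x => cutoff p x * F x) - toSchwartz (fun x => cutoff q x * F x)) _ h1
  rw [map_sub, ← dist_eq_norm] at h2
  refine h2.trans ?_
  have hNp : (N : ℝ) + 1 ≤ p + 1 := by gcongr
  have hNq : (N : ℝ) + 1 ≤ q + 1 := by gcongr
  have hN : (0 : ℝ) < N + 1 := by positivity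
  calc C * (M / ((q : ℝ) + 1) + ‖(-1 : ℂ)‖ * (M / ((p : ℝ) + 1)))
      = C * M / ((q : ℝ) + 1) + C * M / ((p : ℝ) + 1) := by simp; ring
    _ ≤ C * M / ((N : ℝ) + 1) + C * M / ((N : ℝ) + 1) := by gcongr
    _ = _ := by ring

/-- The bounds pass to the limit because multiplication by the cutoffs is bounded uniformly in N. -/
theorem IsFlat.isFlatFunctional {σ : 𝓢'(ℝ, ℂ)} (hσ : IsFlat σ) :
    IsFlatFunctional (flatExtend σ) where
  add k F H hF hH := by
    refine tendsto_nhds_unique (hσ.tendsto_flatExtend (hF.add hH))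
      (((hσ.tendsto_flatExtend hF).add (hσ.tendsto_flatExtend hH)).congr fun N => ?_)
    rw [← map_add]
    congr 1
    ext x
    simp only [add_apply]
    rw [coe_toSchwartz_cutoff_mul hF, coe_toSchwartz_cutoff_mul hH,
      coe_toSchwartz_cutoff_mul (hF.add hH)]
    ring
  const_mul k c F hF := by
    refine tendsto_nhds_unique (hσ.tendsto_flatExtend (hF.const_mul c))
      (((hσ.tendsto_flatExtend hF).const_mul c).congr fun N => ?_)
    rw [← smul_eq_mul, ← map_smul]
    congr 1
    ext x
    simp only [smul_apply]
    rw [coe_toSchwartz_cutoff_mul hF, coe_toSchwartz_cutoff_mul (hF.const_mul c), smul_eq_mul]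
    ring
  bound k := by
    obtain ⟨n, m, C, hb⟩ := hσ k
    obtain ⟨C', hC'⟩ := exists_eulerBound_cutoff m
    refine ⟨n, m, C * (2 ^ m * C'), fun F M hF hM => ?_⟩
    refine le_of_tendsto (hσ.tendsto_flatExtend hF).norm (Filter.Eventually.of_forall fun N => ?_)
    have h1 := (hC' N).mul hM (fun x _ => (contDiff_cutoff N).contDiffAt) hF.smooth
    rw [zero_add, zero_add] at h1
    refine (hb _ _ (h1.congr fun x _ => coe_toSchwartz_cutoff_mul hF N x)).trans (le_of_eq ?_)
    ring

theorem IsFlat.tendsto_cutoff {σ : 𝓢'(ℝ, ℂ)} (hσ : IsFlat σ) (ψ : 𝓢(ℝ, ℂ)) :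
    Filter.Tendsto (fun N => σ (toSchwartz fun x => cutoff N x * ψ x)) Filter.atTop
      (nhds (σ ψ)) := by
  obtain ⟨n, m, C, hb⟩ := hσ 1
  obtain ⟨M, hM⟩ := exists_eulerBound_sub_cutoff_mul ψ.isTame n m
  rw [tendsto_iff_norm_sub_tendsto_zero]
  refine squeeze_zero (fun _ => norm_nonneg _) (fun N => ?_) (tendsto_const_div_add_one (C * M))
  have h1 : EulerBound 1 n m (M / ((N : ℝ) + 1)) (ψ - toSchwartz fun x => cutoff N x * ψ x) :=
    (hM N).congr fun x _ => by
      rw [Pi.sub_apply, coe_toSchwartz_cutoff_mul ψ.isTame]; ring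
  have h2 := hb (ψ - toSchwartz fun x => cutoff N x * ψ x) _ h1
  rw [map_sub, norm_sub_rev] at h2
  rwa [mul_div_assoc]

theorem IsFlat.flatExtend_coe {σ : 𝓢'(ℝ, ℂ)} (hσ : IsFlat σ) (ψ : 𝓢(ℝ, ℂ)) :
    flatExtend σ ψ = σ ψ :=
  tendsto_nhds_unique (hσ.tendsto_flatExtend ψ.isTame) (hσ.tendsto_cutoff ψ)

theorem IsFlat.flatExtend_eq {σ : 𝓢'(ℝ, ℂ)} (hσ : IsFlat σ) {F : ℝ → ℂ} (ψ : 𝓢(ℝ, ℂ))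
    (h : ∀ x, x ≠ 0 → F x = ψ x) : flatExtend σ F = σ ψ := by
  rw [← hσ.flatExtend_coe, hσ.isFlatFunctional.congr ψ.isTame h]

/-- Uniqueness of canonical extensions: a flat distribution is the limit of its values on cut-off
test functions. -/
theorem IsFlat.eq_of_testOffZero {σ τ : 𝓢'(ℝ, ℂ)} (hσ : IsFlat σ) (hτ : IsFlat τ)
    (h : ∀ ψ, IsTestOffZero ψ → σ ψ = τ ψ) : σ = τ := by
  ext ψ
  refine tendsto_nhds_unique (hσ.tendsto_cutoff ψ) ((hτ.tendsto_cutoff ψ).congr fun N => ?_)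
  obtain ⟨φ, hφ, he⟩ := exists_testOffZero_cutoff_mul ψ.isTame N
  rw [toSchwartz_eq he, h φ hφ]

/-! ### Flat distributions vanish to infinite order -/

/-- The bound makes `s` descend to a bounded functional on the range of `J`, which Hahn–Banach
extends to `E`. -/
theorem exists_clm_of_norm_le {V E : Type*} [AddCommGroup V] [Module ℂ V] [NormedAddCommGroup E]
    [NormedSpace ℂ E] (J : V →ₗ[ℂ] E) (s : V →ₗ[ℂ] ℂ) (C : ℝ) (h : ∀ v, ‖s v‖ ≤ C * ‖J v‖) :
    ∃ g : E →L[ℂ] ℂ, ∀ v, g (J v) = s v := by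
  obtain ⟨r, hr⟩ := J.rangeRestrict.exists_rightInverse_of_surjective J.range_rangeRestrict
  have hr' (y : LinearMap.range J) : J (r y) = y := by
    have := LinearMap.congr_fun hr y
    exact congrArg Subtype.val this
  let g₀ : LinearMap.range J →L[ℂ] ℂ := (s ∘ₗ r).mkContinuous C fun y => by
    have := h (r y)
    rwa [hr'] at this
  obtain ⟨g, hg, -⟩ := exists_extension_norm_eq _ g₀
  refine ⟨g, fun v => ?_⟩
  have h1 := hg ⟨J v, LinearMap.mem_range_self J v⟩
  rw [h1]
  change s (r _) = s v
  -- The chosen preimage of J v differs from v by an element of ker J, on which `s` vanishes by the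
  -- bound.
  have h2 := h (r ⟨J v, LinearMap.mem_range_self J v⟩ - v)
  rw [map_sub, map_sub, hr', sub_self, norm_zero, mul_zero] at h2
  exact sub_eq_zero.1 (norm_le_zero_iff.1 h2)

theorem SchwartzMap.eq_integral_Iic_deriv (w : 𝓢(ℝ, ℂ)) (x : ℝ) :
    w x = ∫ t in Iic x, deriv w t := by
  have hi : Integrable (deriv w) := (SchwartzMap.derivCLM ℂ ℂ w).integrable
  have ht : Filter.Tendsto w Filter.atBot (nhds 0) :=
    w.tendsto_cocompact.mono_left (by rw [cocompact_eq_atBot_atTop]; exact le_sup_left)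
  rw [integral_Iic_of_hasDerivAt_of_tendsto' (fun t _ => w.hasDerivAt t) hi.integrableOn ht, sub_zero]

/-- Integration by parts through Fubini. It trades an integrable density for its tail integral,
which is bounded, as the definition of vanishing to order k demands. -/
theorem integral_mul_schwartz_eq {μ : Measure ℝ} [SFinite μ] {h : ℝ → ℂ} (hh : Integrable h μ)
    (w : 𝓢(ℝ, ℂ)) :
    ∫ x, h x * w x ∂μ = ∫ t, (∫ x in Ici t, h x ∂μ) * deriv w t := by
  have hi : Integrable (deriv w) := (SchwartzMap.derivCLM ℂ ℂ w).integrable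
  have hs : MeasurableSet {p : ℝ × ℝ | p.2 ≤ p.1} := measurableSet_le measurable_snd measurable_fst
  have hInt := (hh.mul_prod hi).indicator hs
  calc ∫ x, h x * w x ∂μ
      = ∫ x, (∫ t, {p : ℝ × ℝ | p.2 ≤ p.1}.indicator (fun p => h p.1 * deriv w p.2) (x, t)) ∂μ := by
        congr 1
        funext x
        rw [w.eq_integral_Iic_deriv x, ← integral_indicator measurableSet_Iic,
          ← integral_const_mul]
        congr 1
        funext t
        by_cases htx : t ≤ x <;> simp [indicator, htx]
    _ = ∫ t, (∫ x, {p : ℝ × ℝ | p.2 ≤ p.1}.indicator (fun p => h p.1 * deriv w p.2) (x, t) ∂μ) :=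
        integral_integral_swap hInt
    _ = _ := by
        congr 1
        funext t
        rw [← integral_indicator measurableSet_Ici, ← integral_mul_const]
        congr 1
        funext x
        by_cases htx : t ≤ x <;> simp [indicator, htx]

theorem memLp_top_setIntegral_Ici {μ : Measure ℝ} [SFinite μ] {h : ℝ → ℂ} (hh : Integrable h μ)
    (ν : Measure ℝ) [SFinite ν] : MemLp (fun t => ∫ x in Ici t, h x ∂μ) ⊤ ν := by
  have hs : MeasurableSet {p : ℝ × ℝ | p.1 ≤ p.2} := measurableSet_le measurable_fst measurable_snd
  have h1 : AEStronglyMeasurable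
      ({p : ℝ × ℝ | p.1 ≤ p.2}.indicator fun p => h p.2) (ν.prod μ) :=
    (hh.aestronglyMeasurable.comp_snd).indicator hs
  have h2 : (fun t => ∫ x in Ici t, h x ∂μ)
      = fun t => ∫ x, {p : ℝ × ℝ | p.1 ≤ p.2}.indicator (fun p => h p.2) (t, x) ∂μ := by
    funext t
    rw [← integral_indicator measurableSet_Ici]
    congr 1
  refine memLp_top_of_bound (h2 ▸ h1.integral_prod_right') (∫ x, ‖h x‖ ∂μ)
    (Filter.Eventually.of_forall fun t => ?_)
  exact (norm_integral_le_integral_norm _).trans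
    (setIntegral_le_integral hh.norm (Filter.Eventually.of_forall fun x => norm_nonneg _))

/-! ### Square-integrable representation on [-1, 1]. -/

/-- Multiplication by `x^K` on Schwartz functions. -/
noncomputable def mulPow (K : ℕ) : 𝓢(ℝ, ℂ) →L[ℂ] 𝓢(ℝ, ℂ) :=
  SchwartzMap.smulLeftCLM ℂ (fun x : ℝ => (x : ℂ) ^ K)

theorem mulPow_apply (K : ℕ) (ψ : 𝓢(ℝ, ℂ)) (x : ℝ) : mulPow K ψ x = (x : ℂ) ^ K * ψ x := by
  rw [mulPow, SchwartzMap.smulLeftCLM_apply_apply (by fun_prop)]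
  rfl

theorem deriv_pow_mul_eulerOp_iterate {ψ : ℝ → ℂ} {x : ℝ} (hψ : ContDiffAt ℝ ∞ ψ x) (K b : ℕ) :
    deriv (fun y : ℝ => (y : ℂ) ^ (K + 1) * eulerOp^[b] ψ y) x
      = (x : ℂ) ^ K * ((K + 1) * eulerOp^[b] ψ x + eulerOp^[b + 1] ψ x) := by
  have h1 : HasDerivAt (fun y : ℝ => (y : ℂ)) 1 x := Complex.ofRealCLM.hasDerivAt
  have h2 := (hψ.eulerOp_iterate b).differentiableAt_infty.hasDerivAt
  have h3 : deriv (fun y : ℝ => (y : ℂ) ^ (K + 1) * eulerOp^[b] ψ y) x = _ :=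
    ((h1.pow (K + 1)).mul h2).deriv
  rw [h3, Function.iterate_succ_apply']
  simp only [eulerOp, Pi.pow_apply]
  push_cast
  simp
  ring

theorem deriv_mulPow_succ (K b : ℕ) (ψ : 𝓢(ℝ, ℂ)) (x : ℝ) :
    deriv (mulPow (K + 1) ((schwartzEuler ^ b) ψ)) x
      = (K + 1) * mulPow K ((schwartzEuler ^ b) ψ) x
        + mulPow K ((schwartzEuler ^ (b + 1)) ψ) x := by
  have : ⇑(mulPow (K + 1) ((schwartzEuler ^ b) ψ))
      = fun y : ℝ => (y : ℂ) ^ (K + 1) * eulerOp^[b] ψ y := by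
    funext y; rw [mulPow_apply, coe_schwartzEuler_iterate]
  rw [this, deriv_pow_mul_eulerOp_iterate (ψ.contDiffAt_infty x), mulPow_apply, mulPow_apply,
    coe_schwartzEuler_iterate, coe_schwartzEuler_iterate]
  ring

/-- Schwartz functions supported in `[-1, 1]`. -/
def unitSupported : Submodule ℂ 𝓢(ℝ, ℂ) where
  carrier := {ψ | ∀ x, 1 ≤ |x| → ψ x = 0}
  add_mem' {φ ψ} hφ hψ x hx := by simp [hφ x hx, hψ x hx]
  zero_mem' x _ := rfl
  smul_mem' c ψ hψ x hx := by simp [hψ x hx]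

theorem eulerOp_iterate_zero_of_eventuallyEq {F : ℝ → ℂ} {x : ℝ} (h : F =ᶠ[nhds x] fun _ => 0)
    (b : ℕ) : eulerOp^[b] F x = 0 := by
  have h0 : eulerOp^[b] (fun _ => (0 : ℂ)) = fun _ => 0 := by
    simpa using eulerOp_iterate_const_mul 0 (fun _ => (0 : ℂ)) b
  rw [(h.eulerOp_iterate b).eq_of_nhds, h0]

theorem eulerOp_iterate_eq_zero_of_mem_unitSupported {ψ : 𝓢(ℝ, ℂ)} (hψ : ψ ∈ unitSupported)
    {x : ℝ} (hx : 1 < |x|) (b : ℕ) : eulerOp^[b] ψ x = 0 := by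
  refine eulerOp_iterate_zero_of_eventuallyEq ?_ b
  filter_upwards [(isOpen_lt continuous_const continuous_abs).mem_nhds hx] with y hy
  exact hψ y (le_of_lt hy)

theorem SchwartzMap.integral_norm_le_two_mul_norm_toLp (u : 𝓢(ℝ, ℂ)) :
    ∫ x in Icc (-1 : ℝ) 1, ‖u x‖ ≤ 2 * ‖u.toLp 2 (volume.restrict (Icc (-1 : ℝ) 1))‖ := by
  set μ : Measure ℝ := volume.restrict (Icc (-1 : ℝ) 1) with hμ
  have hm : AEStronglyMeasurable u μ := u.continuous.aestronglyMeasurable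
  have h1 := eLpNorm_le_eLpNorm_mul_rpow_measure_univ (p := 1) (q := 2) (μ := μ) (by norm_num) hm
  have h2 : μ univ = 2 := by
    simp only [hμ, Measure.restrict_apply_univ, Real.volume_Icc]
    norm_num
  rw [h2] at h1
  -- Hölder on an interval of length 2 gives √2, rounded up to 2.
  have h3 : (2 : ENNReal) ^ (1 / (1 : ENNReal).toReal - 1 / (2 : ENNReal).toReal) ≤ 2 := by
    calc _ ≤ (2 : ENNReal) ^ (1 : ℝ) :=
          ENNReal.rpow_le_rpow_of_exponent_le (by norm_num) (by norm_num)
      _ = 2 := ENNReal.rpow_one 2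
  have h4 : eLpNorm u 1 μ ≤ 2 * eLpNorm u 2 μ := by
    refine h1.trans ?_
    rw [mul_comm]
    gcongr
  rw [integral_norm_eq_lintegral_enorm hm, ← eLpNorm_one_eq_lintegral_enorm, SchwartzMap.norm_toLp]
  have h5 : eLpNorm u 2 μ ≠ ⊤ := (u.eLpNorm_lt_top 2 μ).ne
  have := ENNReal.toReal_mono (ENNReal.mul_ne_top (by norm_num) h5) h4
  simpa using this

/-- One-dimensional Sobolev estimate: v = x^{K+1} θ^b ψ has derivative (K+1) x^K θ^b ψ + x^K θ^{b+1}
ψ, and |v| ≤ ∫ |v'|. It costs one power of x and one Euler derivative. -/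
theorem norm_pow_mul_eulerOp_iterate_le {ψ : 𝓢(ℝ, ℂ)} (hψ : ψ ∈ unitSupported) (K b : ℕ) {B : ℝ}
    (h0 : ‖(mulPow K ((schwartzEuler ^ b) ψ)).toLp 2 (volume.restrict (Icc (-1 : ℝ) 1))‖ ≤ B)
    (h1 : ‖(mulPow K ((schwartzEuler ^ (b + 1)) ψ)).toLp 2
      (volume.restrict (Icc (-1 : ℝ) 1))‖ ≤ B) (x : ℝ) :
    |x| ^ (K + 1) * ‖eulerOp^[b] ψ x‖ ≤ (K + 2) * 2 * B := by
  set u := mulPow K ((schwartzEuler ^ b) ψ)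
  set u' := mulPow K ((schwartzEuler ^ (b + 1)) ψ)
  set v := mulPow (K + 1) ((schwartzEuler ^ b) ψ) with hv
  have hvi : Integrable (deriv v) := (SchwartzMap.derivCLM ℂ ℂ v).integrable
  have hd (t : ℝ) : deriv v t = (K + 1) * u t + u' t := deriv_mulPow_succ K b ψ t
  have e1 : |x| ^ (K + 1) * ‖eulerOp^[b] ψ x‖ = ‖v x‖ := by
    rw [hv, mulPow_apply, coe_schwartzEuler_iterate]; simp
  have e2 : ∫ t, ‖deriv v t‖ = ∫ t in Icc (-1 : ℝ) 1, ‖deriv v t‖ := by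
    refine (setIntegral_eq_integral_of_forall_compl_eq_zero fun t ht => ?_).symm
    have ht' : 1 < |t| := by
      by_contra hcon
      exact ht (abs_le.1 (not_lt.1 hcon))
    rw [hd, mulPow_apply, mulPow_apply, coe_schwartzEuler_iterate, coe_schwartzEuler_iterate,
      eulerOp_iterate_eq_zero_of_mem_unitSupported hψ ht',
      eulerOp_iterate_eq_zero_of_mem_unitSupported hψ ht']
    simp
  rw [e1, v.eq_integral_Iic_deriv x]
  calc _ ≤ ∫ t in Iic x, ‖deriv v t‖ := norm_integral_le_integral_norm _
    _ ≤ ∫ t, ‖deriv v t‖ :=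
        setIntegral_le_integral hvi.norm (Filter.Eventually.of_forall fun x => norm_nonneg _)
    _ = ∫ t in Icc (-1 : ℝ) 1, ‖deriv v t‖ := e2
    _ ≤ ∫ t in Icc (-1 : ℝ) 1, ((K + 1) * ‖u t‖ + ‖u' t‖) := by
        refine integral_mono hvi.norm.integrableOn
          ((u.integrable.norm.const_mul _).add u'.integrable.norm).integrableOn fun t => ?_
        dsimp only
        rw [hd]
        refine (norm_add_le _ _).trans (le_of_eq ?_)
        rw [norm_mul]
        congr 2
        exact_mod_cast RCLike.norm_natCast (K := ℂ) (K + 1)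
    _ = (K + 1) * (∫ t in Icc (-1 : ℝ) 1, ‖u t‖) + ∫ t in Icc (-1 : ℝ) 1, ‖u' t‖ := by
        rw [integral_add (u.integrable.norm.const_mul _).integrableOn
          u'.integrable.norm.integrableOn, integral_const_mul]
    _ ≤ (K + 1) * (2 * B) + 2 * B := by
        gcongr
        · exact u.integral_norm_le_two_mul_norm_toLp.trans (by gcongr)
        · exact u'.integral_norm_le_two_mul_norm_toLp.trans (by gcongr)
    _ = _ := by ring

/-- A flat distribution is, on functions supported in `[-1, 1]`, a sum of `x^K (x d/dx)^b` applied
to square integrable functions. -/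
theorem IsFlat.exists_integral_rep {σ : 𝓢'(ℝ, ℂ)} (hσ : IsFlat σ) (K : ℕ) :
    ∃ (m : ℕ) (h : Fin m → ℝ → ℂ),
      (∀ b, Integrable (h b) (volume.restrict (Icc (-1 : ℝ) 1))) ∧
      ∀ ψ ∈ unitSupported,
        σ ψ = ∑ b : Fin m, ∫ x in Icc (-1 : ℝ) 1,
          h b x * mulPow K ((schwartzEuler ^ (b : ℕ)) ψ) x := by
  obtain ⟨n, m, C, hb⟩ := hσ (K + 1)
  set μ : Measure ℝ := volume.restrict (Icc (-1 : ℝ) 1) with hμ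
  let J₀ (b : ℕ) : 𝓢(ℝ, ℂ) →ₗ[ℂ] Lp ℂ 2 μ :=
    ((SchwartzMap.toLpCLM ℂ ℂ 2 μ) ∘L (mulPow K) ∘L (schwartzEuler ^ b)).toLinearMap
  -- Controlling Euler order b ≤ m in the supremum norm needs L² control up to order m + 1, hence m
  -- + 2 components.
  let J : unitSupported →ₗ[ℂ] (Fin (m + 2) → Lp ℂ 2 μ) :=
    LinearMap.pi fun b => (J₀ b) ∘ₗ unitSupported.subtype
  let s : unitSupported →ₗ[ℂ] ℂ :=
    { toFun := fun ψ => σ ψ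
      map_add' := fun φ ψ => map_add σ _ _
      map_smul' := fun c ψ => map_smul σ _ _ }
  have hJ (ψ : unitSupported) : ‖s ψ‖ ≤ (C * (2 ^ n * ((K + 2) * 2))) * ‖J ψ‖ := by
    have hE : EulerBound (K + 1) n m (2 ^ n * ((K + 2) * 2 * ‖J ψ‖)) ψ := by
      intro b hbm x _
      have hJb (c : ℕ) (hc : c < m + 2) :
          ‖(mulPow K ((schwartzEuler ^ c) (ψ : 𝓢(ℝ, ℂ)))).toLp 2 μ‖ ≤ ‖J ψ‖ :=
        norm_le_pi_norm (J ψ) ⟨c, hc⟩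
      have h1 := norm_pow_mul_eulerOp_iterate_le ψ.2 K b (hJb b (by omega))
        (hJb (b + 1) (by omega)) x
      rcases le_or_gt |x| 1 with hx | hx
      · calc _ = (1 + |x|) ^ n * (|x| ^ (K + 1) * ‖eulerOp^[b] ψ x‖) := by ring
          _ ≤ (1 + 1) ^ n * ((K + 2) * 2 * ‖J ψ‖) := by gcongr
          _ = _ := by norm_num
      · rw [eulerOp_iterate_eq_zero_of_mem_unitSupported ψ.2 hx, norm_zero, mul_zero]
        positivity
    refine (hb _ _ hE).trans (le_of_eq ?_)
    ring
  obtain ⟨g, hg⟩ := exists_clm_of_norm_le J s _ hJ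
  -- The Hahn–Banach extension splits into its restrictions to the factors, each represented by an
  -- L² function through Riesz.
  let gb (b : Fin (m + 2)) : Lp ℂ 2 μ →L[ℂ] ℂ :=
    g ∘L (ContinuousLinearMap.single ℂ (fun _ : Fin (m + 2) => Lp ℂ 2 μ) b)
  let w (b : Fin (m + 2)) : Lp ℂ 2 μ := (InnerProductSpace.toDual ℂ (Lp ℂ 2 μ)).symm (gb b)
  refine ⟨m + 2, fun b x => (starRingEnd ℂ) (w b x), fun b => ?_, fun ψ hψ => ?_⟩
  · have h1 : Integrable (w b) μ := (Lp.memLp (w b)).integrable (by norm_num)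
    exact (LinearIsometryEquiv.integrable_comp_iff (L := RCLike.conjLIE (K := ℂ))).2 h1
  · have h1 : σ ψ = g (J ⟨ψ, hψ⟩) := (hg ⟨ψ, hψ⟩).symm
    have h2 : g (J ⟨ψ, hψ⟩) = ∑ b, gb b (J ⟨ψ, hψ⟩ b) := by
      have h3 := LinearMap.sum_single_apply (fun _ : Fin (m + 2) => Lp ℂ 2 μ) (J ⟨ψ, hψ⟩)
      conv_lhs => rw [← h3]
      rw [map_sum]
      rfl
    rw [h1, h2]
    refine Finset.sum_congr rfl fun b _ => ?_
    have h3 : gb b (J ⟨ψ, hψ⟩ b) = inner ℂ (w b) (J ⟨ψ, hψ⟩ b) :=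
      (InnerProductSpace.toDual_symm_apply).symm
    rw [h3, L2.inner_def]
    refine integral_congr_ae ?_
    filter_upwards [(mulPow K ((schwartzEuler ^ (b : ℕ)) ψ)).coeFn_toLp 2 μ] with x hx
    have h4 : (J ⟨ψ, hψ⟩ b) x = mulPow K ((schwartzEuler ^ (b : ℕ)) ψ) x := hx
    rw [h4]
    simp [mul_comm]

/-! ### Functions vanishing to finite order -/

theorem FunVanishesToOrder.mul {p q : ℕ} {f g : ℝ → ℂ} (hf : FunVanishesToOrder p f)
    (hg : FunVanishesToOrder q g) (hf' : ContDiffAt ℝ ∞ f 0) (hg' : ContDiffAt ℝ ∞ g 0) :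
    FunVanishesToOrder (p + q) (fun x => f x * g x) := by
  intro i hi
  have hn : ∀ {H : ℝ → ℂ}, ContDiffAt ℝ ∞ H 0 → ContDiffAt ℝ (i : ℕ∞ω) H 0 :=
    fun h => h.of_le (by exact_mod_cast le_top)
  rw [iteratedDeriv_fun_mul (hn hf') (hn hg')]
  refine Finset.sum_eq_zero fun j hj => ?_
  have hji := Finset.mem_range.1 hj
  rcases lt_or_ge j p with h | h
  · rw [hf j h]; ring
  · rw [hg (i - j) (by omega)]; ring

theorem FunVanishesToOrder.const_mul {p : ℕ} {f : ℝ → ℂ} (hf : FunVanishesToOrder p f) (c : ℂ) :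
    FunVanishesToOrder p (fun x => c * f x) := by
  intro i hi
  rw [iteratedDeriv_const_mul_field, hf i hi, mul_zero]

theorem FunVanishesToOrder.iteratedDeriv {k : ℕ} {f : ℝ → ℂ} (hf : FunVanishesToOrder k f) (i : ℕ) :
    FunVanishesToOrder (k - i) (iteratedDeriv i f) := by
  intro j hj
  have := hf (j + i) (by omega)
  rwa [iteratedDeriv_eq_iterate, Function.iterate_add_apply, ← iteratedDeriv_eq_iterate,
    ← iteratedDeriv_eq_iterate] at this

theorem FunVanishesToOrder.mono {k l : ℕ} {f : ℝ → ℂ} (hf : FunVanishesToOrder k f) (h : l ≤ k) :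
    FunVanishesToOrder l f := fun i hi => hf i (hi.trans_le h)

theorem FunVanishesToOrder.sum {ι : Type*} {k : ℕ} {s : Finset ι} {f : ι → ℝ → ℂ}
    (hf : ∀ i ∈ s, FunVanishesToOrder k (f i)) (hf' : ∀ i ∈ s, ContDiffAt ℝ ∞ (f i) 0) :
    FunVanishesToOrder k (fun x => ∑ i ∈ s, f i x) := by
  intro j hj
  rw [iteratedDeriv_fun_sum fun i hi => (hf' i hi).of_le (by exact_mod_cast le_top)]
  exact Finset.sum_eq_zero fun i hi => hf i hi j hj

theorem contDiff_ofReal_pow (K : ℕ) : ContDiff ℝ ∞ (fun x : ℝ => (x : ℂ) ^ K) :=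
  Complex.ofRealCLM.contDiff.pow K

theorem funVanishesToOrder_pow (K : ℕ) : FunVanishesToOrder K (fun x : ℝ => (x : ℂ) ^ K) := by
  induction K with
  | zero => intro i hi; omega
  | succ K ih =>
    have h1 : FunVanishesToOrder 1 (fun x : ℝ => (x : ℂ)) := by
      intro i hi
      obtain rfl : i = 0 := by omega
      simp
    simpa only [pow_succ] using ih.mul h1 (contDiff_ofReal_pow K).contDiffAt contDiffAt_ofReal

/-! ### Flat distributions vanish to infinite order: the tangential form -/

theorem iteratedDeriv_succ_ofReal_mul {w : ℝ → ℂ} {x : ℝ} (hw : ContDiffAt ℝ ∞ w x) (i : ℕ) :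
    iteratedDeriv (i + 1) (fun y : ℝ => (y : ℂ) * w y) x
      = x * iteratedDeriv (i + 1) w x + (i + 1) * iteratedDeriv i w x := by
  have h1 : deriv (fun y : ℝ => (y : ℂ) * w y) =ᶠ[nhds x] fun y => w y + eulerOp w y := by
    filter_upwards [hw.eventually_differentiableAt] with y hy
    have : HasDerivAt (fun y : ℝ => (y : ℂ)) 1 y := Complex.ofRealCLM.hasDerivAt
    have h := (this.mul hy.hasDerivAt).deriv
    change deriv ((fun y : ℝ => (y : ℂ)) * w) y = _
    rw [h, eulerOp]; ring
  have hn : ∀ {H : ℝ → ℂ}, ContDiffAt ℝ ∞ H x → ContDiffAt ℝ (i : ℕ∞ω) H x :=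
    fun h => h.of_le (by exact_mod_cast le_top)
  rw [iteratedDeriv_succ', h1.iteratedDeriv_eq i, iteratedDeriv_fun_add (hn hw) (hn hw.eulerOp),
    iteratedDeriv_eulerOp hw]
  ring

/-- The terms (d/dx)^i x^i are, up to sign, transposes of the tangential operators x^i (d/dx)^i, so
this puts Euler derivatives in the shape that `diffOpTranspose` requires. -/
theorem exists_pow_mul_eulerOp_iterate_eq (K b : ℕ) : ∃ c : ℕ → ℂ, (∀ i, b < i → c i = 0) ∧
    ∀ (ψ : ℝ → ℂ), ContDiff ℝ ∞ ψ → ∀ x : ℝ, (x : ℂ) ^ K * eulerOp^[b] ψ x =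
      ∑ i ∈ Finset.range (b + 1),
        c i * iteratedDeriv i (fun y : ℝ => (y : ℂ) ^ i * ((y : ℂ) ^ K * ψ y)) x := by
  induction b with
  | zero =>
    refine ⟨fun i => if i = 0 then 1 else 0, fun i hi => by simp [hi.ne'], fun ψ _ x => ?_⟩
    simp
  | succ b ih =>
    obtain ⟨c, hc, ih⟩ := ih
    -- The recursion combines θ E_i = E_{i+1} - (i+1) E_i with x^K θ^{b+1} ψ = θ(x^K θ^b ψ) - K x^K
    -- θ^b ψ.
    refine ⟨fun i => (if i = 0 then 0 else c (i - 1)) - (i + 1 + K) * c i, fun i hi => ?_,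
      fun ψ hψ x => ?_⟩
    · dsimp only
      rw [hc i (by omega), hc (i - 1) (by omega)]; simp
    · set E : ℕ → ℝ → ℂ := fun i => iteratedDeriv i
        (fun y : ℝ => (y : ℂ) ^ i * ((y : ℂ) ^ K * ψ y)) with hE
      have hw (i : ℕ) (y : ℝ) : ContDiffAt ℝ ∞ (fun y : ℝ => (y : ℂ) ^ i * ((y : ℂ) ^ K * ψ y)) y :=
        ((contDiff_ofReal_pow i).mul ((contDiff_ofReal_pow K).mul hψ)).contDiffAt
      have hEs (i : ℕ) : ContDiffAt ℝ ∞ (E i) x := (hw i x).iteratedDeriv_infty i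
      have hEθ (i : ℕ) : eulerOp (E i) x = E (i + 1) x - (i + 1) * E i x := by
        have h1 := iteratedDeriv_succ_ofReal_mul (hw i x) i
        have h2 : (fun y : ℝ => (y : ℂ) * ((y : ℂ) ^ i * ((y : ℂ) ^ K * ψ y)))
            = fun y : ℝ => (y : ℂ) ^ (i + 1) * ((y : ℂ) ^ K * ψ y) := by funext y; ring
        rw [h2] at h1
        simp only [hE, eulerOp]
        rw [h1, iteratedDeriv_succ]; ring
      have hφ : ContDiffAt ℝ ∞ (eulerOp^[b] ψ) x := (hψ.contDiffAt).eulerOp_iterate b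
      have h1 : eulerOp (fun y : ℝ => (y : ℂ) ^ K * eulerOp^[b] ψ y) x
          = K * ((x : ℂ) ^ K * eulerOp^[b] ψ x) + (x : ℂ) ^ K * eulerOp^[b + 1] ψ x := by
        rw [(eulerOp_mul_eventuallyEq (contDiff_ofReal_pow K).contDiffAt hφ).eq_of_nhds,
          Function.iterate_succ_apply']
        have : eulerOp (fun y : ℝ => (y : ℂ) ^ K) x = K * (x : ℂ) ^ K := by
          have h1 : HasDerivAt (fun y : ℝ => (y : ℂ)) 1 x := Complex.ofRealCLM.hasDerivAt
          have h2 : deriv (fun y : ℝ => (y : ℂ) ^ K) x = _ := (h1.pow K).deriv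
          rw [eulerOp, h2]
          rcases K with - | K
          · simp
          · simp; ring
        rw [this]; ring
      have h2 : eulerOp (fun y : ℝ => (y : ℂ) ^ K * eulerOp^[b] ψ y) x
          = ∑ i ∈ Finset.range (b + 1), c i * (E (i + 1) x - (i + 1) * E i x) := by
        have : (fun y : ℝ => (y : ℂ) ^ K * eulerOp^[b] ψ y)
            = fun y => ∑ i ∈ Finset.range (b + 1), c i * E i y := funext fun y => ih ψ hψ y
        rw [this, eulerOp, deriv_fun_sum fun i _ =>
          ((hEs i).differentiableAt_infty.const_mul (c i)), Finset.mul_sum]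
        refine Finset.sum_congr rfl fun i _ => ?_
        rw [← hEθ, eulerOp, deriv_const_mul_field]; ring
      have h3 : (x : ℂ) ^ K * eulerOp^[b + 1] ψ x
          = ∑ i ∈ Finset.range (b + 1), c i * (E (i + 1) x - (i + 1) * E i x)
            - K * ∑ i ∈ Finset.range (b + 1), c i * E i x := by
        rw [← h2, h1, ih ψ hψ x]; ring
      rw [h3]
      simp only [sub_mul, Finset.sum_sub_distrib]
      rw [Finset.sum_range_succ' (n := b + 1), Finset.sum_range_succ _ (b + 1), hc (b + 1) (by omega),
        Finset.mul_sum]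
      simp only [Nat.add_eq_zero_iff, one_ne_zero, and_false, if_false, if_true, zero_mul, add_zero,
        Nat.add_sub_cancel, mul_zero, mul_sub, Finset.sum_sub_distrib]
      rw [sub_sub, ← Finset.sum_add_distrib]
      congr 1
      refine Finset.sum_congr rfl fun i _ => ?_
      ring

theorem isTangential_const_mul_pow (U : Set ℝ) (hU : IsOpen U) (h0 : (0 : ℝ) ∈ U) (m : ℕ)
    (c : ℕ → ℂ) : IsTangential U m (fun i x => c i * (x : ℂ) ^ i) := by
  intro k φ hφ hk
  have hφ0 : ContDiffAt ℝ ∞ φ 0 := hφ.contDiffAt (hU.mem_nhds h0)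
  have hp (i : ℕ) : ContDiffAt ℝ ∞ (fun x : ℝ => c i * (x : ℂ) ^ i) 0 :=
    (contDiff_const.mul (contDiff_ofReal_pow i)).contDiffAt
  refine FunVanishesToOrder.sum (fun i _ => ?_) fun i _ => (hp i).mul (hφ0.iteratedDeriv_infty i)
  exact (((funVanishesToOrder_pow i).const_mul (c i)).mul (hk.iteratedDeriv i) (hp i)
    (hφ0.iteratedDeriv_infty i)).mono (by omega)

theorem IsFlat.vanishesToOrder {σ : 𝓢'(ℝ, ℂ)} (hσ : IsFlat σ) (K : ℕ) : VanishesToOrder K σ := by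
  -- The extra power of x is consumed when the density is integrated once to become bounded.
  obtain ⟨m, h, hh, hrep⟩ := hσ.exists_integral_rep (K + 1)
  choose c hc0 hc using exists_pow_mul_eulerOp_iterate_eq K
  -- These coefficients come from (x^{K+1} θ^b ψ)' = (K+1) x^K θ^b ψ + x^K θ^{b+1} ψ; the sign
  -- (-1)^i used below cancels the one in the transpose.
  set d : ℕ → ℕ → ℂ := fun b i => (K + 1) * c b i + c (b + 1) i with hd
  refine ⟨Ioo (-1) 1, isOpen_Ioo, by simp, m, fun b => b + 1,
    fun b i x => ((-1) ^ i * d b i) * (x : ℂ) ^ i, fun _ x => (x : ℂ) ^ K,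
    fun b t => ∫ x in Ici t, h b x ∂(volume.restrict (Icc (-1 : ℝ) 1)), ?_, ?_, ?_, ?_, ?_⟩
  · exact fun j i _ => (contDiff_const.mul (contDiff_ofReal_pow i)).contDiffOn
  · exact fun j => isTangential_const_mul_pow _ isOpen_Ioo (by simp) _ _
  · exact fun j => ⟨(contDiff_ofReal_pow K).contDiffOn, funVanishesToOrder_pow K⟩
  · exact fun j L _ _ => memLp_top_setIntegral_Ici (hh j) _
  · intro ψ _ hψ
    have hmem : ψ ∈ unitSupported := fun x hx => by
      by_contra hne
      have := hψ (subset_tsupport _ hne)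
      exact absurd (abs_lt.2 this) (not_lt.2 hx)
    rw [hrep ψ hmem]
    refine Finset.sum_congr rfl fun b _ => ?_
    rw [integral_mul_schwartz_eq (hh b)]
    congr 1
    funext t
    congr 1
    rw [deriv_mulPow_succ, mulPow_apply, mulPow_apply, coe_schwartzEuler_iterate,
      coe_schwartzEuler_iterate, hc _ ψ (ψ.smooth ⊤), hc _ ψ (ψ.smooth ⊤), diffOpTranspose]
    -- The order-b expansion is padded by its zero coefficient at b + 1 so that both sums have the
    -- same range.
    have hext : ∑ i ∈ Finset.range ((b : ℕ) + 1), c b i *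
        iteratedDeriv i (fun y : ℝ => (y : ℂ) ^ i * ((y : ℂ) ^ K * ψ y)) t
        = ∑ i ∈ Finset.range ((b : ℕ) + 1 + 1), c b i *
        iteratedDeriv i (fun y : ℝ => (y : ℂ) ^ i * ((y : ℂ) ^ K * ψ y)) t := by
      rw [Finset.sum_range_succ _ ((b : ℕ) + 1), hc0 b _ (Nat.lt_succ_self _)]; simp
    rw [hext, Finset.mul_sum, ← Finset.sum_add_distrib]
    refine Finset.sum_congr rfl fun i _ => ?_
    have : (fun y : ℝ => (-1) ^ i * d b i * (y : ℂ) ^ i * ((y : ℂ) ^ K * ψ y))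
        = fun y : ℝ => ((-1) ^ i * d b i) * ((y : ℂ) ^ i * ((y : ℂ) ^ K * ψ y)) := by
      funext y; ring
    have hs : (-1 : ℂ) ^ i * (-1) ^ i = 1 := by rw [← mul_pow]; simp
    rw [this, iteratedDeriv_const_mul_field, mul_assoc ((-1 : ℂ) ^ i) (d b i),
      ← mul_assoc ((-1 : ℂ) ^ i) ((-1) ^ i), hs, one_mul]
    simp only [hd]
    ring

/-! ### Distributions vanishing to infinite order are flat -/

theorem iteratedDeriv_ofReal_pow (l i : ℕ) :
    iteratedDeriv i (fun x : ℝ => (x : ℂ) ^ l)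
      = fun x : ℝ => (l.descFactorial i : ℂ) * (x : ℂ) ^ (l - i) := by
  induction i with
  | zero => simp
  | succ i ih =>
    rw [iteratedDeriv_succ, ih]
    funext x
    have h1 : HasDerivAt (fun y : ℝ => (y : ℂ)) 1 x := Complex.ofRealCLM.hasDerivAt
    have h2 : deriv (fun y : ℝ => (y : ℂ) ^ (l - i)) x = _ := (h1.pow (l - i)).deriv
    rw [deriv_const_mul_field, h2, Nat.descFactorial_succ]
    simp only [mul_one, Nat.sub_sub]
    push_cast
    ring

/-- Apply the operator to x^l. By induction the terms with i < l vanish to order i + (l - i) = l,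
those with i > l are zero, and what is left is l! a_l. -/
theorem IsTangential.funVanishesToOrder {U : Set ℝ} {m : ℕ} {a : ℕ → ℝ → ℂ}
    (h : IsTangential U m a) (ha : ∀ i ≤ m, ContDiffAt ℝ ∞ (a i) 0) (l : ℕ) (hl : l ≤ m) :
    FunVanishesToOrder l (a l) := by
  induction l using Nat.strong_induction_on with
  | _ l ih =>
    have h1 := h l _ (contDiff_ofReal_pow l).contDiffOn (funVanishesToOrder_pow l)
    have hs (i : ℕ) (hi : i ≤ m) :
        ContDiffAt ℝ ∞ (fun x : ℝ => a i x * iteratedDeriv i (fun x : ℝ => (x : ℂ) ^ l) x) 0 :=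
      (ha i hi).mul ((contDiff_ofReal_pow l).contDiffAt.iteratedDeriv_infty i)
    have h2 : FunVanishesToOrder l (fun x => ∑ i ∈ (Finset.range (m + 1)).erase l,
        a i x * iteratedDeriv i (fun x : ℝ => (x : ℂ) ^ l) x) := by
      refine FunVanishesToOrder.sum (fun i hi => ?_) fun i hi => hs i ?_
      · have him : i ≤ m := by
          have := Finset.mem_range.1 (Finset.mem_of_mem_erase hi); omega
        rcases lt_or_ge i l with hil | hil
        · exact ((ih i hil him).mul ((funVanishesToOrder_pow l).iteratedDeriv i) (ha i him)
            ((contDiff_ofReal_pow l).contDiffAt.iteratedDeriv_infty i)).mono (by omega)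
        · have hne := Finset.ne_of_mem_erase hi
          rw [iteratedDeriv_ofReal_pow, Nat.descFactorial_of_lt (by omega)]
          intro j _
          simp
      · have := Finset.mem_range.1 (Finset.mem_of_mem_erase hi); omega
    intro j hj
    have h3 : diffOp m a (fun x : ℝ => (x : ℂ) ^ l) = fun x =>
        a l x * iteratedDeriv l (fun x : ℝ => (x : ℂ) ^ l) x
        + ∑ i ∈ (Finset.range (m + 1)).erase l,
          a i x * iteratedDeriv i (fun x : ℝ => (x : ℂ) ^ l) x := by
      funext x
      rw [diffOp, ← Finset.add_sum_erase _ _ (Finset.mem_range.2 (Nat.lt_succ_of_le hl))]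
    have h4 := h1 j hj
    have hn : ∀ {H : ℝ → ℂ}, ContDiffAt ℝ ∞ H 0 → ContDiffAt ℝ (j : ℕ∞ω) H 0 :=
      fun h => h.of_le (by exact_mod_cast le_top)
    rw [h3, iteratedDeriv_fun_add (hn (hs l hl)) (hn (ContDiffAt.sum fun i hi => hs i (by
      have := Finset.mem_range.1 (Finset.mem_of_mem_erase hi); omega))), h2 j hj, add_zero,
      iteratedDeriv_ofReal_pow] at h4
    have h5 : (fun x : ℝ => a l x * ((l.descFactorial l : ℂ) * (x : ℂ) ^ (l - l)))
        = fun x => (l.factorial : ℂ) * a l x := by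
      funext x; rw [Nat.descFactorial_self]; simp [mul_comm]
    rw [h5, iteratedDeriv_const_mul_field] at h4
    exact (mul_eq_zero.1 h4).resolve_left (by exact_mod_cast l.factorial_ne_zero)

/-- Taylor's estimate, by induction on the order through the mean value inequality for G'. -/
theorem FunVanishesToOrder.exists_norm_le {n : ℕ} {G : ℝ → ℂ} {r : ℝ}
    (hG : ∀ x, |x| ≤ r → ContDiffAt ℝ ∞ G x) (h : FunVanishesToOrder n G) :
    ∃ C : ℝ, 0 ≤ C ∧ ∀ x, |x| ≤ r → ‖G x‖ ≤ C * |x| ^ n := by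
  induction n generalizing G with
  | zero =>
    have hc : ContinuousOn G (Icc (-r) r) := fun x hx =>
      (hG x (abs_le.2 hx)).continuousAt.continuousWithinAt
    obtain ⟨C, hC⟩ := isCompact_Icc.exists_bound_of_continuousOn hc
    exact ⟨|C|, abs_nonneg C, fun x hx => by
      simpa using (hC x (abs_le.1 hx)).trans (le_abs_self C)⟩
  | succ n ih =>
    obtain ⟨C, hC0, hC⟩ := ih (G := deriv G) (fun x hx => (hG x hx).deriv_infty) fun i hi => by
      rw [← iteratedDeriv_succ']; exact h (i + 1) (by omega)
    refine ⟨C, hC0, fun x hx => ?_⟩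
    have h0 : G 0 = 0 := by simpa using h 0 (by omega)
    have hmv := (convex_Icc (-|x|) |x|).norm_image_sub_le_of_norm_deriv_le (f := G)
      (C := C * |x| ^ n) (x := 0) (y := x)
      (fun y hy => (hG y ((abs_le.2 hy).trans hx)).differentiableAt_infty)
      (fun y hy => (hC y ((abs_le.2 hy).trans hx)).trans
        (mul_le_mul_of_nonneg_left (pow_le_pow_left₀ (abs_nonneg y) (abs_le.2 hy) n) hC0))
      ⟨neg_nonpos.2 (abs_nonneg x), abs_nonneg x⟩ ⟨neg_abs_le x, le_abs_self x⟩
    rw [h0, sub_zero, sub_zero, Real.norm_eq_abs] at hmv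
    rw [pow_succ, ← mul_assoc]
    exact hmv

/-- In the Leibniz formula G^{(j)} = O(|x|^{i+K-j}) supplies both the weight |x|^{i-j} that turns
ψ^{(i-j)} into Euler derivatives and the weight |x|^K. -/
theorem FunVanishesToOrder.exists_norm_iteratedDeriv_mul_le {i K : ℕ} {G : ℝ → ℂ} {r : ℝ}
    (hG : ∀ x, |x| ≤ r → ContDiffAt ℝ ∞ G x) (h : FunVanishesToOrder (i + K) G) :
    ∃ C : ℝ, 0 ≤ C ∧ ∀ (ψ : ℝ → ℂ) (x M : ℝ), x ≠ 0 → |x| ≤ r → ContDiffAt ℝ ∞ ψ x →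
      (∀ b ≤ i, |x| ^ K * ‖eulerOp^[b] ψ x‖ ≤ M) →
      ‖_root_.iteratedDeriv i (fun y => G y * ψ y) x‖ ≤ C * M := by
  choose A hA0 hA using fun j => FunVanishesToOrder.exists_norm_le
    (fun x hx => (hG x hx).iteratedDeriv_infty j) (h.iteratedDeriv j)
  choose B hB0 hB using exists_abs_pow_mul_norm_iteratedDeriv_le
  refine ⟨∑ j ∈ Finset.range (i + 1), (i.choose j : ℝ) * (A j * B (i - j)),
    Finset.sum_nonneg fun j _ => mul_nonneg (Nat.cast_nonneg _) (mul_nonneg (hA0 _) (hB0 _)),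
    fun ψ x M hx hxr hψ hM => ?_⟩
  have hx' : 0 < |x| := abs_pos.2 hx
  have hn : ∀ {H : ℝ → ℂ}, ContDiffAt ℝ ∞ H x → ContDiffAt ℝ (i : ℕ∞ω) H x :=
    fun h => h.of_le (by exact_mod_cast le_top)
  rw [iteratedDeriv_fun_mul (hn (hG x hxr)) (hn hψ), Finset.sum_mul]
  refine norm_sum_le_of_le _ fun j hj => ?_
  have hji : j ≤ i := by have := Finset.mem_range.1 hj; omega
  have h1 := hA j x hxr
  have h2 := hB (i - j) ψ x (M / |x| ^ K) hψ fun b hb => by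
    rw [le_div_iff₀ (by positivity), mul_comm]; exact hM b (by omega)
  have hAj := hA0 j
  rw [norm_mul, norm_mul, Complex.norm_natCast, mul_assoc, mul_assoc (i.choose j : ℝ)]
  refine mul_le_mul_of_nonneg_left ?_ (Nat.cast_nonneg _)
  calc _ ≤ (A j * |x| ^ (i + K - j)) * ‖_root_.iteratedDeriv (i - j) ψ x‖ := by gcongr
    _ = A j * |x| ^ K * (|x| ^ (i - j) * ‖_root_.iteratedDeriv (i - j) ψ x‖) := by
      rw [show i + K - j = K + (i - j) by omega, pow_add]; ring
    _ ≤ A j * |x| ^ K * (B (i - j) * (M / |x| ^ K)) := by gcongr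
    _ = _ := by field_simp

/-- The product a_i f vanishes to order i + K, so the i-th derivative of a_i f ψ is bounded by the
weighted norm of ψ; `h` is essentially bounded on the interval. -/
theorem exists_norm_integral_diffOpTranspose_le {m K : ℕ} {a : ℕ → ℝ → ℂ} {f h : ℝ → ℂ} {r : ℝ}
    (ha : ∀ i ≤ m, ∀ x, |x| ≤ r → ContDiffAt ℝ ∞ (a i) x)
    (hav : ∀ i ≤ m, FunVanishesToOrder i (a i)) (hf : ∀ x, |x| ≤ r → ContDiffAt ℝ ∞ f x)
    (hfv : FunVanishesToOrder K f) (hr : 0 ≤ r)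
    (hh : MemLp h ⊤ (volume.restrict (Icc (-r) r))) :
    ∃ C : ℝ, 0 ≤ C ∧ ∀ (ψ : 𝓢(ℝ, ℂ)) (M : ℝ), (∀ x, r ≤ |x| → ψ x = 0) → EulerBound K 0 m M ψ →
      ‖∫ x, h x * diffOpTranspose m a (fun y => f y * ψ y) x‖ ≤ C * M := by
  have hex : ∀ i, ∃ C : ℝ, 0 ≤ C ∧ (i ≤ m → ∀ (ψ : ℝ → ℂ) (x M : ℝ), x ≠ 0 → |x| ≤ r →
      ContDiffAt ℝ ∞ ψ x → (∀ b ≤ i, |x| ^ K * ‖eulerOp^[b] ψ x‖ ≤ M) →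
      ‖iteratedDeriv i (fun y => (a i y * f y) * ψ y) x‖ ≤ C * M) := by
    intro i
    by_cases hi : i ≤ m
    · obtain ⟨C, hC0, hC⟩ := FunVanishesToOrder.exists_norm_iteratedDeriv_mul_le
        (fun x hx => (ha i hi x hx).mul (hf x hx)) ((hav i hi).mul hfv (ha i hi 0 (by simpa))
          (hf 0 (by simpa)))
      exact ⟨C, hC0, fun _ => hC⟩
    · exact ⟨0, le_rfl, fun h => absurd h hi⟩
  choose C hC0 hC using hex
  set B := (eLpNorm h ⊤ (volume.restrict (Icc (-r) r))).toReal
  set S := ∑ i ∈ Finset.range (m + 1), C i with hS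
  have hS0 : 0 ≤ S := Finset.sum_nonneg fun i _ => hC0 i
  refine ⟨B * S * (2 * r), by positivity, fun ψ M hψ hM => ?_⟩
  have hz (x : ℝ) (hx : r < |x|) : diffOpTranspose m a (fun y => f y * ψ y) x = 0 := by
    refine Finset.sum_eq_zero fun i _ => ?_
    have : (fun y => a i y * (f y * ψ y)) =ᶠ[nhds x] fun _ => 0 := by
      filter_upwards [(isOpen_lt continuous_const continuous_abs).mem_nhds hx] with y hy
      rw [hψ y (le_of_lt hy)]; ring
    rw [this.iteratedDeriv_eq]
    simp
  have e1 : ∫ x, h x * diffOpTranspose m a (fun y => f y * ψ y) x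
      = ∫ x in Icc (-r) r, h x * diffOpTranspose m a (fun y => f y * ψ y) x := by
    refine (setIntegral_eq_integral_of_forall_compl_eq_zero fun x hx => ?_).symm
    rw [hz x (by by_contra hcon; exact hx (abs_le.1 (not_lt.1 hcon))), mul_zero]
  have hbd : ∀ᵐ x ∂(volume.restrict (Icc (-r) r)),
      ‖h x * diffOpTranspose m a (fun y => f y * ψ y) x‖ ≤ B * (S * M) := by
    have h0 : ∀ᵐ x ∂(volume.restrict (Icc (-r) r)), x ≠ (0 : ℝ) :=
      ae_restrict_of_ae (compl_mem_ae_iff.2 (measure_singleton (0 : ℝ)))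
    have hB : ∀ᵐ x ∂(volume.restrict (Icc (-r) r)), ‖h x‖ ≤ B := by
      have := ae_le_eLpNormEssSup (f := h) (μ := volume.restrict (Icc (-r) r))
      filter_upwards [this] with x hx
      rw [← eLpNorm_exponent_top] at hx
      have := ENNReal.toReal_mono hh.eLpNorm_ne_top hx
      simpa [B] using this
    filter_upwards [h0, hB, ae_restrict_mem measurableSet_Icc] with x hx0 hxB hxr
    rw [norm_mul]
    refine mul_le_mul hxB ?_ (norm_nonneg _) ENNReal.toReal_nonneg
    rw [diffOpTranspose, hS, Finset.sum_mul]
    refine norm_sum_le_of_le _ fun i hi => ?_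
    have him : i ≤ m := by have := Finset.mem_range.1 hi; omega
    rw [norm_mul, norm_pow, norm_neg, norm_one, one_pow, one_mul]
    simp only [← mul_assoc]
    refine hC i him ψ x M hx0 (abs_le.2 hxr) (ψ.contDiffAt_infty x) fun b hb => ?_
    simpa using hM b (hb.trans him) x hx0
  rw [e1]
  have := norm_setIntegral_le_of_norm_le_const_ae (μ := volume) (s := Icc (-r) r) (by simp) hbd
  refine this.trans (le_of_eq ?_)
  simp only [Measure.real, Real.volume_Icc]
  rw [ENNReal.toReal_ofReal (by linarith)]
  ring

theorem VanishesToOrder.exists_local_bound {σ : 𝓢'(ℝ, ℂ)} {K : ℕ} (hσ : VanishesToOrder K σ) :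
    ∃ (r : ℝ) (m : ℕ) (C : ℝ), 0 < r ∧ 0 ≤ C ∧ ∀ (ψ : 𝓢(ℝ, ℂ)) (M : ℝ),
      (∀ x, r ≤ |x| → ψ x = 0) → EulerBound K 0 m M ψ → ‖σ ψ‖ ≤ C * M := by
  obtain ⟨U, hU, hU0, N, m, a, f, h, ha, hat, hf, hh, hrep⟩ := hσ
  obtain ⟨r, hr, hrU⟩ := Metric.nhds_basis_closedBall.mem_iff.1 (hU.mem_nhds hU0)
  have hrU' : ∀ x, |x| ≤ r → x ∈ U := fun x hx => hrU (by simpa using hx)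
  have hIcc : Icc (-r) r ⊆ U := fun x hx => hrU' x (abs_le.2 hx)
  have hc (x : ℝ) (hx : |x| ≤ r) {g : ℝ → ℂ} (hg : ContDiffOn ℝ ∞ g U) : ContDiffAt ℝ ∞ g x :=
    hg.contDiffAt (hU.mem_nhds (hrU' x hx))
  choose C hC0 hC using fun j => exists_norm_integral_diffOpTranspose_le (m := m j) (K := K)
    (a := a j) (f := f j) (h := h j) (r := r) (fun i hi x hx => hc x hx (ha j i hi))
    (fun i hi => (hat j).funVanishesToOrder
      (fun i hi => hc 0 (by simpa using hr.le) (ha j i hi)) i hi)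
    (fun x hx => hc x hx (hf j).1) (hf j).2 hr.le (hh j _ hIcc isCompact_Icc)
  refine ⟨r, Finset.univ.sup m, ∑ j, C j, hr, Finset.sum_nonneg fun j _ => hC0 j,
    fun ψ M hψ hM => ?_⟩
  have hsub : Function.support ψ ⊆ Icc (-r) r := fun x hx => by
    by_contra hcon
    exact hx (hψ x (le_of_not_gt fun hlt => hcon (abs_le.1 hlt.le)))
  rw [hrep ψ (HasCompactSupport.of_support_subset_isCompact isCompact_Icc hsub)
    ((closure_minimal hsub isClosed_Icc).trans hIcc), Finset.sum_mul]
  exact norm_sum_le_of_le _ fun j _ =>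
    hC j ψ M hψ (hM.mono le_rfl (Finset.le_sup (Finset.mem_univ j)) le_rfl)

theorem exists_abs_pow_mul_norm_iteratedDeriv_le_of_eulerBound (K p q : ℕ) {δ : ℝ} (hδ : 0 < δ) :
    ∃ C : ℝ, 0 ≤ C ∧ ∀ (H : ℝ → ℂ) (M : ℝ), (∀ x, x ≠ 0 → ContDiffAt ℝ ∞ H x) →
      EulerBound K q p M H → ∀ x, δ ≤ |x| → |x| ^ q * ‖iteratedDeriv p H x‖ ≤ C * M := by
  obtain ⟨C, hC0, hC⟩ := exists_abs_pow_mul_norm_iteratedDeriv_le p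
  refine ⟨C / δ ^ (p + K), by positivity, fun H M hH hM x hx => ?_⟩
  have hx' : 0 < |x| := hδ.trans_le hx
  have hx0 : x ≠ 0 := abs_pos.1 hx'
  have h1 := hC H x (M / (|x| ^ K * (1 + |x|) ^ q)) (hH x hx0) fun b hb => by
    rw [le_div_iff₀ (by positivity), mul_comm]; exact hM b hb x hx0
  have hM0 := hM.nonneg
  have h2 : |x| ^ p * (|x| ^ q * ‖iteratedDeriv p H x‖) ≤ C * M / |x| ^ K := by
    calc _ = |x| ^ q * (|x| ^ p * ‖iteratedDeriv p H x‖) := by ring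
      _ ≤ (1 + |x|) ^ q * (C * (M / (|x| ^ K * (1 + |x|) ^ q))) := by
        gcongr; linarith
      _ = _ := by field_simp
  calc |x| ^ q * ‖iteratedDeriv p H x‖ = |x| ^ p * (|x| ^ q * ‖iteratedDeriv p H x‖) / |x| ^ p := by
        field_simp
    _ ≤ C * M / |x| ^ K / |x| ^ p := by gcongr
    _ = C * M / |x| ^ (p + K) := by rw [div_div, ← pow_add, add_comm]
    _ ≤ C * M / δ ^ (p + K) := by gcongr
    _ = _ := by ring

/-- Away from 0 the singular weight is harmless, so continuity of σ for finitely many Schwartz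
seminorms is enough; nothing about σ at 0 enters. -/
theorem exists_norm_apply_le_of_eq_zero_near (σ : 𝓢'(ℝ, ℂ)) (K : ℕ) {δ : ℝ} (hδ : 0 < δ) :
    ∃ (n m : ℕ) (C : ℝ), 0 ≤ C ∧ ∀ (ψ : 𝓢(ℝ, ℂ)) (M : ℝ), (∀ x, |x| ≤ δ → ψ x = 0) →
      EulerBound K n m M ψ → ‖σ ψ‖ ≤ C * M := by
  obtain ⟨s, C, -, hs⟩ := Seminorm.bound_of_continuous (schwartz_withSeminorms ℂ ℝ ℂ)
    ((normSeminorm ℂ ℂ).comp σ.toLinearMap) (continuous_norm.comp σ.continuous)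
  choose D hD0 hD using fun i : ℕ × ℕ =>
    exists_abs_pow_mul_norm_iteratedDeriv_le_of_eulerBound K i.2 i.1 hδ
  refine ⟨s.sup Prod.fst, s.sup Prod.snd, C * ∑ i ∈ s, D i,
    mul_nonneg C.2 (Finset.sum_nonneg fun i _ => hD0 i), fun ψ M hψ hM => ?_⟩
  have hM0 := hM.nonneg
  have h1 : (s.sup (schwartzSeminormFamily ℂ ℝ ℂ)) ψ ≤ (∑ i ∈ s, D i) * M := by
    refine Seminorm.finset_sup_apply_le
      (mul_nonneg (Finset.sum_nonneg fun i _ => hD0 i) hM0) fun i hi => ?_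
    refine le_trans ?_ (mul_le_mul_of_nonneg_right
      (Finset.single_le_sum (fun i _ => hD0 i) hi) hM0)
    refine SchwartzMap.seminorm_le_bound' ℂ i.1 i.2 ψ (mul_nonneg (hD0 i) hM0) fun x => ?_
    rcases lt_or_ge |x| δ with hx | hx
    · have : ψ =ᶠ[nhds x] fun _ => 0 := by
        filter_upwards [(isOpen_lt continuous_abs continuous_const).mem_nhds hx] with y hy
        exact hψ y (le_of_lt hy)
      rw [this.iteratedDeriv_eq]
      simpa using mul_nonneg (hD0 i) hM0
    · exact hD i ψ M (fun x _ => ψ.contDiffAt_infty x)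
        (hM.mono (Finset.le_sup (f := Prod.fst) hi) (Finset.le_sup (f := Prod.snd) hi) le_rfl) x hx
  calc ‖σ ψ‖ ≤ C * (s.sup (schwartzSeminormFamily ℂ ℝ ℂ)) ψ := hs ψ
    _ ≤ C * ((∑ i ∈ s, D i) * M) := mul_le_mul_of_nonneg_left h1 C.2
    _ = _ := by ring

theorem VanishesToInfiniteOrder.isFlat {σ : 𝓢'(ℝ, ℂ)} (hσ : VanishesToInfiniteOrder σ) :
    IsFlat σ := by
  intro K
  obtain ⟨r, m₁, C₁, hr, hC₁, h₁⟩ := (hσ K).exists_local_bound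
  obtain ⟨n, m₂, C₂, hC₂, h₂⟩ := exists_norm_apply_le_of_eq_zero_near σ K (half_pos hr)
  set m := max m₁ m₂
  -- χ is 1 for |x| ≤ r/2 and 0 for |x| ≥ r: χψ falls under the local bound and (1 - χ)ψ under the
  -- bound away from 0.
  set χ : ℝ → ℂ := fun x => plateau (2 / r * x) with hχ
  have hc0 : 2 / r ≠ 0 := by positivity
  have hχs : ContDiff ℝ ∞ χ := (plateau.smooth ⊤).comp (contDiff_const.mul contDiff_id)
  have hχ1 (x : ℝ) (hx : |x| ≤ r / 2) : χ x = 1 := plateau_eq_one (by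
    rw [abs_mul, abs_of_pos (by positivity)]
    calc 2 / r * |x| ≤ 2 / r * (r / 2) := by gcongr
      _ = 1 := by field_simp)
  have hχ0 (x : ℝ) (hx : r ≤ |x|) : χ x = 0 := plateau_eq_zero (by
    rw [abs_mul, abs_of_pos (by positivity)]
    calc 2 = 2 / r * r := by field_simp
      _ ≤ 2 / r * |x| := by gcongr)
  set B := eulerNorm 0 0 m plateau
  have hB : EulerBound 0 0 m B χ := (eulerBound_eulerNorm 0 0 m plateau).comp_mul hc0
  have hB' : EulerBound 0 0 m (‖(1 : ℂ)‖ + ‖(-1 : ℂ)‖ * B) (fun x => 1 + (-1) * χ x) :=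
    (eulerBound_const 1 m).add (hB.const_mul (-1)) (fun x _ => contDiffAt_const)
      (fun x _ => (contDiff_const.mul hχs).contDiffAt)
  have hχc : HasCompactSupport χ :=
    HasCompactSupport.of_support_subset_isCompact (isCompact_Icc (a := -r) (b := r)) fun x hx => by
      by_contra hcon
      exact hx (hχ0 x (le_of_not_gt fun hlt => hcon (abs_le.1 hlt.le)))
  refine ⟨n, m, C₁ * (2 ^ m * B) + C₂ * (2 ^ m * (‖(1 : ℂ)‖ + ‖(-1 : ℂ)‖ * B)), fun ψ M hM => ?_⟩
  set φ := SchwartzMap.smulLeftCLM ℂ χ ψ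
  have hφ (x : ℝ) : φ x = χ x * ψ x :=
    SchwartzMap.smulLeftCLM_apply_apply (hχc.hasTemperateGrowth hχs) ψ x
  have e1 : EulerBound K 0 m₁ (2 ^ m * B * M) φ := by
    have := hB.mul (hM.mono (Nat.zero_le n) le_rfl le_rfl) (fun x _ => hχs.contDiffAt)
      (fun x _ => ψ.contDiffAt_infty x)
    rw [zero_add] at this
    exact (this.mono le_rfl (le_max_left _ _) le_rfl).congr fun x _ => hφ x
  have e2 : EulerBound K n m₂ (2 ^ m * (‖(1 : ℂ)‖ + ‖(-1 : ℂ)‖ * B) * M) (ψ - φ : 𝓢(ℝ, ℂ)) := by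
    have := hB'.mul hM (fun x _ => (contDiff_const.add (contDiff_const.mul hχs)).contDiffAt)
      (fun x _ => ψ.contDiffAt_infty x)
    rw [zero_add, zero_add] at this
    refine (this.mono le_rfl (le_max_right _ _) le_rfl).congr fun x _ => ?_
    rw [sub_apply, hφ]; ring
  have f1 := h₁ φ _ (fun x hx => by rw [hφ, hχ0 x hx, zero_mul]) e1
  have f2 := h₂ (ψ - φ) _ (fun x hx => by rw [sub_apply, hφ, hχ1 x hx]; ring) e2
  calc ‖σ ψ‖ = ‖σ φ + σ (ψ - φ)‖ := by rw [← map_add]; congr 2; abel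
    _ ≤ _ := norm_add_le _ _
    _ ≤ _ := add_le_add f1 f2
    _ = _ := by ring

theorem vanishesToInfiniteOrder_iff_isFlat {σ : 𝓢'(ℝ, ℂ)} :
    VanishesToInfiniteOrder σ ↔ IsFlat σ :=
  ⟨fun h => h.isFlat, fun h K => h.vanishesToOrder K⟩

/-! ### Functions with simple singularities are tame -/

theorem exists_eulerBound_of_forall {k n : ℕ} {F : ℝ → ℂ}
    (h : ∀ b, ∃ M : ℝ, ∀ x : ℝ, x ≠ 0 → |x| ^ k * (1 + |x|) ^ n * ‖eulerOp^[b] F x‖ ≤ M) (m : ℕ) :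
    ∃ M : ℝ, EulerBound k n m M F := by
  choose M hM using h
  refine ⟨∑ b ∈ Finset.range (m + 1), M b, fun b hb x hx => (hM b x hx).trans ?_⟩
  exact Finset.single_le_sum
    (fun i _ => le_trans (by positivity) (hM i 1 one_ne_zero))
    (Finset.mem_range.2 (Nat.lt_succ_of_le hb))

theorem IsTame.exists_schwartz {k : ℕ} {H : ℝ → ℂ} (hH : IsTame k H) (h0 : H =ᶠ[nhds 0] 0) :
    ∃ g : 𝓢(ℝ, ℂ), ∀ x, g x = H x := by
  obtain ⟨δ, hδ, hz⟩ := Metric.eventually_nhds_iff.1 h0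
  refine ⟨⟨H, contDiff_of_notMem_tsupport hH.smooth h0, fun q p => ?_⟩, fun x => rfl⟩
  obtain ⟨C, hC0, hC⟩ := exists_abs_pow_mul_norm_iteratedDeriv_le_of_eulerBound k p q
    (half_pos hδ)
  obtain ⟨M, hM⟩ := hH.bound q p
  refine ⟨C * M, fun x => ?_⟩
  rw [norm_iteratedFDeriv_eq_norm_iteratedDeriv, Real.norm_eq_abs]
  rcases lt_or_ge |x| δ with hx | hx
  · have : H =ᶠ[nhds x] fun _ => 0 := by
      filter_upwards [(isOpen_lt continuous_abs continuous_const).mem_nhds hx] with y hy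
      exact hz (by simpa using hy)
    rw [this.iteratedDeriv_eq]
    simpa using mul_nonneg hC0 hM.nonneg
  · exact hC H M hH.smooth hM x (by linarith)

theorem eventually_nhdsNE_eventually_nhds {p : ℝ → Prop} (h : ∀ᶠ x in nhdsWithin 0 {0}ᶜ, p x) :
    ∀ᶠ x in nhdsWithin (0 : ℝ) {0}ᶜ, ∀ᶠ y in nhds x, p y := by
  filter_upwards [eventually_eventually_nhdsWithin.2 h, self_mem_nhdsWithin] with x hx hne
  rwa [isOpen_compl_singleton.nhdsWithin_eq hne] at hx

/-! ### Power bounds near 0 and the elementary singular factors. -/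

/-- Near `0`, `g` is smooth off `0` and `(x d/dx)^b g = O(|x|^{-r})` for all `b`. -/
structure IsNearTame (r : ℕ) (g : ℝ → ℂ) : Prop where
  smooth : ∀ᶠ x in nhdsWithin (0 : ℝ) {0}ᶜ, ContDiffAt ℝ ∞ g x
  bound : ∀ b : ℕ, ∃ C : ℝ, ∀ᶠ x in nhdsWithin (0 : ℝ) {0}ᶜ, |x| ^ r * ‖eulerOp^[b] g x‖ ≤ C

theorem IsNearTame.congr {r : ℕ} {g h : ℝ → ℂ} (hg : IsNearTame r g)
    (he : ∀ᶠ x in nhdsWithin (0 : ℝ) {0}ᶜ, h x = g x) : IsNearTame r h where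
  smooth := by
    filter_upwards [hg.smooth, eventually_nhdsNE_eventually_nhds he] with x hx hex
    exact hx.congr_of_eventuallyEq hex
  bound b := by
    obtain ⟨C, hC⟩ := hg.bound b
    refine ⟨C, ?_⟩
    filter_upwards [hC, eventually_nhdsNE_eventually_nhds he] with x hx hex
    rwa [(Filter.EventuallyEq.eulerOp_iterate hex b).eq_of_nhds]

theorem IsNearTame.add {r : ℕ} {g h : ℝ → ℂ} (hg : IsNearTame r g) (hh : IsNearTame r h) :
    IsNearTame r (fun x => g x + h x) where
  smooth := by
    filter_upwards [hg.smooth, hh.smooth] with x h1 h2 using h1.add h2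
  bound b := by
    obtain ⟨C, hC⟩ := hg.bound b
    obtain ⟨D, hD⟩ := hh.bound b
    refine ⟨C + D, ?_⟩
    filter_upwards [hC, hD, hg.smooth, hh.smooth] with x h1 h2 h3 h4
    rw [eulerOp_iterate_add h3 h4]
    refine le_trans ?_ (add_le_add h1 h2)
    rw [← mul_add]
    gcongr
    exact norm_add_le _ _

theorem IsNearTame.zero (r : ℕ) : IsNearTame r (fun _ => 0) where
  smooth := Filter.Eventually.of_forall fun _ => contDiffAt_const
  bound b := ⟨0, Filter.Eventually.of_forall fun x => by
    rw [eulerOp_iterate_zero_of_eventuallyEq (Filter.EventuallyEq.refl _ _)]; simp⟩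

theorem IsNearTame.sum {ι : Type*} {r : ℕ} {s : Finset ι} {g : ι → ℝ → ℂ}
    (h : ∀ i ∈ s, IsNearTame r (g i)) : IsNearTame r (fun x => ∑ i ∈ s, g i x) := by
  classical
  induction s using Finset.induction_on with
  | empty => simpa using IsNearTame.zero r
  | insert i s his ih =>
    simp only [Finset.sum_insert his]
    exact (h i (Finset.mem_insert_self i s)).add
      (ih fun j hj => h j (Finset.mem_insert_of_mem hj))

theorem eventually_abs_lt_nhdsNE {ε : ℝ} (hε : 0 < ε) :
    ∀ᶠ x in nhdsWithin (0 : ℝ) {0}ᶜ, |x| < ε := by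
  refine nhdsWithin_le_nhds ?_
  filter_upwards [Metric.ball_mem_nhds (0 : ℝ) hε] with x hx
  simpa using hx

theorem IsNearTame.raise {r s : ℕ} {g : ℝ → ℂ} (hg : IsNearTame r g) (h : r ≤ s) :
    IsNearTame s g where
  smooth := hg.smooth
  bound b := by
    obtain ⟨C, hC⟩ := hg.bound b
    refine ⟨C, ?_⟩
    filter_upwards [hC, eventually_abs_lt_nhdsNE one_pos] with x h1 h2
    refine le_trans ?_ h1
    gcongr ?_ * _
    exact pow_le_pow_of_le_one (abs_nonneg x) h2.le h

theorem IsNearTame.mul {r s : ℕ} {g h : ℝ → ℂ} (hg : IsNearTame r g) (hh : IsNearTame s h) :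
    IsNearTame (r + s) (fun x => g x * h x) where
  smooth := by
    filter_upwards [hg.smooth, hh.smooth] with x h1 h2 using h1.mul h2
  bound b := by
    choose C hC using hg.bound
    choose D hD using hh.bound
    refine ⟨2 ^ b * (∑ c ∈ Finset.range (b + 1), |C c|) * ∑ c ∈ Finset.range (b + 1), |D c|, ?_⟩
    have hC' := (Filter.eventually_all_finset (Finset.range (b + 1))).2 fun c _ => hC c
    have hD' := (Filter.eventually_all_finset (Finset.range (b + 1))).2 fun c _ => hD c
    filter_upwards [hC', hD', hg.smooth, hh.smooth, self_mem_nhdsWithin] with x h1 h2 h3 h4 hx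
    have hx' : 0 < |x| := abs_pos.2 hx
    have key := norm_eulerOp_iterate_mul_le h3 h4 (b := b)
      (A := (∑ c ∈ Finset.range (b + 1), |C c|) / |x| ^ r)
      (B := (∑ c ∈ Finset.range (b + 1), |D c|) / |x| ^ s)
      (fun c hc => by
        have hmem := Finset.mem_range.2 (Nat.lt_succ_of_le hc)
        rw [le_div_iff₀ (by positivity), mul_comm]
        exact ((h1 c hmem).trans (le_abs_self _)).trans
          (Finset.single_le_sum (f := fun c => |C c|) (fun i _ => abs_nonneg _) hmem))
      (fun c hc => by
        have hmem := Finset.mem_range.2 (Nat.lt_succ_of_le hc)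
        rw [le_div_iff₀ (by positivity), mul_comm]
        exact ((h2 c hmem).trans (le_abs_self _)).trans
          (Finset.single_le_sum (f := fun c => |D c|) (fun i _ => abs_nonneg _) hmem))
    calc _ ≤ |x| ^ (r + s) * (2 ^ b * ((∑ c ∈ Finset.range (b + 1), |C c|) / |x| ^ r) *
          ((∑ c ∈ Finset.range (b + 1), |D c|) / |x| ^ s)) := by gcongr
      _ = _ := by rw [pow_add]; field_simp

theorem sgPow_eventuallyEq (η : ZMod 2) {x : ℝ} (hx : x ≠ 0) :
    sgPow η =ᶠ[nhds x] fun _ => sgPow η x := by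
  rcases lt_or_gt_of_ne hx with h | h
  · filter_upwards [gt_mem_nhds h] with y hy
    simp [sgPow, Real.sign_of_neg h, Real.sign_of_neg hy]
  · filter_upwards [lt_mem_nhds h] with y hy
    simp [sgPow, Real.sign_of_pos h, Real.sign_of_pos hy]

theorem norm_sgPow (η : ZMod 2) {x : ℝ} (hx : x ≠ 0) : ‖sgPow η x‖ = 1 := by
  rw [sgPow, norm_pow]
  rcases lt_or_gt_of_ne hx with h | h
  · simp [Real.sign_of_neg h]
  · simp [Real.sign_of_pos h]

theorem isNearTame_sgPow (η : ZMod 2) : IsNearTame 0 (sgPow η) where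
  smooth := by
    filter_upwards [self_mem_nhdsWithin] with x hx
    exact contDiffAt_const.congr_of_eventuallyEq (sgPow_eventuallyEq η hx)
  bound b := by
    refine ⟨1, ?_⟩
    filter_upwards [self_mem_nhdsWithin] with x hx
    rw [((sgPow_eventuallyEq η hx).eulerOp_iterate b).eq_of_nhds, ← norm_sgPow η hx]
    simpa using eulerBound_const (sgPow η x) b b le_rfl x hx

theorem absPow_eq_exp (α : ℂ) {x : ℝ} (hx : x ≠ 0) :
    absPow α x = Complex.exp ((Real.log x : ℂ) * α) := by
  have h : ((|x| : ℝ) : ℂ) ≠ 0 := by exact_mod_cast (abs_pos.2 hx).ne'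
  rw [absPow, Complex.cpow_def_of_ne_zero h, ← Complex.ofReal_log (abs_nonneg x), Real.log_abs]

theorem norm_absPow (α : ℂ) {x : ℝ} (hx : x ≠ 0) : ‖absPow α x‖ = |x| ^ α.re :=
  Complex.norm_cpow_eq_rpow_re_of_pos (abs_pos.2 hx) α

theorem contDiffAt_ofReal_log {x : ℝ} (hx : x ≠ 0) :
    ContDiffAt ℝ ∞ (fun y : ℝ => (Real.log y : ℂ)) x :=
  Complex.ofRealCLM.contDiff.contDiffAt.comp x (Real.contDiffAt_log.2 hx)

theorem hasDerivAt_ofReal_log {x : ℝ} (hx : x ≠ 0) :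
    HasDerivAt (fun y : ℝ => (Real.log y : ℂ)) ((x : ℂ)⁻¹) x := by
  have := (Real.hasDerivAt_log hx).ofReal_comp
  simpa using this

theorem absPow_eventuallyEq (α : ℂ) {x : ℝ} (hx : x ≠ 0) :
    absPow α =ᶠ[nhds x] fun y => Complex.exp ((Real.log y : ℂ) * α) := by
  filter_upwards [isOpen_ne.mem_nhds hx] with y hy using absPow_eq_exp α hy

theorem contDiffAt_absPow (α : ℂ) {x : ℝ} (hx : x ≠ 0) : ContDiffAt ℝ ∞ (absPow α) x :=
  (((contDiffAt_ofReal_log hx).mul contDiffAt_const).cexp).congr_of_eventuallyEq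
    (absPow_eventuallyEq α hx)

theorem hasDerivAt_absPow (α : ℂ) {x : ℝ} (hx : x ≠ 0) :
    HasDerivAt (absPow α) (α * absPow α x * (x : ℂ)⁻¹) x := by
  have := ((hasDerivAt_ofReal_log hx).mul_const α).cexp
  rw [← absPow_eq_exp α hx] at this
  refine (this.congr_of_eventuallyEq (absPow_eventuallyEq α hx)).congr_deriv ?_
  ring

theorem eulerOp_absPow (α : ℂ) {x : ℝ} (hx : x ≠ 0) :
    eulerOp (absPow α) x = α * absPow α x := by
  have hx' : (x : ℂ) ≠ 0 := by exact_mod_cast hx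
  rw [eulerOp, (hasDerivAt_absPow α hx).deriv]
  field_simp

theorem eulerOp_iterate_absPow (α : ℂ) (b : ℕ) {x : ℝ} (hx : x ≠ 0) :
    eulerOp^[b] (absPow α) x = α ^ b * absPow α x := by
  induction b with
  | zero => simp
  | succ b ih =>
    have : eulerOp (absPow α) =ᶠ[nhds x] fun y => α * absPow α y := by
      filter_upwards [isOpen_ne.mem_nhds hx] with y hy using eulerOp_absPow α hy
    rw [Function.iterate_succ_apply, (this.eulerOp_iterate b).eq_of_nhds,
      eulerOp_iterate_const_mul]
    dsimp only
    rw [ih, pow_succ]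
    ring

/-- |x|^α is an eigenfunction of θ, so only its own size matters; the natural-number ceiling is 0
when Re α ≥ 0. -/
theorem isNearTame_absPow (α : ℂ) : IsNearTame ⌈-α.re⌉₊ (absPow α) where
  smooth := by
    filter_upwards [self_mem_nhdsWithin] with x hx using contDiffAt_absPow α hx
  bound b := by
    refine ⟨‖α‖ ^ b, ?_⟩
    filter_upwards [self_mem_nhdsWithin, eventually_abs_lt_nhdsNE one_pos] with x hx hx1
    have hx' : 0 < |x| := abs_pos.2 hx
    rw [eulerOp_iterate_absPow α b hx, norm_mul, norm_pow, norm_absPow α hx,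
      ← mul_assoc, mul_comm (|x| ^ _), mul_assoc, ← Real.rpow_natCast |x|, ← Real.rpow_add hx']
    refine mul_le_of_le_one_right (by positivity) (Real.rpow_le_one hx'.le hx1.le ?_)
    linarith [Nat.le_ceil (-α.re)]

/-- Here |x log|x|| < 1 on the unit interval, and θ log|x| = 1. -/
theorem isNearTame_log : IsNearTame 1 (fun x : ℝ => ((Real.log |x| : ℝ) : ℂ)) := by
  simp only [Real.log_abs]
  refine ⟨?_, fun b => ⟨1, ?_⟩⟩
  · filter_upwards [self_mem_nhdsWithin] with x hx using contDiffAt_ofReal_log hx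
  · filter_upwards [self_mem_nhdsWithin, eventually_abs_lt_nhdsNE one_pos] with x hx hx1
    have hx' : 0 < |x| := abs_pos.2 hx
    rcases b with - | b
    · have := Real.abs_log_mul_self_lt |x| hx' hx1.le
      rw [Real.log_abs, abs_mul, abs_abs] at this
      simp only [Function.iterate_zero, id_eq, pow_one, Complex.norm_real, Real.norm_eq_abs]
      linarith
    · have h1 : eulerOp (fun y : ℝ => (Real.log y : ℂ)) =ᶠ[nhds x] fun _ => 1 := by
        filter_upwards [isOpen_ne.mem_nhds hx] with y hy
        have hy' : (y : ℂ) ≠ 0 := by exact_mod_cast hy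
        rw [eulerOp, (hasDerivAt_ofReal_log hy).deriv, mul_inv_cancel₀ hy']
      have h2 := eulerBound_const 1 b b le_rfl x hx
      simp only [pow_zero, one_mul, norm_one] at h2
      rw [Function.iterate_succ_apply, (h1.eulerOp_iterate b).eq_of_nhds, pow_one]
      exact mul_le_one₀ hx1.le (norm_nonneg _) h2

theorem IsNearTame.pow {r : ℕ} {g : ℝ → ℂ} (hg : IsNearTame r g) (j : ℕ) :
    IsNearTame (j * r) (fun x => g x ^ j) := by
  induction j with
  | zero =>
    refine ⟨Filter.Eventually.of_forall fun _ => by simpa using contDiffAt_const, fun b => ⟨1, ?_⟩⟩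
    filter_upwards [self_mem_nhdsWithin] with x hx
    simpa using eulerBound_const 1 b b le_rfl x hx
  | succ j ih =>
    simp only [pow_succ, Nat.succ_mul]
    exact ih.mul hg

theorem isNearTame_of_contDiffOn {F : ℝ → ℂ} {ε : ℝ} (hε : 0 < ε)
    (hF : ContDiffOn ℝ ∞ F (Ioo (-ε) ε)) : IsNearTame 0 F where
  smooth := by
    filter_upwards [eventually_abs_lt_nhdsNE hε] with x hx
    exact hF.contDiffAt (isOpen_Ioo.mem_nhds (abs_lt.1 hx))
  bound b := by
    have h0 : ContDiffAt ℝ ∞ F 0 := hF.contDiffAt (isOpen_Ioo.mem_nhds (by simpa using hε))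
    have hc := (h0.eulerOp_iterate b).continuousAt.norm
    refine ⟨‖eulerOp^[b] F 0‖ + 1, nhdsWithin_le_nhds ?_⟩
    filter_upwards [hc.eventually_lt_const (lt_add_one _)] with x hx
    simpa using le_of_lt hx

theorem HasSingularityOfType.isNearTame {α : ℂ} {η : ZMod 2} {f : ℝ → ℂ}
    (h : HasSingularityOfType α η f) : ∃ r, IsNearTame r f := by
  obtain ⟨n, F, ε, hε, hF, hf⟩ := h
  refine ⟨0 + ⌈-α.re⌉₊ + n * 1 + 0, IsNearTame.congr (g := fun x =>
    ∑ j ∈ Finset.range (n + 1), sgPow η x * absPow α x * ((Real.log |x| : ℝ) : ℂ) ^ j * F j x)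
    (IsNearTame.sum fun j hj => ?_) ?_⟩
  · have hjn : j ≤ n := by have := Finset.mem_range.1 hj; omega
    exact ((((isNearTame_sgPow η).mul (isNearTame_absPow α)).mul (isNearTame_log.pow j)).mul
      (isNearTame_of_contDiffOn hε (hF j hjn))).raise (by omega)
  · filter_upwards [self_mem_nhdsWithin, eventually_abs_lt_nhdsNE hε] with x hx hxε
    exact hf x hx hxε

theorem HasSimpleSingularity.isNearTame {f : ℝ → ℂ} (h : HasSimpleSingularity f) :
    ∃ r, IsNearTame r f := by
  obtain ⟨m, α, η, g, hg, ε, hε, hf⟩ := h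
  choose r hr using fun j => (hg j).isNearTame
  refine ⟨∑ j, r j, IsNearTame.congr (g := fun x => ∑ j, g j x) (IsNearTame.sum fun j hj =>
    (hr j).raise (Finset.single_le_sum (fun _ _ => Nat.zero_le _) hj)) ?_⟩
  filter_upwards [self_mem_nhdsWithin, eventually_abs_lt_nhdsNE hε] with x hx hxε
  exact hf x hx hxε

theorem IsSis.isTame {f : ℝ → ℂ} (hf : IsSis f) : ∃ k, IsTame k f := by
  obtain ⟨r, hr⟩ := hf.simple.isNearTame
  have hs : ∀ x : ℝ, x ≠ 0 → ContDiffAt ℝ ∞ f x := fun x hx =>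
    hf.smooth.contDiffAt (isOpen_compl_singleton.mem_nhds hx)
  refine ⟨r, hs, fun n => exists_eulerBound_of_forall fun b => ?_⟩
  obtain ⟨C₁, hC₁⟩ := hr.bound b
  obtain ⟨ε, hε, hnear⟩ : ∃ ε > 0, ∀ x : ℝ, x ≠ 0 → |x| < ε → |x| ^ r * ‖eulerOp^[b] f x‖ ≤ C₁ := by
    rw [eventually_nhdsWithin_iff, Metric.eventually_nhds_iff] at hC₁
    obtain ⟨ε, hε, h⟩ := hC₁
    exact ⟨ε, hε, fun x hx hxε => h (by simpa using hxε) hx⟩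
  have hcont : ContinuousOn (fun x => |x| ^ r * (1 + |x|) ^ n * ‖eulerOp^[b] f x‖)
      {x : ℝ | ε ≤ |x| ∧ |x| ≤ 1} := by
    intro x hx
    have hx0 : x ≠ 0 := abs_pos.1 (hε.trans_le hx.1)
    have := ((hs x hx0).eulerOp_iterate b).continuousAt.norm
    exact ((((continuous_abs.pow r).mul ((continuous_const.add continuous_abs).pow n)).continuousAt).mul
      this).continuousWithinAt
  have hK : IsCompact {x : ℝ | ε ≤ |x| ∧ |x| ≤ 1} :=
    (isCompact_Icc (a := (-1 : ℝ)) (b := 1)).of_isClosed_subset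
      ((isClosed_le continuous_const continuous_abs).inter
        (isClosed_le continuous_abs continuous_const)) fun x hx => abs_le.1 hx.2
  obtain ⟨C₂, hC₂⟩ := hK.exists_bound_of_continuousOn hcont
  obtain ⟨C₃, hC₃0, hC₃⟩ := exists_norm_eulerOp_iterate_le b
  choose D hD using fun p => hf.decay (r + n + p) p
  set S := ∑ p ∈ Finset.range (b + 1), |D p|
  have hS0 : 0 ≤ S := Finset.sum_nonneg fun _ _ => abs_nonneg _
  -- The three constants belong to |x| < ε (singularity type), ε ≤ |x| ≤ 1 (compactness) and |x| > 1
  -- (rapid decay).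
  refine ⟨max (2 ^ n * |C₁|) (max C₂ (2 ^ n * (C₃ * S))), fun x hx => ?_⟩
  have hx' : 0 < |x| := abs_pos.2 hx
  rcases lt_or_ge 1 |x| with h1 | h1
  · refine le_trans ?_ ((le_max_right _ _).trans (le_max_right _ _))
    have h2 := hC₃ f x (S / |x| ^ (r + n)) (hs x hx) fun p hp => by
      rw [le_div_iff₀ (by positivity)]
      have hmem := Finset.mem_range.2 (Nat.lt_succ_of_le hp)
      calc _ = |x| ^ (r + n + p) * ‖iteratedDeriv p f x‖ := by rw [pow_add]; ring
        _ ≤ D p := hD p x h1.le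
        _ ≤ |D p| := le_abs_self _
        _ ≤ S := Finset.single_le_sum (f := fun p => |D p|) (fun i _ => abs_nonneg _) hmem
    calc _ ≤ |x| ^ r * (2 * |x|) ^ n * (C₃ * (S / |x| ^ (r + n))) := by gcongr; linarith
      _ = _ := by rw [mul_pow, pow_add]; field_simp
  · rcases lt_or_ge |x| ε with h2 | h2
    · refine le_trans ?_ (le_max_left _ _)
      calc _ = (1 + |x|) ^ n * (|x| ^ r * ‖eulerOp^[b] f x‖) := by ring
        _ ≤ 2 ^ n * |C₁| := by
          gcongr
          · linarith
          · exact (hnear x hx h2).trans (le_abs_self _)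
    · refine le_trans ?_ ((le_max_left _ _).trans (le_max_right _ _))
      exact (le_abs_self _).trans (hC₂ x ⟨h2, h1⟩)

/-! ### The twisted inversion -/

theorem invTwist_of_ne {α : ℂ} {η : ZMod 2} {F : ℝ → ℂ} {y : ℝ} (hy : y ≠ 0) :
    invTwist α η F y = F (1 / y) * sgPow η y * absPow (-α - 1) y := if_neg hy

theorem invTwist_zero (α : ℂ) (η : ZMod 2) (F : ℝ → ℂ) : invTwist α η F 0 = 0 := if_pos rfl

theorem invTwist_linear (α : ℂ) (η : ZMod 2) (F H : ℝ → ℂ) (c d : ℂ) :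
    invTwist α η (fun x => c * F x + d * H x)
      = fun y => c * invTwist α η F y + d * invTwist α η H y := by
  funext y
  rcases eq_or_ne y 0 with rfl | hy
  · simp [invTwist_zero]
  · simp only [invTwist_of_ne hy]; ring

theorem norm_invTwist {α : ℂ} {η : ZMod 2} {F : ℝ → ℂ} {y : ℝ} (hy : y ≠ 0) :
    ‖invTwist α η F y‖ = ‖F (1 / y)‖ * |y| ^ (-α.re - 1) := by
  rw [invTwist_of_ne hy, norm_mul, norm_mul, norm_sgPow η hy, norm_absPow _ hy]
  simp

theorem hasDerivAt_invTwist {α : ℂ} {η : ZMod 2} {F : ℝ → ℂ} {y : ℝ} (hy : y ≠ 0)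
    (hF : ContDiffAt ℝ ∞ F (1 / y)) :
    HasDerivAt (invTwist α η F)
      ((y : ℂ)⁻¹ * invTwist α η (fun x => (-1) * eulerOp F x + (-(α + 1)) * F x) y) y := by
  have hy' : (y : ℂ) ≠ 0 := by exact_mod_cast hy
  have h1 : HasDerivAt (fun z : ℝ => 1 / z) (-(y ^ 2)⁻¹) y := by
    simpa only [one_div] using hasDerivAt_inv hy
  have h2 : HasDerivAt (fun z => F (1 / z)) ((-(y ^ 2)⁻¹ : ℝ) • deriv F (1 / y)) y :=
    HasDerivAt.scomp y hF.differentiableAt_infty.hasDerivAt h1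
  have h3 := (h2.mul_const (sgPow η y)).mul (hasDerivAt_absPow (-α - 1) hy)
  have h4 : invTwist α η F =ᶠ[nhds y]
      (fun z => F (1 / z) * sgPow η y) * absPow (-α - 1) := by
    filter_upwards [isOpen_ne.mem_nhds hy, sgPow_eventuallyEq η hy] with z hz hs
    rw [invTwist_of_ne hz, hs]; rfl
  refine (h3.congr_of_eventuallyEq h4).congr_deriv ?_
  rw [invTwist_of_ne hy]
  simp only [eulerOp, Complex.real_smul]
  push_cast
  field_simp
  ring

theorem contDiffAt_invTwist {α : ℂ} {η : ZMod 2} {F : ℝ → ℂ} {y : ℝ} (hy : y ≠ 0)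
    (hF : ContDiffAt ℝ ∞ F (1 / y)) : ContDiffAt ℝ ∞ (invTwist α η F) y := by
  have h1 : ContDiffAt ℝ ∞ (fun z : ℝ => 1 / z) y := contDiffAt_const.div contDiffAt_id hy
  have h2 : ContDiffAt ℝ ∞ (fun z => F (1 / z)) y := ContDiffAt.comp y hF h1
  have h3 : ContDiffAt ℝ ∞ (sgPow η) y :=
    contDiffAt_const.congr_of_eventuallyEq (sgPow_eventuallyEq η hy)
  refine ((h2.mul h3).mul (contDiffAt_absPow (-α - 1) hy)).congr_of_eventuallyEq ?_
  filter_upwards [isOpen_ne.mem_nhds hy] with z hz using invTwist_of_ne hz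

/-- Inversion turns θ into -θ, and the factor |y|^{-α-1} contributes its degree. -/
theorem eulerOp_invTwist {α : ℂ} {η : ZMod 2} {F : ℝ → ℂ}
    (hF : ∀ x : ℝ, x ≠ 0 → ContDiffAt ℝ ∞ F x) :
    eulerOp (invTwist α η F)
      = fun y => (-1) * invTwist α η (eulerOp F) y + (-(α + 1)) * invTwist α η F y := by
  rw [← invTwist_linear]
  funext y
  rcases eq_or_ne y 0 with rfl | hy
  · simp [invTwist_zero, eulerOp]
  · have hy' : (y : ℂ) ≠ 0 := by exact_mod_cast hy
    rw [eulerOp, (hasDerivAt_invTwist hy (hF _ (one_div_ne_zero hy))).deriv, ← mul_assoc,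
      mul_inv_cancel₀ hy', one_mul]

theorem exists_norm_eulerOp_iterate_invTwist_le (α : ℂ) (η : ZMod 2) (b : ℕ) :
    ∃ C : ℝ, 0 ≤ C ∧ ∀ (F : ℝ → ℂ), (∀ x : ℝ, x ≠ 0 → ContDiffAt ℝ ∞ F x) → ∀ (y M : ℝ), y ≠ 0 →
      (∀ c ≤ b, ‖eulerOp^[c] F (1 / y)‖ ≤ M) →
      ‖eulerOp^[b] (invTwist α η F) y‖ ≤ C * (|y| ^ (-α.re - 1) * M) := by
  induction b with
  | zero =>
    refine ⟨1, zero_le_one, fun F hF y M hy hM => ?_⟩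
    have := hM 0 le_rfl
    simp only [Function.iterate_zero, id_eq] at this ⊢
    rw [norm_invTwist hy, one_mul, mul_comm]
    gcongr
  | succ b ih =>
    obtain ⟨C, hC, ih⟩ := ih
    refine ⟨C + ‖α + 1‖ * C, by positivity, fun F hF y M hy hM => ?_⟩
    have hF' : ∀ x : ℝ, x ≠ 0 → ContDiffAt ℝ ∞ (eulerOp F) x := fun x hx => (hF x hx).eulerOp
    have h1 := ih (eulerOp F) hF' y M hy fun c hc => by simpa using hM (c + 1) (by omega)
    have h2 := ih F hF y M hy fun c hc => hM c (by omega)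
    have hy1 := one_div_ne_zero hy
    rw [Function.iterate_succ_apply, eulerOp_invTwist hF, eulerOp_iterate_add
      (contDiffAt_const.mul (contDiffAt_invTwist hy (hF' _ hy1)))
      (contDiffAt_const.mul (contDiffAt_invTwist hy (hF _ hy1))), eulerOp_iterate_const_mul,
      eulerOp_iterate_const_mul]
    refine (norm_add_le _ _).trans ?_
    rw [norm_mul, norm_mul, norm_neg, norm_neg, norm_one, one_mul]
    calc _ ≤ C * (|y| ^ (-α.re - 1) * M) + ‖α + 1‖ * (C * (|y| ^ (-α.re - 1) * M)) := by gcongr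
      _ = _ := by ring

/-- A natural number bounding the exponent in the twist. -/
noncomputable def twistOrder (α : ℂ) : ℕ := ⌈|α.re + 1|⌉₊

theorem pow_twistOrder_mul_le (α : ℂ) {y : ℝ} (hy : y ≠ 0) :
    |y| ^ twistOrder α * |y| ^ (-α.re - 1) ≤ (1 + |y|) ^ (2 * twistOrder α) := by
  have hy' : 0 < |y| := abs_pos.2 hy
  have hA : |α.re + 1| ≤ twistOrder α := Nat.le_ceil _
  have hA' := abs_le.1 hA
  rw [← Real.rpow_natCast |y|, ← Real.rpow_add hy']
  rcases le_total |y| 1 with h | h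
  · refine (Real.rpow_le_one hy'.le h (by linarith [hA'.2])).trans (one_le_pow₀ (by linarith))
  · calc _ ≤ |y| ^ ((2 * twistOrder α : ℕ) : ℝ) :=
          Real.rpow_le_rpow_of_exponent_le h (by push_cast; linarith [hA'.1])
      _ = |y| ^ (2 * twistOrder α) := Real.rpow_natCast _ _
      _ ≤ _ := by gcongr; linarith

/-- Decay of F becomes flatness of the twisted inversion at 0: A + a + 2 powers of decay, with A =
`twistOrder α`, absorb the twist and the loss |y|^{-a} of a derivatives. At infinity what remains is
growth |y|^{k+A-a}, improving with a. -/
theorem exists_norm_iteratedDeriv_invTwist_le_of_ne (α : ℂ) (η : ZMod 2) (a k : ℕ) :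
    ∃ C : ℝ, 0 ≤ C ∧ ∀ (F : ℝ → ℂ) (M : ℝ), (∀ x : ℝ, x ≠ 0 → ContDiffAt ℝ ∞ F x) →
      EulerBound k (twistOrder α + a + 2) a M F → ∀ y : ℝ, y ≠ 0 →
      ‖iteratedDeriv a (invTwist α η F) y‖ * (1 + |y|) ^ (a + 2)
        ≤ C * M * (|y| ^ (k + 2) * (1 + |y|) ^ twistOrder α) := by
  set A := twistOrder α with hA
  choose C hC0 hC using exists_norm_eulerOp_iterate_invTwist_le α η
  obtain ⟨D, hD0, hD⟩ := exists_abs_pow_mul_norm_iteratedDeriv_le a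
  have hS0 : 0 ≤ ∑ b ∈ Finset.range (a + 1), C b := Finset.sum_nonneg fun b _ => hC0 b
  refine ⟨D * ∑ b ∈ Finset.range (a + 1), C b, by positivity, fun F M hF hM y hy => ?_⟩
  have hM0 := hM.nonneg
  have hy' : 0 < |y| := abs_pos.2 hy
  have hy1 : 0 < 1 + |y| := by positivity
  have hFy (c : ℕ) (hc : c ≤ a) : ‖eulerOp^[c] F (1 / y)‖
      ≤ M * |y| ^ (k + (A + a + 2)) / (1 + |y|) ^ (A + a + 2) := by
    have := hM c hc (1 / y) (one_div_ne_zero hy)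
    have he : (|1 / y| : ℝ) ^ k * (1 + |1 / y|) ^ (A + a + 2)
        = (1 + |y|) ^ (A + a + 2) / |y| ^ (k + (A + a + 2)) := by
      rw [abs_div, abs_one, show 1 + 1 / |y| = (1 + |y|) / |y| by field_simp; ring, div_pow,
        div_pow, one_pow, pow_add |y| k]
      field_simp
    rw [he, div_mul_eq_mul_div, div_le_iff₀ (by positivity)] at this
    rw [le_div_iff₀ (by positivity), mul_comm]
    exact this
  have hG (b : ℕ) (hb : b ≤ a) : ‖eulerOp^[b] (invTwist α η F) y‖
      ≤ (∑ b ∈ Finset.range (a + 1), C b) *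
        (M * |y| ^ (k + a + 2) * (1 + |y|) ^ A / (1 + |y|) ^ (a + 2)) := by
    have h1 := hC b F hF y _ hy fun c hc => hFy c (hc.trans hb)
    have h2 : |y| ^ (-α.re - 1) * (M * |y| ^ (k + (A + a + 2)) / (1 + |y|) ^ (A + a + 2))
        ≤ M * |y| ^ (k + a + 2) * (1 + |y|) ^ A / (1 + |y|) ^ (a + 2) := by
      calc _ = (|y| ^ A * |y| ^ (-α.re - 1)) *
            (M * |y| ^ (k + a + 2) / (1 + |y|) ^ (A + a + 2)) := by
            rw [show k + (A + a + 2) = A + (k + a + 2) by ring, pow_add]; ring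
        _ ≤ (1 + |y|) ^ (2 * A) * (M * |y| ^ (k + a + 2) / (1 + |y|) ^ (A + a + 2)) := by
            gcongr; exact pow_twistOrder_mul_le α hy
        _ = _ := by
            rw [two_mul, pow_add, show A + a + 2 = A + (a + 2) by ring, pow_add (1 + |y|) A (a + 2)]
            field_simp
    refine h1.trans (mul_le_mul ?_ h2 (by positivity) hS0)
    exact Finset.single_le_sum (fun b _ => hC0 b) (Finset.mem_range.2 (Nat.lt_succ_of_le hb))
  have h3 := hD (invTwist α η F) y _ (contDiffAt_invTwist hy (hF _ (one_div_ne_zero hy))) hG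
  have hya : 0 < |y| ^ a := by positivity
  refine le_of_mul_le_mul_left ?_ hya
  calc |y| ^ a * (‖iteratedDeriv a (invTwist α η F) y‖ * (1 + |y|) ^ (a + 2))
      = |y| ^ a * ‖iteratedDeriv a (invTwist α η F) y‖ * (1 + |y|) ^ (a + 2) := by ring
    _ ≤ _ := mul_le_mul_of_nonneg_right h3 (by positivity)
    _ = _ := by
      rw [show k + a + 2 = a + (k + 2) by ring, pow_add |y| a]
      field_simp

/-- The bound O(y²) gives G'(0) = 0, so the derivative satisfies the same hypotheses and the
induction proceeds. -/
theorem contDiff_nat_of_flat (n : ℕ) {G : ℝ → ℂ} (h0 : G 0 = 0)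
    (hs : ∀ y : ℝ, y ≠ 0 → ContDiffAt ℝ ∞ G y)
    (hb : ∀ a : ℕ, ∃ C : ℝ, ∀ y : ℝ, y ≠ 0 → |y| < 1 → ‖iteratedDeriv a G y‖ ≤ C * |y| ^ 2) :
    ContDiff ℝ n G := by
  have hd : ∀ {G : ℝ → ℂ}, G 0 = 0 →
      (∀ a : ℕ, ∃ C : ℝ, ∀ y : ℝ, y ≠ 0 → |y| < 1 → ‖iteratedDeriv a G y‖ ≤ C * |y| ^ 2) →
      HasDerivAt G 0 0 := by
    intro G h0 hb
    obtain ⟨C, hC⟩ := hb 0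
    have h1 : G =O[nhds 0] fun x : ℝ => ‖x - 0‖ ^ 2 := by
      refine Asymptotics.IsBigO.of_bound C ?_
      filter_upwards [Metric.ball_mem_nhds (0 : ℝ) one_pos] with y hy
      rcases eq_or_ne y 0 with rfl | hne
      · simp [h0]
      · simpa using hC y hne (by simpa using hy)
    simpa [HasDerivAt, HasDerivAtFilter] using (h1.hasFDerivAt one_lt_two).hasDerivAt
  induction n generalizing G with
  | zero =>
    rw [Nat.cast_zero, contDiff_zero, continuous_iff_continuousAt]
    intro y
    rcases eq_or_ne y 0 with rfl | hy
    · exact (hd h0 hb).continuousAt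
    · exact (hs y hy).continuousAt
  | succ n ih =>
    rw [Nat.cast_succ, contDiff_succ_iff_deriv]
    refine ⟨fun y => ?_, fun h => by simp at h, ih (hd h0 hb).deriv
      (fun y hy => (hs y hy).deriv_infty) fun a => by
        simpa only [iteratedDeriv_succ'] using hb (a + 1)⟩
    rcases eq_or_ne y 0 with rfl | hy
    · exact (hd h0 hb).differentiableAt
    · exact (hs y hy).differentiableAt_infty

theorem IsTame.contDiff_invTwist {k : ℕ} {F : ℝ → ℂ} (hF : IsTame k F) (α : ℂ) (η : ZMod 2) :
    ContDiff ℝ ∞ (invTwist α η F) := by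
  rw [contDiff_infty]
  intro n
  refine contDiff_nat_of_flat n (invTwist_zero α η F)
    (fun y hy => contDiffAt_invTwist hy (hF.smooth _ (one_div_ne_zero hy))) fun a => ?_
  obtain ⟨C, hC0, hC⟩ := exists_norm_iteratedDeriv_invTwist_le_of_ne α η a k
  obtain ⟨M, hM⟩ := hF.bound (twistOrder α + a + 2) a
  refine ⟨C * M * 2 ^ twistOrder α, fun y hy hy1 => ?_⟩
  have h1 := hC F M hF.smooth hM y hy
  have hM0 := hM.nonneg
  calc _ ≤ ‖iteratedDeriv a (invTwist α η F) y‖ * (1 + |y|) ^ (a + 2) :=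
        le_mul_of_one_le_right (norm_nonneg _) (one_le_pow₀ (by linarith [abs_nonneg y]))
    _ ≤ _ := h1
    _ ≤ C * M * (|y| ^ 2 * 2 ^ twistOrder α) := by
        gcongr ?_ * (?_ * ?_)
        · exact pow_le_pow_of_le_one (abs_nonneg y) hy1.le (by omega)
        · exact pow_le_pow_left₀ (by positivity) (by linarith) _
    _ = _ := by ring

theorem exists_norm_iteratedDeriv_invTwist_le (α : ℂ) (η : ZMod 2) (a k : ℕ) :
    ∃ C : ℝ, 0 ≤ C ∧ ∀ (F : ℝ → ℂ) (M : ℝ), IsTame k F →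
      EulerBound k (twistOrder α + a + 2) a M F → ∀ y : ℝ,
      ‖iteratedDeriv a (invTwist α η F) y‖ * (1 + |y|) ^ (a + 2)
        ≤ C * M * (1 + |y|) ^ (k + 2 + twistOrder α) := by
  obtain ⟨C, hC0, hC⟩ := exists_norm_iteratedDeriv_invTwist_le_of_ne α η a k
  refine ⟨C, hC0, fun F M hF hM y => ?_⟩
  have hM0 := hM.nonneg
  have hcont : Continuous (iteratedDeriv a (invTwist α η F)) :=
    (hF.contDiff_invTwist α η).continuous_iteratedDeriv a (by exact_mod_cast le_top)
  have hcl : IsClosed {y : ℝ | ‖iteratedDeriv a (invTwist α η F) y‖ * (1 + |y|) ^ (a + 2)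
      ≤ C * M * (1 + |y|) ^ (k + 2 + twistOrder α)} :=
    isClosed_le (by fun_prop) (by fun_prop)
  have hsub : ({0}ᶜ : Set ℝ) ⊆ {y : ℝ | ‖iteratedDeriv a (invTwist α η F) y‖ * (1 + |y|) ^ (a + 2)
      ≤ C * M * (1 + |y|) ^ (k + 2 + twistOrder α)} := fun y hy => by
    refine (hC F M hF.smooth hM y hy).trans ?_
    rw [pow_add (1 + |y|)]
    gcongr
    linarith
  -- Both sides are continuous, so the inequality extends from the dense set y ≠ 0 to y = 0.
  have := hcl.closure_subset_iff.2 hsub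
  rw [(dense_compl_singleton (0 : ℝ)).closure_eq] at this
  exact this (mem_univ y)

theorem IsTame.hasTemperateGrowth_invTwist {k : ℕ} {F : ℝ → ℂ} (hF : IsTame k F) (α : ℂ)
    (η : ZMod 2) : (invTwist α η F).HasTemperateGrowth := by
  refine ⟨hF.contDiff_invTwist α η, fun a => ?_⟩
  obtain ⟨C, hC0, hC⟩ := exists_norm_iteratedDeriv_invTwist_le α η a k
  obtain ⟨M, hM⟩ := hF.bound (twistOrder α + a + 2) a
  refine ⟨k + 2 + twistOrder α, C * M, fun y => ?_⟩
  rw [norm_iteratedFDeriv_eq_norm_iteratedDeriv, Real.norm_eq_abs]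
  refine le_trans ?_ (hC F M hF hM y)
  exact le_mul_of_one_le_right (norm_nonneg _) (one_le_pow₀ (by linarith [abs_nonneg y]))

/-- High derivatives decay like (1+|y|)^{-j}: j = 2 gives integrability, j = 3 integrability after
multiplication by y. -/
theorem exists_pow_mul_norm_iteratedDeriv_invTwist_le (α : ℂ) (η : ZMod 2) {a k j : ℕ}
    (ha : k + twistOrder α + j ≤ a) :
    ∃ C : ℝ, 0 ≤ C ∧ ∀ (F : ℝ → ℂ) (M : ℝ), IsTame k F →
      EulerBound k (twistOrder α + a + 2) a M F → ∀ y : ℝ,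
      (1 + |y|) ^ j * ‖iteratedDeriv a (invTwist α η F) y‖ ≤ C * M := by
  obtain ⟨C, hC0, hC⟩ := exists_norm_iteratedDeriv_invTwist_le α η a k
  refine ⟨C, hC0, fun F M hF hM y => ?_⟩
  have h1 := hC F M hF hM y
  have hy : 1 ≤ 1 + |y| := by linarith [abs_nonneg y]
  have hpos : 0 < (1 + |y|) ^ (k + 2 + twistOrder α) := by positivity
  refine le_of_mul_le_mul_right ?_ hpos
  refine le_trans ?_ h1
  calc _ = ‖iteratedDeriv a (invTwist α η F) y‖ * (1 + |y|) ^ (j + (k + 2 + twistOrder α)) := by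
        rw [pow_add]; ring
    _ ≤ _ := mul_le_mul_of_nonneg_left (pow_le_pow_right₀ hy (by omega)) (norm_nonneg _)

theorem integrable_of_sq_mul_norm_le {u : ℝ → ℂ} (hu : Continuous u) {C : ℝ}
    (h : ∀ y : ℝ, (1 + |y|) ^ 2 * ‖u y‖ ≤ C) :
    Integrable u ∧ ∫ y, ‖u y‖ ≤ C * Real.pi := by
  have hb (y : ℝ) : ‖u y‖ ≤ C * (1 + y ^ 2)⁻¹ := by
    rw [← div_eq_mul_inv, le_div_iff₀ (by positivity), mul_comm]
    refine le_trans ?_ (h y)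
    gcongr
    nlinarith [abs_nonneg y, sq_abs y]
  have hi : Integrable u :=
    (integrable_inv_one_add_sq.const_mul C).mono' hu.aestronglyMeasurable
      (Filter.Eventually.of_forall hb)
  refine ⟨hi, ?_⟩
  calc ∫ y, ‖u y‖ ≤ ∫ y : ℝ, C * (1 + y ^ 2)⁻¹ :=
        integral_mono hi.norm (integrable_inv_one_add_sq.const_mul C) hb
    _ = C * Real.pi := by rw [integral_const_mul, integral_univ_inv_one_add_sq]

theorem IsTame.continuous_iteratedDeriv_invTwist {k : ℕ} {F : ℝ → ℂ} (hF : IsTame k F) (α : ℂ)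
    (η : ZMod 2) (a : ℕ) : Continuous (iteratedDeriv a (invTwist α η F)) :=
  (hF.contDiff_invTwist α η).continuous_iteratedDeriv a (by exact_mod_cast le_top)

theorem IsTame.integrable_iteratedDeriv_invTwist {k : ℕ} {F : ℝ → ℂ} (hF : IsTame k F) {α : ℂ}
    {η : ZMod 2} {a : ℕ} (ha : k + twistOrder α + 2 ≤ a) :
    Integrable (iteratedDeriv a (invTwist α η F)) := by
  obtain ⟨C, -, hC⟩ := exists_pow_mul_norm_iteratedDeriv_invTwist_le α η ha
  obtain ⟨M, hM⟩ := hF.bound (twistOrder α + a + 2) a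
  exact (integrable_of_sq_mul_norm_le (hF.continuous_iteratedDeriv_invTwist α η a)
    (hC F M hF hM)).1

theorem IsTame.integrable_mul_iteratedDeriv_invTwist {k : ℕ} {F : ℝ → ℂ} (hF : IsTame k F) {α : ℂ}
    {η : ZMod 2} {a : ℕ} (ha : k + twistOrder α + 3 ≤ a) :
    Integrable (fun y : ℝ => (y : ℂ) * iteratedDeriv a (invTwist α η F) y) := by
  obtain ⟨C, -, hC⟩ := exists_pow_mul_norm_iteratedDeriv_invTwist_le α η ha
  obtain ⟨M, hM⟩ := hF.bound (twistOrder α + a + 2) a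
  refine (integrable_of_sq_mul_norm_le (C := C * M) (Complex.continuous_ofReal.mul
    (hF.continuous_iteratedDeriv_invTwist α η a)) fun y => ?_).1
  refine le_trans ?_ (hC F M hF hM y)
  rw [Pi.mul_apply, norm_mul, Complex.norm_real, Real.norm_eq_abs, pow_succ (1 + |y|) 2, mul_assoc]
  gcongr
  linarith

/-! ### The Fourier transform of the twisted inversion -/

theorem Real.fourier_linear {f g : ℝ → ℂ} (hf : Integrable f) (hg : Integrable g) (c d : ℂ)
    (x : ℝ) : 𝓕 (fun y => c * f y + d * g y) x = c * 𝓕 f x + d * 𝓕 g x := by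
  simp only [Real.fourier_real_eq]
  have h1 := (Real.fourierIntegral_convergent_iff (μ := volume) x).2 hf
  have h2 := (Real.fourierIntegral_convergent_iff (μ := volume) x).2 hg
  have e (v : ℝ) : inner ℝ v x = v * x := by simp [mul_comm]
  simp only [e] at h1 h2
  rw [← integral_const_mul, ← integral_const_mul,
    ← integral_add (h1.const_mul c) (h2.const_mul d)]
  congr 1
  funext v
  simp only [Circle.smul_def, smul_eq_mul]
  ring

theorem Real.norm_fourier_le (f : ℝ → ℂ) (x : ℝ) : ‖𝓕 f x‖ ≤ ∫ y, ‖f y‖ :=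
  VectorFourier.norm_fourierIntegral_le_integral_norm _ _ _ _ _

/-- The function `(2πix)^{-a} 𝓕(G^{(a)})`, for `G` the twisted inversion of `F`. For large `a` it
does not depend on `a`. -/
noncomputable def twistFourierSeq (α : ℂ) (η : ZMod 2) (F : ℝ → ℂ) (a : ℕ) (x : ℝ) : ℂ :=
  ((2 * Real.pi * Complex.I * x) ^ a)⁻¹ * 𝓕 (iteratedDeriv a (invTwist α η F)) x

/-- The Fourier transform, off `0`, of the twisted inversion of `F`. -/
noncomputable def twistFourier (α : ℂ) (η : ZMod 2) (F : ℝ → ℂ) (x : ℝ) : ℂ :=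
  if x = 0 then 0 else Filter.limUnder Filter.atTop fun a => twistFourierSeq α η F a x

theorem two_pi_I_mul_ne_zero {x : ℝ} (hx : x ≠ 0) : (2 * Real.pi * Complex.I * x : ℂ) ≠ 0 := by
  have : (x : ℂ) ≠ 0 := by exact_mod_cast hx
  have : (Real.pi : ℂ) ≠ 0 := by exact_mod_cast Real.pi_ne_zero
  simp [*]

/-- Passing from a to a + 1 multiplies the Fourier transform by 2πix, which the prefactor cancels,
so the sequence is eventually constant and a may be chosen freely. -/
theorem IsTame.twistFourier_eq {k : ℕ} {F : ℝ → ℂ} (hF : IsTame k F) (α : ℂ) (η : ZMod 2) {a : ℕ}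
    (ha : k + twistOrder α + 2 ≤ a) {x : ℝ} (hx : x ≠ 0) :
    twistFourier α η F x = twistFourierSeq α η F a x := by
  have hstep (b : ℕ) (hb : k + twistOrder α + 2 ≤ b) :
      twistFourierSeq α η F (b + 1) x = twistFourierSeq α η F b x := by
    have h1 := hF.integrable_iteratedDeriv_invTwist (α := α) (η := η) hb
    have h2 := hF.integrable_iteratedDeriv_invTwist (α := α) (η := η) (hb.trans (Nat.le_succ b))
    have hd : Differentiable ℝ (iteratedDeriv b (invTwist α η F)) := fun y =>
      ((hF.contDiff_invTwist α η).contDiffAt.iteratedDeriv_infty b).differentiableAt_infty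
    rw [iteratedDeriv_succ] at h2
    rw [twistFourierSeq, twistFourierSeq, iteratedDeriv_succ, Real.fourier_deriv h1 hd h2]
    have := two_pi_I_mul_ne_zero hx
    dsimp only
    rw [smul_eq_mul, pow_succ, mul_inv, mul_assoc, ← mul_assoc _ (2 * Real.pi * Complex.I * x : ℂ),
      inv_mul_cancel₀ this, one_mul]
  have hconst (b : ℕ) (hb : a ≤ b) : twistFourierSeq α η F b x = twistFourierSeq α η F a x := by
    induction b, hb using Nat.le_induction with
    | base => rfl
    | succ b hb ih => rw [hstep b (ha.trans hb), ih]
  rw [twistFourier, if_neg hx]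
  refine Filter.Tendsto.limUnder_eq (tendsto_const_nhds.congr' ?_)
  filter_upwards [Filter.eventually_ge_atTop a] with b hb using (hconst b hb).symm

theorem IsTame.twistFourier_linear {k : ℕ} {F H : ℝ → ℂ} (hF : IsTame k F) (hH : IsTame k H)
    (α : ℂ) (η : ZMod 2) (c d : ℂ) :
    twistFourier α η (fun x => c * F x + d * H x)
      = fun x => c * twistFourier α η F x + d * twistFourier α η H x := by
  funext x
  rcases eq_or_ne x 0 with rfl | hx
  · simp [twistFourier]
  set a := k + twistOrder α + 2
  have hn : ∀ {G : ℝ → ℂ} {y : ℝ}, ContDiff ℝ ∞ G → ContDiffAt ℝ (a : ℕ∞ω) G y :=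
    fun h => h.contDiffAt.of_le (by exact_mod_cast le_top)
  have he : iteratedDeriv a (invTwist α η (fun x => c * F x + d * H x)) = fun y =>
      c * iteratedDeriv a (invTwist α η F) y + d * iteratedDeriv a (invTwist α η H) y := by
    funext y
    rw [invTwist_linear, iteratedDeriv_fun_add
      (hn (contDiff_const.mul (hF.contDiff_invTwist α η)))
      (hn (contDiff_const.mul (hH.contDiff_invTwist α η))), iteratedDeriv_const_mul_field,
      iteratedDeriv_const_mul_field]
  rw [((hF.const_mul c).add (hH.const_mul d)).twistFourier_eq α η le_rfl hx,
    hF.twistFourier_eq α η le_rfl hx, hH.twistFourier_eq α η le_rfl hx, twistFourierSeq,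
    twistFourierSeq, twistFourierSeq, he, Real.fourier_linear
      (hF.integrable_iteratedDeriv_invTwist le_rfl) (hH.integrable_iteratedDeriv_invTwist le_rfl)]
  ring

/-- The relation θ(T F) = T(θF + αF). It follows by differentiating (2πix)^{-a} 𝓕(G^{(a)}) and
recognising (y G^{(a)})' as the a-th derivative of a twisted inversion. -/
theorem IsTame.hasDerivAt_twistFourier {k : ℕ} {F : ℝ → ℂ} (hF : IsTame k F) (α : ℂ) (η : ZMod 2)
    {x : ℝ} (hx : x ≠ 0) :
    HasDerivAt (twistFourier α η F)
      ((x : ℂ)⁻¹ * twistFourier α η (fun x => 1 * _root_.eulerOp F x + α * F x) x) x := by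
  set G := invTwist α η F with hG
  set a := k + twistOrder α + 3
  set u := iteratedDeriv a G with hu
  set w : ℂ := 2 * Real.pi * Complex.I with hw
  have hx' : (x : ℂ) ≠ 0 := by exact_mod_cast hx
  have hw0 : w ≠ 0 := by
    have : (Real.pi : ℂ) ≠ 0 := by exact_mod_cast Real.pi_ne_zero
    simp [hw, this]
  have hGs : ContDiff ℝ ∞ G := hF.contDiff_invTwist α η
  have hus (y : ℝ) : ContDiffAt ℝ ∞ u y := hGs.contDiffAt.iteratedDeriv_infty a
  have hui : Integrable u := hF.integrable_iteratedDeriv_invTwist (by omega)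
  have hyu : Integrable (fun y : ℝ => (y : ℂ) * u y) :=
    hF.integrable_mul_iteratedDeriv_invTwist le_rfl
  have hyu' : Integrable (fun y : ℝ => (y : ℂ) * iteratedDeriv (a + 1) G y) :=
    hF.integrable_mul_iteratedDeriv_invTwist (by omega)
  have hder (y : ℝ) : HasDerivAt (fun y : ℝ => (y : ℂ) * u y)
      (u y + y * iteratedDeriv (a + 1) G y) y := by
    have h1 : HasDerivAt (fun y : ℝ => (y : ℂ)) 1 y := Complex.ofRealCLM.hasDerivAt
    have h2 := h1.mul (hus y).differentiableAt_infty.hasDerivAt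
    rw [one_mul, hu, ← iteratedDeriv_succ] at h2
    exact h2
  have hder' : deriv (fun y : ℝ => (y : ℂ) * u y)
      = fun y => u y + y * iteratedDeriv (a + 1) G y := funext fun y => (hder y).deriv
  have hfd := Real.fourier_deriv hyu (fun y => (hder y).differentiableAt)
    (by rw [hder']; exact hui.add hyu')
  -- (y G^{(a)})' is the a-th derivative of θG + (1 - a)G, which by `eulerOp_invTwist` is the
  -- twisted inversion of this H.
  set H : ℝ → ℂ := fun x => (-1) * _root_.eulerOp F x + (-(α + a)) * F x with hH
  have hHt : IsTame k H := (hF.eulerOp.const_mul _).add (hF.const_mul _)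
  have hH' : deriv (fun y : ℝ => (y : ℂ) * u y) = iteratedDeriv a (invTwist α η H) := by
    have e1 : invTwist α η H = fun y => 1 * _root_.eulerOp G y + (1 - a) * G y := by
      rw [hH, invTwist_linear, hG, eulerOp_invTwist hF.smooth]
      funext y; ring
    have hn : ∀ {G : ℝ → ℂ} {y : ℝ}, ContDiffAt ℝ ∞ G y → ContDiffAt ℝ (a : ℕ∞ω) G y :=
      fun h => h.of_le (by exact_mod_cast le_top)
    funext y
    rw [e1, iteratedDeriv_fun_add (hn (contDiffAt_const.mul hGs.contDiffAt.eulerOp))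
      (hn (contDiffAt_const.mul hGs.contDiffAt)), iteratedDeriv_const_mul_field,
      iteratedDeriv_const_mul_field, iteratedDeriv_eulerOp hGs.contDiffAt, hder']
    ring
  have hF1 : w * x * 𝓕 (fun y : ℝ => (y : ℂ) * u y) x
      = (w * x) ^ a * twistFourier α η H x := by
    rw [hHt.twistFourier_eq α η (a := a) (by omega) hx, twistFourierSeq, ← hH', hfd]
    rw [← mul_assoc, mul_inv_cancel₀ (pow_ne_zero _ (mul_ne_zero hw0 hx')), one_mul]
    rfl
  have hlin : twistFourier α η H x = -(twistFourier α η (fun x => 1 * _root_.eulerOp F x + α * F x) x)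
      - a * twistFourier α η F x := by
    rw [hH, hF.eulerOp.twistFourier_linear hF, hF.eulerOp.twistFourier_linear hF]
    ring
  have hfour : HasDerivAt (𝓕 u) (-w * 𝓕 (fun y : ℝ => (y : ℂ) * u y) x) x := by
    have h1 := Real.hasDerivAt_fourier hui (by simpa using hyu) x
    have e : (fun y : ℝ => (-2 * Real.pi * Complex.I * y : ℂ) • u y)
        = fun y : ℝ => (-w) * ((y : ℂ) * u y) + 0 * ((y : ℂ) * u y) := by
      funext y; rw [hw, smul_eq_mul]; ring
    rw [e, Real.fourier_linear hyu hyu, zero_mul, add_zero] at h1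
    exact h1
  have hinv : HasDerivAt (fun z : ℝ => ((w * z) ^ a)⁻¹) (-(a : ℂ) * ((w * x) ^ a)⁻¹ * (x : ℂ)⁻¹) x := by
    have h1 : HasDerivAt (fun z : ℝ => w * (z : ℂ)) w x := by
      simpa using (Complex.ofRealCLM.hasDerivAt (x := x)).const_mul w
    have h2 := (h1.pow a).inv (pow_ne_zero _ (mul_ne_zero hw0 hx'))
    refine h2.congr_deriv ?_
    have ha1 : a = (a - 1) + 1 := by omega
    simp only [Pi.pow_apply]
    rw [show (w * (x : ℂ)) ^ a = (w * x) ^ (a - 1) * (w * x) by rw [← pow_succ, ← ha1]]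
    have := pow_ne_zero (a - 1) (mul_ne_zero hw0 hx')
    field_simp
  have hev : twistFourier α η F =ᶠ[nhds x] (fun z : ℝ => ((w * z) ^ a)⁻¹) * 𝓕 u := by
    filter_upwards [isOpen_ne.mem_nhds hx] with z hz
    rw [hF.twistFourier_eq α η (a := a) (by omega) hz]
    rfl
  refine ((hinv.mul hfour).congr_of_eventuallyEq hev).congr_deriv ?_
  have hTF : twistFourier α η F x = ((w * x) ^ a)⁻¹ * 𝓕 u x :=
    hF.twistFourier_eq α η (a := a) (by omega) hx
  have hFu : 𝓕 (fun y : ℝ => (y : ℂ) * u y) x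
      = (w * x)⁻¹ * ((w * x) ^ a * twistFourier α η H x) := by
    rw [← hF1, ← mul_assoc, inv_mul_cancel₀ (mul_ne_zero hw0 hx'), one_mul]
  have hp := pow_ne_zero a (mul_ne_zero hw0 hx')
  calc _ = -(a : ℂ) * (x : ℂ)⁻¹ * (((w * x) ^ a)⁻¹ * 𝓕 u x) + ((w * x) ^ a)⁻¹ *
        (-w * 𝓕 (fun y : ℝ => (y : ℂ) * u y) x) := by ring
    _ = -(a : ℂ) * (x : ℂ)⁻¹ * twistFourier α η F x - (x : ℂ)⁻¹ * twistFourier α η H x := by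
      rw [← hTF, hFu]
      field_simp
      ring
    _ = _ := by rw [hlin]; ring

theorem IsTame.eulerOp_add_const_mul {k : ℕ} {F : ℝ → ℂ} (hF : IsTame k F) (α : ℂ) :
    IsTame k (fun x => 1 * _root_.eulerOp F x + α * F x) :=
  (hF.eulerOp.const_mul 1).add (hF.const_mul α)

theorem IsTame.contDiffAt_twistFourier {k : ℕ} {F : ℝ → ℂ} (hF : IsTame k F) (α : ℂ) (η : ZMod 2)
    {x : ℝ} (hx : x ≠ 0) : ContDiffAt ℝ ∞ (twistFourier α η F) x := by
  -- The induction runs over all tame F at once, since the derivative of T F is x⁻¹ T applied to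
  -- another tame function of the same order.
  have key (n : ℕ) : ∀ F : ℝ → ℂ, IsTame k F → ContDiffOn ℝ n (twistFourier α η F) {0}ᶜ := by
    induction n with
    | zero =>
      intro F hF
      rw [Nat.cast_zero, contDiffOn_zero]
      exact fun y hy => (hF.hasDerivAt_twistFourier α η hy).continuousAt.continuousWithinAt
    | succ n ih =>
      intro F hF
      rw [Nat.cast_succ, contDiffOn_succ_iff_deriv_of_isOpen isOpen_compl_singleton]
      refine ⟨fun y hy =>
        (hF.hasDerivAt_twistFourier α η hy).differentiableAt.differentiableWithinAt,
        fun h => by simp at h, ?_⟩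
      have h1 : ContDiffOn ℝ n (fun y : ℝ => ((y : ℂ))⁻¹) {0}ᶜ := fun y hy =>
        ((contDiffAt_ofReal (n := n)).inv (by simpa using hy)).contDiffWithinAt
      exact (h1.mul (ih _ (hF.eulerOp_add_const_mul α))).congr fun y hy =>
        (hF.hasDerivAt_twistFourier α η hy).deriv
  exact (contDiffOn_infty.2 fun n => key n F hF).contDiffAt (isOpen_compl_singleton.mem_nhds hx)

theorem exists_pow_mul_norm_eulerOp_iterate_twistFourier_le (α : ℂ) (η : ZMod 2) {a k : ℕ}
    (ha : k + twistOrder α + 2 ≤ a) (b : ℕ) :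
    ∃ C : ℝ, 0 ≤ C ∧ ∀ (F : ℝ → ℂ) (M : ℝ), IsTame k F →
      EulerBound k (twistOrder α + a + 2) (a + b) M F → ∀ x : ℝ, x ≠ 0 →
      |x| ^ a * ‖eulerOp^[b] (twistFourier α η F) x‖ ≤ C * M := by
  induction b with
  | zero =>
    obtain ⟨C, hC0, hC⟩ := exists_pow_mul_norm_iteratedDeriv_invTwist_le α η ha
    refine ⟨C * Real.pi, mul_nonneg hC0 Real.pi_pos.le, fun F M hF hM x hx => ?_⟩
    have h1 := (integrable_of_sq_mul_norm_le (hF.continuous_iteratedDeriv_invTwist α η a)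
      (hC F M hF hM)).2
    have hx' : 0 < |x| := abs_pos.2 hx
    have h2 : 1 ≤ (2 * Real.pi) ^ a := one_le_pow₀ (by linarith [Real.pi_gt_three])
    simp only [Function.iterate_zero, id_eq]
    rw [hF.twistFourier_eq α η ha hx, twistFourierSeq, norm_mul, norm_inv, norm_pow]
    have h3 : ‖(2 * Real.pi * Complex.I * x : ℂ)‖ = 2 * Real.pi * |x| := by
      simp [abs_of_pos Real.pi_pos]
    rw [h3, mul_pow, mul_inv]
    have hI := (Real.norm_fourier_le (iteratedDeriv a (invTwist α η F)) x).trans h1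
    have h4 : ((2 * Real.pi) ^ a)⁻¹ ≤ 1 := inv_le_one_of_one_le₀ h2
    calc _ = ((2 * Real.pi) ^ a)⁻¹ * ‖𝓕 (iteratedDeriv a (invTwist α η F)) x‖ := by
          field_simp
      _ ≤ 1 * (C * M * Real.pi) := mul_le_mul h4 hI (norm_nonneg _) zero_le_one
      _ = _ := by ring
  | succ b ih =>
    obtain ⟨C, hC0, hC⟩ := ih
    refine ⟨C * (1 + ‖α‖), by positivity, fun F M hF hM x hx => ?_⟩
    have hev : eulerOp (twistFourier α η F) =ᶠ[nhds x]
        twistFourier α η (fun x => 1 * eulerOp F x + α * F x) := by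
      filter_upwards [isOpen_ne.mem_nhds hx] with y hy
      have hy' : (y : ℂ) ≠ 0 := by exact_mod_cast hy
      rw [eulerOp, (hF.hasDerivAt_twistFourier α η hy).deriv, ← mul_assoc, mul_inv_cancel₀ hy',
        one_mul]
    rw [Function.iterate_succ_apply, (hev.eulerOp_iterate b).eq_of_nhds]
    have hM' : EulerBound k (twistOrder α + a + 2) (a + b + 1) M F := hM
    have hB := (hM'.eulerOp.const_mul 1).add
      ((hM'.mono le_rfl (Nat.le_succ _) le_rfl).const_mul α)
      (hF.eulerOp.const_mul 1).smooth (hF.const_mul α).smooth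
    refine (hC _ _ (hF.eulerOp_add_const_mul α) hB x hx).trans (le_of_eq ?_)
    rw [norm_one]; ring

/-- The smallest admissible number l of derivatives fixes the order of the singularity at 0; l + n
derivatives give n powers of decay. -/
theorem exists_eulerBound_twistFourier (α : ℂ) (η : ZMod 2) (k n m : ℕ) :
    ∃ (n' m' : ℕ) (C : ℝ), ∀ (F : ℝ → ℂ) (M : ℝ), IsTame k F → EulerBound k n' m' M F →
      EulerBound (k + twistOrder α + 2) n m (C * M) (twistFourier α η F) := by
  set l := k + twistOrder α + 2
  choose C hC0 hC using fun b => exists_pow_mul_norm_eulerOp_iterate_twistFourier_le α η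
    (le_refl l) b
  choose D hD0 hD using fun b => exists_pow_mul_norm_eulerOp_iterate_twistFourier_le α η
    (Nat.le_add_right l n) b
  have hs0 (b : ℕ) : 0 ≤ 2 ^ n * (C b + D b) :=
    mul_nonneg (by positivity) (add_nonneg (hC0 b) (hD0 b))
  refine ⟨twistOrder α + (l + n) + 2, l + n + m, ∑ b ∈ Finset.range (m + 1), 2 ^ n * (C b + D b),
    fun F M hF hM b hb x hx => ?_⟩
  have h1 := hC b F M hF (hM.mono (by omega) (by omega) le_rfl) x hx
  have h2 := hD b F M hF (hM.mono (by omega) (by omega) le_rfl) x hx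
  have hM0 := hM.nonneg
  calc _ ≤ |x| ^ l * (2 ^ n * (1 + |x| ^ n)) * ‖eulerOp^[b] (twistFourier α η F) x‖ := by
        gcongr; exact one_add_pow_le (abs_nonneg x) n
    _ = 2 ^ n * (|x| ^ l * ‖eulerOp^[b] (twistFourier α η F) x‖
        + |x| ^ (l + n) * ‖eulerOp^[b] (twistFourier α η F) x‖) := by rw [pow_add]; ring
    _ ≤ 2 ^ n * (C b * M + D b * M) := by gcongr
    _ = (2 ^ n * (C b + D b)) * M := by ring
    _ ≤ _ := by
      gcongr
      exact Finset.single_le_sum (f := fun b => 2 ^ n * (C b + D b)) (fun i _ => hs0 i)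
        (Finset.mem_range.2 (Nat.lt_succ_of_le hb))

theorem IsTame.twistFourier {k : ℕ} {F : ℝ → ℂ} (hF : IsTame k F) (α : ℂ) (η : ZMod 2) :
    IsTame (k + twistOrder α + 2) (twistFourier α η F) where
  smooth _ hx := hF.contDiffAt_twistFourier α η hx
  bound n m := by
    obtain ⟨n', m', C, hC⟩ := exists_eulerBound_twistFourier α η k n m
    obtain ⟨M, hM⟩ := hF.bound n' m'
    exact ⟨_, hC F M hF hM⟩

/-- Applied to the extension of σ, this functional will be T*σ. -/
theorem IsFlatFunctional.comp_twistFourier {L : (ℝ → ℂ) → ℂ} (hL : IsFlatFunctional L) (α : ℂ)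
    (η : ZMod 2) : IsFlatFunctional (fun F => L (twistFourier α η F)) where
  add k F H hF hH := by
    have h := hF.twistFourier_linear hH α η 1 1
    simp only [one_mul] at h
    rw [h]
    exact hL.add _ _ _ (hF.twistFourier α η) (hH.twistFourier α η)
  const_mul k c F hF := by
    have h := hF.twistFourier_linear hF α η c 0
    simp only [zero_mul, add_zero] at h
    rw [h]
    exact hL.const_mul _ _ _ (hF.twistFourier α η)
  bound k := by
    obtain ⟨n, m, C, hC⟩ := hL.bound (k + twistOrder α + 2)
    obtain ⟨n', m', C', hC'⟩ := exists_eulerBound_twistFourier α η k n m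
    refine ⟨n', m', C * C', fun F M hF hM => ?_⟩
    rw [mul_assoc]
    exact hC _ _ (hF.twistFourier α η) (hC' F M hF hM)

/-- Applied to the extension of σ, it yields the canonical extension of the product F σ. -/
theorem IsFlatFunctional.comp_mul {L : (ℝ → ℂ) → ℂ} (hL : IsFlatFunctional L) {r : ℕ} {F : ℝ → ℂ}
    (hF : IsTame r F) : IsFlatFunctional (fun H => L (fun x => F x * H x)) where
  add k H H' hH hH' := by
    simp only [mul_add]
    exact hL.add _ _ _ (hF.mul hH) (hF.mul hH')
  const_mul k c H hH := by
    simp only [mul_left_comm _ c]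
    exact hL.const_mul _ c _ (hF.mul hH)
  bound k := by
    obtain ⟨n, m, C, hC⟩ := hL.bound (r + k)
    obtain ⟨M₀, hM₀⟩ := hF.bound 0 m
    refine ⟨n, m, C * (2 ^ m * M₀), fun H M hH hM => ?_⟩
    have h1 := hM₀.mul hM hF.smooth hH.smooth
    rw [zero_add] at h1
    refine (hC _ _ (hF.mul hH) h1).trans (le_of_eq (by ring))

/-! ### The distributional Fourier transform of the twisted inversion -/

theorem IsTestOffZero.exists_bounds {ψ : 𝓢(ℝ, ℂ)} (hψ : IsTestOffZero ψ) :
    ∃ δ R : ℝ, 0 < δ ∧ 0 < R ∧ (∀ x, |x| ≤ δ → ψ x = 0) ∧ ∀ x, R ≤ |x| → ψ x = 0 := by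
  obtain ⟨δ, hδ, h0⟩ := Metric.eventually_nhds_iff.1 (notMem_tsupport_iff_eventuallyEq.1 hψ.2)
  obtain ⟨R, hR⟩ := hψ.1.isCompact.isBounded.subset_closedBall 0
  refine ⟨δ / 2, |R| + 1, half_pos hδ, by positivity, fun x hx => h0 ?_, fun x hx => ?_⟩
  · rw [Real.dist_eq, sub_zero]; linarith
  · by_contra hne
    have := hR (subset_tsupport _ hne)
    rw [Metric.mem_closedBall, Real.dist_eq, sub_zero] at this
    linarith [le_abs_self R]

theorem Function.HasTemperateGrowth.deriv {G : ℝ → ℂ} (hG : G.HasTemperateGrowth) :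
    (_root_.deriv G).HasTemperateGrowth := by
  refine ⟨contDiff_iff_contDiffAt.2 fun y => hG.1.contDiffAt.deriv_infty, fun n => ?_⟩
  obtain ⟨k, C, h⟩ := hG.2 (n + 1)
  refine ⟨k, C, fun x => ?_⟩
  have := h x
  rwa [norm_iteratedFDeriv_eq_norm_iteratedDeriv, iteratedDeriv_succ',
    ← norm_iteratedFDeriv_eq_norm_iteratedDeriv] at this

theorem SchwartzMap.integrable_mul_temperate (φ : 𝓢(ℝ, ℂ)) {G : ℝ → ℂ}
    (hG : G.HasTemperateGrowth) : Integrable (fun x => φ x * G x) := by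
  refine (SchwartzMap.smulLeftCLM ℂ G φ).integrable.congr (Filter.Eventually.of_forall fun x => ?_)
  simp only [SchwartzMap.smulLeftCLM_apply_apply hG, smul_eq_mul, mul_comm]

theorem integral_fourier_mulPow_one_mul (φ : 𝓢(ℝ, ℂ)) {G : ℝ → ℂ} (hG : G.HasTemperateGrowth) :
    2 * Real.pi * Complex.I * ∫ x, 𝓕 (mulPow 1 φ) x * G x = ∫ x, 𝓕 φ x * deriv G x := by
  have hd (x : ℝ) : HasDerivAt (𝓕 φ : 𝓢(ℝ, ℂ))
      (-(2 * Real.pi * Complex.I) * 𝓕 (mulPow 1 φ) x) x := by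
    have hi : Integrable (fun y : ℝ => (y : ℂ) * φ y) :=
      (mulPow 1 φ).integrable.congr (Filter.Eventually.of_forall fun y => by
        simp only [mulPow_apply, pow_one])
    have h1 := Real.hasDerivAt_fourier φ.integrable (by simpa using hi) x
    have e : (fun y : ℝ => (-2 * Real.pi * Complex.I * y : ℂ) • φ y)
        = fun y : ℝ => (-(2 * Real.pi * Complex.I)) * ((y : ℂ) * φ y) + 0 * ((y : ℂ) * φ y) := by
      funext y; rw [smul_eq_mul]; ring
    have e2 : (fun y : ℝ => (y : ℂ) * φ y) = mulPow 1 φ := by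
      funext y; rw [mulPow_apply, pow_one]
    rw [e, Real.fourier_linear hi hi, zero_mul, add_zero, e2] at h1
    exact h1
  have hGd (x : ℝ) : HasDerivAt G (deriv G x) x :=
    (hG.1.contDiffAt.differentiableAt_infty).hasDerivAt
  have h1 := (𝓕 φ : 𝓢(ℝ, ℂ)).integrable_mul_temperate hG.deriv
  have h2 := (((𝓕 (mulPow 1 φ) : 𝓢(ℝ, ℂ)).integrable_mul_temperate hG).const_mul
    (-(2 * Real.pi * Complex.I)))
  have h3 := (𝓕 φ : 𝓢(ℝ, ℂ)).integrable_mul_temperate hG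
  have key := integral_mul_deriv_eq_deriv_mul_of_integrable (fun x _ => hd x) (fun x _ => hGd x) h1
    (h2.congr (Filter.Eventually.of_forall fun x => by simp only [Pi.mul_apply]; ring)) h3
  rw [key, ← integral_neg, ← integral_const_mul]
  congr 1
  funext x
  ring

theorem integral_fourier_mulPow_mul (a : ℕ) (φ : 𝓢(ℝ, ℂ)) {G : ℝ → ℂ}
    (hG : G.HasTemperateGrowth) :
    (2 * Real.pi * Complex.I) ^ a * ∫ x, 𝓕 (mulPow a φ) x * G x
      = ∫ x, 𝓕 φ x * iteratedDeriv a G x := by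
  induction a generalizing G with
  | zero =>
    have : mulPow 0 φ = φ := by ext x; simp [mulPow_apply]
    simp [this]
  | succ a ih =>
    have : mulPow (a + 1) φ = mulPow 1 (mulPow a φ) := by
      ext x; simp only [mulPow_apply]; ring
    rw [iteratedDeriv_succ', ← ih hG.deriv, ← integral_fourier_mulPow_one_mul _ hG, this]
    ring

theorem integral_schwartz_fourier_mul (φ : 𝓢(ℝ, ℂ)) {u : ℝ → ℂ} (hu : Integrable u) :
    ∫ x, 𝓕 φ x * u x = ∫ x, φ x * 𝓕 u x := by
  have := VectorFourier.integral_fourierIntegral_smul_eq_flip (μ := volume) (ν := volume)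
    (L := innerₗ ℝ) Real.continuous_fourierChar (by exact continuous_inner) φ.integrable hu
  simp only [flip_innerₗ, smul_eq_mul] at this
  exact this

/-- A test function off 0 is divisible by (2πix)^a. This moves a derivatives onto G, which becomes
integrable, and the multiplication formula for 𝓕 applies. -/
theorem IsTame.integral_fourier_smul_invTwist {k : ℕ} {F : ℝ → ℂ} (hF : IsTame k F) (α : ℂ)
    (η : ZMod 2) {ψ : 𝓢(ℝ, ℂ)} (hψ : IsTestOffZero ψ) :
    ∫ x, 𝓕 ψ x • invTwist α η F x = ∫ y, _root_.twistFourier α η F y * ψ y := by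
  obtain ⟨δ, R, hδ, hR, h0, hinf⟩ := hψ.exists_bounds
  set a := k + twistOrder α + 2
  obtain ⟨φ, -, hφ⟩ := exists_testOffZero
    (H := fun x : ℝ => ((2 * Real.pi * Complex.I * x) ^ a)⁻¹ * ψ x)
    (fun x hx => (((contDiffAt_const.mul contDiffAt_ofReal).pow a).inv
      (pow_ne_zero _ (two_pi_I_mul_ne_zero hx))).mul (ψ.contDiffAt_infty x))
    hδ (fun x hx => by rw [h0 x hx, mul_zero]) (fun x hx => by rw [hinf x hx, mul_zero])
  have hψ0 : ψ 0 = 0 := h0 0 (by simpa using hδ.le)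
  have hψφ : ψ = (2 * Real.pi * Complex.I : ℂ) ^ a • mulPow a φ := by
    ext x
    rw [smul_apply, mulPow_apply, hφ, smul_eq_mul]
    rcases eq_or_ne x 0 with rfl | hx
    · simp [hψ0]
    · rw [← mul_assoc, ← mul_assoc, ← mul_pow,
        mul_inv_cancel₀ (pow_ne_zero _ (two_pi_I_mul_ne_zero hx)), one_mul]
  have h1 := integral_fourier_mulPow_mul a φ (hF.hasTemperateGrowth_invTwist α η)
  have h2 : ∫ x, 𝓕 ψ x • invTwist α η F x
      = (2 * Real.pi * Complex.I) ^ a * ∫ x, 𝓕 (mulPow a φ) x * invTwist α η F x := by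
    rw [← integral_const_mul, hψφ, FourierTransform.fourier_smul]
    congr 1
    funext x
    rw [smul_apply, smul_eq_mul, smul_eq_mul, mul_assoc]
  rw [h2, h1, integral_schwartz_fourier_mul φ (hF.integrable_iteratedDeriv_invTwist le_rfl)]
  congr 1
  funext y
  rw [hφ]
  rcases eq_or_ne y 0 with rfl | hy
  · simp [hψ0]
  · rw [hF.twistFourier_eq α η le_rfl hy, twistFourierSeq]
    ring

theorem SchwartzMap.integrable_iteratedDeriv (g : 𝓢(ℝ, ℂ)) (n : ℕ) :
    Integrable (iteratedDeriv n g) := by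
  induction n generalizing g with
  | zero => simpa using g.integrable
  | succ n ih => rw [iteratedDeriv_succ']; exact ih (SchwartzMap.derivCLM ℂ ℂ g)

theorem twistFourier_eq_fourier {α : ℂ} {η : ZMod 2} {k : ℕ} {F : ℝ → ℂ} (hF : IsTame k F)
    {g : 𝓢(ℝ, ℂ)} (hg : ∀ y, g y = invTwist α η F y) {x : ℝ} (hx : x ≠ 0) :
    twistFourier α η F x = 𝓕 g x := by
  rw [hF.twistFourier_eq α η le_rfl hx, twistFourierSeq, ← funext hg,
    Real.fourier_iteratedDeriv (N := ⊤) (g.smooth ⊤) (fun n _ => g.integrable_iteratedDeriv n)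
      le_top]
  dsimp only
  rw [smul_eq_mul, ← mul_assoc,
    inv_mul_cancel₀ (pow_ne_zero _ (two_pi_I_mul_ne_zero hx)), one_mul]
  rfl

theorem IsTestOffZero.exists_invTwist {ψ : 𝓢(ℝ, ℂ)} (hψ : IsTestOffZero ψ) (α : ℂ) (η : ZMod 2) :
    ∃ g : 𝓢(ℝ, ℂ), ∀ y, g y = invTwist α η ψ y := by
  obtain ⟨δ, R, hδ, hR, h0, hinf⟩ := hψ.exists_bounds
  obtain ⟨g, -, hg⟩ := exists_testOffZero (H := invTwist α η ψ) (δ := R⁻¹) (R := δ⁻¹)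
    (fun y hy => contDiffAt_invTwist hy (ψ.contDiffAt_infty _)) (inv_pos.2 hR)
    (fun y hy => by
      rcases eq_or_ne y 0 with rfl | hne
      · exact invTwist_zero _ _ _
      · have : R ≤ |1 / y| := by
          rw [abs_div, abs_one, le_div_iff₀ (abs_pos.2 hne)]
          calc R * |y| ≤ R * R⁻¹ := by gcongr
            _ = 1 := mul_inv_cancel₀ hR.ne'
        rw [invTwist_of_ne hne, hinf _ this]; simp)
    (fun y hy => by
      have hy' : 0 < |y| := (inv_pos.2 hδ).trans_le hy
      have : |1 / y| ≤ δ := by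
        rw [abs_div, abs_one, div_le_iff₀ hy']
        calc 1 = δ * δ⁻¹ := (mul_inv_cancel₀ hδ.ne').symm
          _ ≤ δ * |y| := by gcongr
      rw [invTwist_of_ne (abs_pos.1 hy'), h0 _ this]; simp)
  exact ⟨g, hg⟩

/-- |y|^{1-α} y^{-2} = |y|^{-α-1}: the change of variables defining T* uses the same twisted
inversion as T, so T* is the transpose of T. -/
theorem invTwist_eq_absPow_one_sub (α : ℂ) (η : ZMod 2) {ψ : ℝ → ℂ} (y : ℝ) :
    invTwist α η ψ y = sgPow η y * absPow (1 - α) y * ψ (1 / y) * ((y : ℂ) ^ 2)⁻¹ := by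
  rcases eq_or_ne y 0 with rfl | hy
  · simp [invTwist_zero]
  · have hy' : (y : ℂ) ≠ 0 := by exact_mod_cast hy
    have hy'' : ((|y| : ℝ) : ℂ) ≠ 0 := by exact_mod_cast (abs_pos.2 hy).ne'
    have h1 : absPow (1 - α) y = absPow (-α - 1) y * (y : ℂ) ^ 2 := by
      have h2 : (y : ℂ) ^ 2 = ((|y| : ℝ) : ℂ) ^ (2 : ℂ) := by
        rw [Complex.cpow_ofNat]; norm_cast; rw [sq_abs]
      rw [h2, absPow, absPow, ← Complex.cpow_add _ _ hy'']
      congr 1; ring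
    rw [invTwist_of_ne hy, h1]
    field_simp

/-! ### The operators and the pairing -/

theorem isTalpha_twistFourier {k : ℕ} {f : ℝ → ℂ} (hf : IsTame k f) (α : ℂ) (η : ZMod 2) :
    IsTalpha α η f (twistFourier α η f) := by
  refine ⟨by simp [twistFourier], fun x hx =>
    (hf.contDiffAt_twistFourier α η hx).contDiffWithinAt,
    hf.hasTemperateGrowth_invTwist α η, fun ψ hψ => ?_⟩
  rw [TemperedDistribution.fourier_apply]
  exact hf.integral_fourier_smul_invTwist α η hψ

/-- Test functions determine F almost everywhere off 0, continuity determines it everywhere there,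
and the value at 0 is normalised. -/
theorem IsTalpha.unique {α : ℂ} {η : ZMod 2} {f F H : ℝ → ℂ} (hF : IsTalpha α η f F)
    (hH : IsTalpha α η f H) : F = H := by
  obtain ⟨hF0, hFs, hg, hFi⟩ := hF
  obtain ⟨hH0, hHs, hg', hHi⟩ := hH
  have hli : LocallyIntegrableOn (fun x => F x - H x) {0}ᶜ volume :=
    (hFs.continuousOn.sub hHs.continuousOn).locallyIntegrableOn
      isOpen_compl_singleton.measurableSet
  have hae := isOpen_compl_singleton.ae_eq_zero_of_integral_contDiff_smul_eq_zero hli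
    (fun g hgs hgc hg0 => by
      have hc : HasCompactSupport (fun x => (g x : ℂ)) :=
        hgc.comp_left (g := fun t : ℝ => (t : ℂ)) (by simp)
      have hsm : ContDiff ℝ ∞ (fun x => (g x : ℂ)) := Complex.ofRealCLM.contDiff.comp hgs
      have hts : tsupport (fun x => (g x : ℂ)) ⊆ tsupport g :=
        closure_mono fun x hx => by
          simpa using hx
      set ψ : 𝓢(ℝ, ℂ) := hc.toSchwartzMap hsm
      have hψ : IsTestOffZero ψ := ⟨hc, fun h => hg0 (hts h) rfl⟩
      have hInt {K : ℝ → ℂ} (hK : ContDiffOn ℝ ∞ K {0}ᶜ) : Integrable (fun y => K y * ψ y) := by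
        have hcont : Continuous (fun y => K y * ψ y) := by
          rw [continuous_iff_continuousAt]
          intro y
          by_cases hy : y = 0
          · subst hy
            have : (fun y => K y * ψ y) =ᶠ[nhds 0] fun _ => 0 := by
              filter_upwards [notMem_tsupport_iff_eventuallyEq.1 hψ.2] with z hz
              rw [hz]; simp
            exact continuousAt_const.congr this.symm
          · exact ((hK.contDiffAt (isOpen_compl_singleton.mem_nhds hy)).continuousAt).mul
              ψ.continuous.continuousAt
        exact hcont.integrable_of_hasCompactSupport (hψ.1.mul_left)
      have h1 := (hFi ψ hψ).symm.trans (hHi ψ hψ)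
      rw [← sub_eq_zero, ← integral_sub (hInt hFs) (hInt hHs)] at h1
      rw [← h1]
      congr 1
      funext x
      have : ψ x = (g x : ℂ) := rfl
      rw [this, Complex.real_smul]; ring)
  have hae' : (fun x => F x - H x) =ᵐ[volume.restrict {0}ᶜ] fun _ => 0 := by
    rw [Filter.EventuallyEq, ae_restrict_iff' isOpen_compl_singleton.measurableSet]
    exact hae
  have heq := Measure.eqOn_open_of_ae_eq hae' isOpen_compl_singleton
    (hFs.continuousOn.sub hHs.continuousOn) continuousOn_const
  funext x
  rcases eq_or_ne x 0 with rfl | hx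
  · rw [hF0, hH0]
  · exact sub_eq_zero.1 (heq hx)

theorem IsFlat.exists_isTstar {σ : 𝓢'(ℝ, ℂ)} (hσ : IsFlat σ) (α : ℂ) (η : ZMod 2) :
    ∃ ρ : 𝓢'(ℝ, ℂ), IsFlat ρ ∧ IsTstar α η σ ρ ∧
      ∀ ψ : 𝓢(ℝ, ℂ), ρ ψ = flatExtend σ (twistFourier α η ψ) := by
  obtain ⟨ρ, hρ, hρψ⟩ := (hσ.isFlatFunctional.comp_twistFourier α η).exists_distribution
  refine ⟨ρ, hρ, ⟨vanishesToInfiniteOrder_iff_isFlat.2 hρ, fun ψ hψ => ?_⟩, hρψ⟩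
  obtain ⟨g, hg⟩ := hψ.exists_invTwist α η
  refine ⟨g, fun y => by rw [hg, invTwist_eq_absPow_one_sub], ?_⟩
  rw [hρψ, TemperedDistribution.fourier_apply]
  exact hσ.flatExtend_eq (𝓕 g) fun x hx => twistFourier_eq_fourier ψ.isTame hg hx

theorem IsTstar.unique {α : ℂ} {η : ZMod 2} {σ ρ ρ' : 𝓢'(ℝ, ℂ)} (h : IsTstar α η σ ρ)
    (h' : IsTstar α η σ ρ') : ρ = ρ' := by
  refine h.1.isFlat.eq_of_testOffZero h'.1.isFlat fun ψ hψ => ?_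
  obtain ⟨g, hg, e⟩ := h.2 ψ hψ
  obtain ⟨g', hg', e'⟩ := h'.2 ψ hψ
  have : g = g' := by ext y; rw [hg, hg']
  rw [e, e', this]

/-- With τ = σ(F ·) for the extended σ, independence of the cutoff is additivity on F = Fφ + (1 -
φ)F. -/
theorem IsFlat.hasPairing {σ : 𝓢'(ℝ, ℂ)} (hσ : IsFlat σ) {r : ℕ} {F : ℝ → ℂ} (hF : IsTame r F) :
    HasPairing F σ (flatExtend σ F) := by
  have hL := hσ.isFlatFunctional
  obtain ⟨τ, hτ, hτψ⟩ := (hL.comp_mul hF).exists_distribution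
  refine ⟨τ, vanishesToInfiniteOrder_iff_isFlat.2 hτ, fun ψ hψ => ?_, fun φ _ hφ1 => ?_⟩
  · obtain ⟨δ, R, hδ, hR, h0, hinf⟩ := hψ.exists_bounds
    obtain ⟨g, -, hg⟩ := exists_testOffZero (H := fun x => F x * ψ x)
      (fun x hx => (hF.smooth x hx).mul (ψ.contDiffAt_infty x)) hδ
      (fun x hx => by rw [h0 x hx, mul_zero]) (fun x hx => by rw [hinf x hx, mul_zero])
    refine ⟨g, hg, ?_⟩
    rw [hτψ]
    exact hσ.flatExtend_eq g fun x _ => (hg x).symm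
  · have hFφ : IsTame r (fun x => F x * φ x) := hF.mul φ.isTame
    have ht : IsTame r (fun x => F x + (-1) * (F x * φ x)) := hF.add (hFφ.const_mul (-1))
    obtain ⟨g, hg⟩ := ht.exists_schwartz (by
      filter_upwards [hφ1] with x hx
      rw [hx]; simp)
    refine ⟨g, fun x => by rw [hg]; ring, ?_⟩
    have h1 : flatExtend σ (fun x => F x + (-1) * (F x * φ x)) = σ g :=
      hσ.flatExtend_eq g fun x _ => (hg x).symm
    rw [hL.add _ _ _ hF (hFφ.const_mul _), hL.const_mul _ _ _ hFφ] at h1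
    rw [hτψ, ← h1]
    ring

theorem HasPairing.unique {F : ℝ → ℂ} {σ : 𝓢'(ℝ, ℂ)} {c c' : ℂ} (h : HasPairing F σ c)
    (h' : HasPairing F σ c') : c = c' := by
  obtain ⟨τ, hτ, hτψ, hc⟩ := h
  obtain ⟨τ', hτ', hτψ', hc'⟩ := h'
  have hττ : τ = τ' := hτ.isFlat.eq_of_testOffZero hτ'.isFlat fun ψ hψ => by
    obtain ⟨g, hg, e⟩ := hτψ ψ hψ
    obtain ⟨g', hg', e'⟩ := hτψ' ψ hψ
    have : g = g' := by ext y; rw [hg, hg']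
    rw [e, e', this]
  have h1 : ∀ᶠ x in nhds (0 : ℝ), plateau x = 1 := by
    filter_upwards [Metric.ball_mem_nhds (0 : ℝ) one_pos] with x hx
    exact plateau_eq_one (by simpa using (Metric.mem_ball.1 hx).le)
  obtain ⟨g, hg, e⟩ := hc plateau hasCompactSupport_plateau h1
  obtain ⟨g', hg', e'⟩ := hc' plateau hasCompactSupport_plateau h1
  have : g = g' := by ext y; rw [hg, hg']
  rw [e, e', hττ, this]

theorem IsFlat.pairing_eq {σ : 𝓢'(ℝ, ℂ)} (hσ : IsFlat σ) {r : ℕ} {F : ℝ → ℂ} (hF : IsTame r F) :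
    pairing F σ = flatExtend σ F :=
  (Classical.epsilon_spec ⟨_, hσ.hasPairing hF⟩ : HasPairing F σ (pairing F σ)).unique
    (hσ.hasPairing hF)

theorem mainTheorem8 (α : ℂ) (η : ZMod 2) (f : ℝ → ℂ) (hf : IsSis f)
    (σ : 𝓢'(ℝ, ℂ)) (hσ : VanishesToInfiniteOrder σ) :
    (∃! F : ℝ → ℂ, IsTalpha α η f F) ∧
    (∃! ρ : 𝓢'(ℝ, ℂ), IsTstar α η σ ρ) ∧
    (∃! c : ℂ, HasPairing (Talpha α η f) σ c) ∧
    (∃! c : ℂ, HasPairing f (Tstar α η σ) c) ∧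
    pairing (Talpha α η f) σ = pairing f (Tstar α η σ) := by
  have hσ' := hσ.isFlat
  obtain ⟨k, hk⟩ := hf.isTame
  have hTf := isTalpha_twistFourier hk α η
  obtain ⟨ρ, hρ, hρT, hρψ⟩ := hσ'.exists_isTstar α η
  have eT : Talpha α η f = twistFourier α η f :=
    (Classical.epsilon_spec ⟨_, hTf⟩ : IsTalpha α η f (Talpha α η f)).unique hTf
  have eS : Tstar α η σ = ρ :=
    (Classical.epsilon_spec ⟨_, hρT⟩ : IsTstar α η σ (Tstar α η σ)).unique hρT
  have ht := hk.twistFourier α η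
  refine ⟨⟨_, hTf, fun F hF => hF.unique hTf⟩, ⟨_, hρT, fun ρ' h => h.unique hρT⟩, ?_, ?_, ?_⟩
  · rw [eT]
    exact ⟨_, hσ'.hasPairing ht, fun c hc => hc.unique (hσ'.hasPairing ht)⟩
  · rw [eS]
    exact ⟨_, hρ.hasPairing hk, fun c hc => hc.unique (hρ.hasPairing hk)⟩
  · rw [eT, eS, hσ'.pairing_eq ht, hρ.pairing_eq hk]
    -- Both sides are flat functionals of f, hence limits along cutoffs; each cut-off f is Schwartz,
    -- where they agree by the construction of ρ.
    refine tendsto_nhds_unique ((hσ'.isFlatFunctional.comp_twistFourier α η).tendsto hk)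
      ((hρ.isFlatFunctional.tendsto hk).congr fun N => ?_)
    obtain ⟨ψ, -, hψ⟩ := exists_testOffZero_cutoff_mul hk N
    rw [← funext hψ, hρ.flatExtend_coe, hρψ]
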